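/- Let $(M,g)$ be a closed smooth Riemannian manifold (smooth, compact, without boundary) of dimension $m$, let $n\ge 0$ be an integer, and let $N=M\times\mathbf R^n$ carry the product metric $g+g_E$, where $g_E$ is the Euclidean metric. For $1<s<\infty$ let $L^s_1(N)$ be the Sobolev space of all $u\in L^s(N)$ that have a weak gradient $\nabla u\in L^s(N)$, and let $L^s_{1+}(N)$ be the set of its nonnegative elements. For a measurable set $U\subset N$, let $U^*$ be the set whose fibre over each $x\in M$ is the open ball in $\mathbf R^n$ centred at $0$ with the same $n$-dimensional volume as the fibre $\{z\in\mathbf R^n:(x,z)\in U\}$ (the whole of $\mathbf R^n$ if that volume is infinite; if it is $0$, the fibre of $U^*$ is $\{0\}$ or $\emptyset$ according to whether that of $U$ is nonempty or empty). The Steiner symmetrization with respect to $M$ of a nonnegative function $u$ on $N$ is $$u^*(p)=\sup\{c\in\mathbf R : p\in\{u>c\}^*\},$$ which is finite for almost every $p\in N$ if $u\in L^s(N)$. If $u\in L^s_{1+}(N)$, then $u^*\in L^s_{1+}(N)$ and $$\|\nabla u^*\|_s\le\|\nabla u\|_s .$$ -/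

import Mathlib

open MeasureTheory
open scoped Manifold ContDiff ENNReal

noncomputable section

namespace SteinerProduct

/-- The Euclidean space `ℝⁿ`. -/
abbrev Eucl (n : ℕ) : Type := EuclideanSpace ℝ (Fin n)

section Volume

variable {m : ℕ} {M : Type*} [TopologicalSpace M] [ChartedSpace (Eucl m) M]

/-- For the preferred chart `φ` at `x` and a point `y` of its target, `coordVector x y v` is the
tangent vector `d(φ⁻¹)_y v` of `M` at `φ⁻¹ y`; for `v = eᵢ` this is the coordinate vector
field `∂ᵢ`. -/
def coordVector (x : M) (y v : Eucl m) :
    TangentSpace (𝓡 m) ((chartAt (Eucl m) x).symm y) :=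
  mfderiv 𝓘(ℝ, Eucl m) (𝓡 m) (chartAt (Eucl m) x).symm y v

variable [IsManifold (𝓡 m) ∞ M]

/-- A smooth Riemannian metric on the smooth `m`-manifold `M`. -/
abbrev SmoothMetric (m : ℕ) (M : Type*) [TopologicalSpace M] [ChartedSpace (Eucl m) M]
    [IsManifold (𝓡 m) ∞ M] : Type _ :=
  Bundle.ContMDiffRiemannianMetric (𝓡 m) ∞ (Eucl m) (fun x : M => TangentSpace (𝓡 m) x)

/-- The volume density `√(det gᵢⱼ)` in the preferred chart at `x`. -/
def volumeDensity (g : SmoothMetric m M) (x : M) (y : Eucl m) : ℝ :=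
  Real.sqrt (Matrix.det (Matrix.of fun i j : Fin m =>
    g.inner ((chartAt (Eucl m) x).symm y)
      (coordVector x y (EuclideanSpace.single i 1))
      (coordVector x y (EuclideanSpace.single j 1))))

variable [MeasurableSpace M]

/-- The Riemannian volume on the domain of the preferred chart `φ` at `x`, extended by zero:
the image under `φ⁻¹` of the measure `√(det gᵢⱼ) dy` on the target of `φ`. -/
def chartVolume (g : SmoothMetric m M) (x : M) : Measure M :=
  Measure.map (chartAt (Eucl m) x).symm
    ((volume.restrict (chartAt (Eucl m) x).target).withDensity
      fun y => ENNReal.ofReal (volumeDensity g x y))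

/-- The Riemannian volume measure `dV_g` of `M`. The measures `chartVolume g x` agree on the
overlaps of chart domains, and their supremum in the lattice of measures is the measure which
restricts to each of them. -/
def riemannianVolume (g : SmoothMetric m M) : Measure M :=
  ⨆ x : M, chartVolume g x

/-- The Riemannian volume of `N = M × ℝⁿ` with the product metric `g + g_E`. -/
def productVolume (g : SmoothMetric m M) (n : ℕ) : Measure (M × Eucl n) :=
  (riemannianVolume g).prod volume

end Volume

section Sobolev

variable {m n : ℕ} {M : Type*} [TopologicalSpace M] [ChartedSpace (Eucl m) M]

/-- The tangent space `T_p N = T_x M × ℝⁿ` of `N = M × ℝⁿ` at `p = (x, z)`. -/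
abbrev ProdTangent (p : M × Eucl n) : Type :=
  TangentSpace (𝓡 m) p.1 × Eucl n

/-- The inverse of the chart `φ × id` of `N = M × ℝⁿ`, with `φ` the preferred chart at `x`. -/
def prodChartInv (x : M) (q : Eucl m × Eucl n) : M × Eucl n :=
  ((chartAt (Eucl m) x).symm q.1, q.2)

variable [IsManifold (𝓡 m) ∞ M]

/-- The product metric `g + g_E` on `T_p N`. -/
def prodInner (g : SmoothMetric m M) (p : M × Eucl n) (X Y : ProdTangent (m := m) p) : ℝ :=
  g.inner p.1 X.1 Y.1 + inner ℝ X.2 Y.2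

/-- The pointwise length `|X|` of a vector field `X` on `N`, for the product metric. -/
def fieldLength (g : SmoothMetric m M) (X : ∀ p : M × Eucl n, ProdTangent (m := m) p)
    (p : M × Eucl n) : ℝ :=
  Real.sqrt (prodInner g p (X p) (X p))

/-- In the chart `φ × id` (`φ` the preferred chart at `x`), the function `⟨X, w⟩` for the vector
field `X` on `N` and the constant coordinate vector field `w`. -/
def chartCoeff (g : SmoothMetric m M) (X : ∀ p : M × Eucl n, ProdTangent (m := m) p)
    (x : M) (w q : Eucl m × Eucl n) : ℝ :=
  prodInner g (prodChartInv x q) (X (prodChartInv x q)) (coordVector x q.1 w.1, w.2)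

/-- `X` is the weak gradient of `u` on `N = M × ℝⁿ` with the metric `g + g_E`: in every chart
`φ × id`, both are locally integrable, and the distributional derivative of `u` along each constant
coordinate vector field `w` is `⟨X, w⟩`. -/
structure IsWeakGradient (g : SmoothMetric m M) (u : M × Eucl n → ℝ)
    (X : ∀ p : M × Eucl n, ProdTangent (m := m) p) : Prop where
  locallyIntegrable : ∀ x : M,
    LocallyIntegrableOn (fun q : Eucl m × Eucl n => u (prodChartInv x q))
      ((chartAt (Eucl m) x).target ×ˢ Set.univ) volume
  locallyIntegrable_coeff : ∀ (x : M) (w : Eucl m × Eucl n),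
    LocallyIntegrableOn (chartCoeff g X x w) ((chartAt (Eucl m) x).target ×ˢ Set.univ) volume
  integral_eq : ∀ (x : M) (w : Eucl m × Eucl n) (ψ : Eucl m × Eucl n → ℝ),
    ContDiff ℝ ∞ ψ → HasCompactSupport ψ →
    tsupport ψ ⊆ (chartAt (Eucl m) x).target ×ˢ Set.univ →
    ∫ q, u (prodChartInv x q) * fderiv ℝ ψ q w = - ∫ q, chartCoeff g X x w q * ψ q

variable [MeasurableSpace M]

/-- The norm `‖X‖_s` in `L^s(N)` of a vector field on `N`. -/
def fieldNorm (g : SmoothMetric m M) (s : ℝ≥0∞)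
    (X : ∀ p : M × Eucl n, ProdTangent (m := m) p) : ℝ≥0∞ :=
  eLpNorm (fieldLength g X) s (productVolume g n)

/-- `u` belongs to the Sobolev space `L^s_1(N)` of `N = M × ℝⁿ` with the metric `g + g_E`: `u` is
in `L^s(N)` and has a weak gradient in `L^s(N)`. -/
def MemSobolevOne (g : SmoothMetric m M) (s : ℝ≥0∞) (u : M × Eucl n → ℝ) : Prop :=
  MemLp u s (productVolume g n) ∧
    ∃ X : ∀ p : M × Eucl n, ProdTangent (m := m) p,
      IsWeakGradient g u X ∧ MemLp (fieldLength g X) s (productVolume g n)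

/-- `u` belongs to `L^s_{1+}(N)`, the nonnegative functions of `L^s_1(N)`. -/
def MemSobolevOnePos (g : SmoothMetric m M) (s : ℝ≥0∞) (u : M × Eucl n → ℝ) : Prop :=
  MemSobolevOne g s u ∧ 0 ≤ᵐ[productVolume g n] u

end Sobolev

section Steiner

variable {n : ℕ} {M : Type*}

/-- The fibre of `U ⊆ M × ℝⁿ` over `x`. -/
def fiber (U : Set (M × Eucl n)) (x : M) : Set (Eucl n) := {z | (x, z) ∈ U}

/-- The Steiner symmetrization of `U ⊆ M × ℝⁿ` with respect to `M`: the fibre over `x` is the open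
ball centred at the origin with the same volume as the fibre of `U` over `x` (all of `ℝⁿ` if this
volume is infinite). If the fibre of `U` has volume zero, it is replaced by `{0}` or `∅`, according
to whether it is nonempty or empty. -/
def steinerSet (U : Set (M × Eucl n)) : Set (M × Eucl n) :=
  {p | volume (Metric.ball (0 : Eucl n) ‖p.2‖) < volume (fiber U p.1) ∨
    (p.2 = 0 ∧ (fiber U p.1).Nonempty)}

/-- The Steiner symmetrization `u*` with respect to `M` of a function `u` on `M × ℝⁿ`:
`u*(p)` is the supremum of all `c` such that `p` belongs to the symmetrization of `{u > c}`. -/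
def steiner (u : M × Eucl n → ℝ) (p : M × Eucl n) : ℝ :=
  sSup {c : ℝ | p ∈ steinerSet {q | c < u q}}

end Steiner

end SteinerProduct

end

/-!
Steiner symmetrization with respect to `M` is approximated by polarizations (two-point
symmetrizations) in the second variable. For a half-space `H` of `ℝⁿ` with boundary reflection `σ`,
the polarization of `u` is the larger of `u (x, z)` and `u (x, σ z)` for `z ∈ H`, and the smaller
one for `z ∉ H`. The reflection `(x, z) ↦ (x, σ z)` is an isometry of `N = M × ℝⁿ`, and the gradient
of the polarization is at each point `∇u` or its reflection, in such a way that the two values at a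
pair of mirror points are only exchanged. Hence polarization does not change `‖∇u‖_s`
(`IsWeakGradient.polField`, `fieldNorm_polField`). That the gradients fit together on the mirror is
checked on lines: along a direction which the reflection maps to a multiple of itself, an integrable
function with an integrable weak derivative is absolutely continuous on almost every line, and the
polarization of such a function is again absolutely continuous (`absolutelyContinuous_selection`,
`HasWeakDeriv.polarize`). Every direction of `ℝᵐ × ℝⁿ` is the sum of two such directions.

A universal sequence of polarizations converges to the symmetrization
(`tendsto_integral_sweep`): for half-spaces dense among those with the origin in their interior, the
successive sweeps, the `k`-th of which applies the first `k` polarizations to the result of the one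
before, converge in `L¹(ℝⁿ)` to the symmetric decreasing rearrangement of any nonnegative integrable
function. Polarization and
rearrangement are contractions of `L¹` (`integral_abs_sub_le_of_sup`), so it is enough to consider
continuous functions of compact support. For these the sweeps are compact by Arzelà–Ascoli, and the
integral against the radially decreasing weight `(1 + |z|²)⁻¹`, which polarizations increase, shows
that a limit point is invariant under all polarizations in the sequence, hence radially decreasing.
Since polarization and rearrangement commute with `t ↦ t ^ s` and `|a - b| ^ s ≤ |a ^ s - b ^ s|`,
this gives convergence in `L^s` of the fibrewise sweeps of `u` to `u*`
(`tendsto_eLpNorm_prodSweep`).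

Finally the norm of the gradient is lower semicontinuous for convergence in `L^s`
(`exists_isWeakGradient_of_tendsto`). Instead of weak compactness the proof uses uniform convexity:
among the gradients of functions which are `L^s`-close to the limit and whose norms obey the bound,
near-minimizers of the norm form a Cauchy sequence (`exists_cauchy_minimizers`), whose limit is the
gradient of the limit function. Weak gradients of the same function have almost everywhere the same
length (`IsWeakGradient.fieldLength_ae_eq`), so that the inequality holds for any choice of them.
-/

noncomputable section

namespace SteinerProduct

/-! ### Polarization with respect to an involution -/

section Polarization

variable {α : Type*}

/-- `σ` behaves like the reflection in the zero set of `h`: it is an involution which changes the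
sign of `h` and fixes the points where `h` vanishes. The half-space `{h > 0}` is the preferred
side. -/
structure IsReflection (σ : α → α) (h : α → ℝ) : Prop where
  invol : ∀ p, σ (σ p) = p
  anti : ∀ p, h (σ p) = -h p
  fix : ∀ p, h p = 0 → σ p = p

/-- The points at which polarization exchanges the values of `f` at `p` and `σ p`: those where the
larger of the two values is not on the side `{h > 0}`. -/
def swapSet (σ : α → α) (h : α → ℝ) (f : α → ℝ) : Set α := {p | 0 < h p * (f (σ p) - f p)}

open Classical in
/-- The polarization (two-point symmetrization) of `f`: on `{h > 0}` the larger, and on `{h < 0}`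
the smaller, of the values of `f` at `p` and `σ p`. -/
def polarize (σ : α → α) (h : α → ℝ) (f : α → ℝ) (p : α) : ℝ :=
  if p ∈ swapSet σ h f then f (σ p) else f p

variable {σ : α → α} {h : α → ℝ}

lemma polarize_of_pos {f : α → ℝ} {p : α} (hp : 0 < h p) :
    polarize σ h f p = max (f p) (f (σ p)) := by
  unfold polarize swapSet
  simp only [Set.mem_ofPred_eq, mul_pos_iff_of_pos_left hp, sub_pos]
  split_ifs with H
  · rw [max_eq_right H.le]
  · rw [max_eq_left (not_lt.1 H)]

lemma polarize_of_neg {f : α → ℝ} {p : α} (hp : h p < 0) :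
    polarize σ h f p = min (f p) (f (σ p)) := by
  unfold polarize swapSet
  have : 0 < h p * (f (σ p) - f p) ↔ f (σ p) < f p :=
    ⟨fun H => by nlinarith, fun H => by nlinarith⟩
  simp only [Set.mem_ofPred_eq, this]
  split_ifs with H
  · rw [min_eq_right H.le]
  · rw [min_eq_left (not_lt.1 H)]

lemma polarize_of_zero {f : α → ℝ} {p : α} (hp : h p = 0) : polarize σ h f p = f p := by
  simp [polarize, swapSet, hp]

lemma polarize_eq_or (f : α → ℝ) (p : α) :
    polarize σ h f p = f p ∨ polarize σ h f p = f (σ p) := by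
  unfold polarize; split_ifs <;> simp

lemma polarize_mono {f g : α → ℝ} (hfg : ∀ p, f p ≤ g p) (p : α) :
    polarize σ h f p ≤ polarize σ h g p := by
  rcases lt_trichotomy (h p) 0 with H | H | H
  · rw [polarize_of_neg H, polarize_of_neg H]; exact min_le_min (hfg _) (hfg _)
  · rw [polarize_of_zero H, polarize_of_zero H]; exact hfg _
  · rw [polarize_of_pos H, polarize_of_pos H]; exact max_le_max (hfg _) (hfg _)

lemma polarize_nonneg {f : α → ℝ} (hf : ∀ p, 0 ≤ f p) (p : α) : 0 ≤ polarize σ h f p := by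
  rcases polarize_eq_or (σ := σ) (h := h) f p with H | H <;> rw [H] <;> exact hf _

/-- Polarization commutes with increasing functions of the value. -/
lemma polarize_comp {f : α → ℝ} {φ : ℝ → ℝ} (hφ : StrictMonoOn φ (Set.Ici 0))
    (hf : ∀ p, 0 ≤ f p) (p : α) :
    polarize σ h (fun q => φ (f q)) p = φ (polarize σ h f p) := by
  have hm : MonotoneOn φ (Set.Ici 0) := hφ.monotoneOn
  rcases lt_trichotomy (h p) 0 with H | H | H
  · rw [polarize_of_neg H, polarize_of_neg H]
    rcases le_total (f p) (f (σ p)) with h1 | h1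
    · rw [min_eq_left h1, min_eq_left (hm (hf _) (hf _) h1)]
    · rw [min_eq_right h1, min_eq_right (hm (hf _) (hf _) h1)]
  · rw [polarize_of_zero H, polarize_of_zero H]
  · rw [polarize_of_pos H, polarize_of_pos H]
    rcases le_total (f p) (f (σ p)) with h1 | h1
    · rw [max_eq_right h1, max_eq_right (hm (hf _) (hf _) h1)]
    · rw [max_eq_left h1, max_eq_left (hm (hf _) (hf _) h1)]

lemma IsReflection.mem_swapSet (hσ : IsReflection σ h) {f : α → ℝ} {p : α} :
    σ p ∈ swapSet σ h f ↔ p ∈ swapSet σ h f := by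
  simp only [swapSet, Set.mem_ofPred_eq, hσ.invol, hσ.anti]
  rw [show -h p * (f p - f (σ p)) = h p * (f (σ p) - f p) by ring]

lemma IsReflection.polarize_sub (hσ : IsReflection σ h) (f : α → ℝ) (p : α) :
    polarize σ h f (σ p) - f (σ p) = -(polarize σ h f p - f p) := by
  unfold polarize
  rw [hσ.mem_swapSet, hσ.invol]
  split_ifs <;> ring

lemma IsReflection.mul_polarize_sub_nonneg (f : α → ℝ) (p : α) :
    0 ≤ h p * (polarize σ h f p - f p) := by
  unfold polarize
  split_ifs with H
  · exact le_of_lt H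
  · simp

/-- A reflection as a measurable equivalence. -/
def IsReflection.measurableEquiv [MeasurableSpace α] (hσ : IsReflection σ h) (hm : Measurable σ) :
    α ≃ᵐ α where
  toFun := σ
  invFun := σ
  left_inv := hσ.invol
  right_inv := hσ.invol
  measurable_toFun := hm
  measurable_invFun := hm

variable [MeasurableSpace α] {μ : Measure α}

lemma measurableSet_swapSet {f : α → ℝ} (hσ : Measurable σ) (hh : Measurable h)
    (hf : Measurable f) : MeasurableSet (swapSet σ h f) :=
  measurableSet_lt measurable_const (hh.mul ((hf.comp hσ).sub hf))

lemma measurable_polarize {f : α → ℝ} (hσ : Measurable σ) (hh : Measurable h)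
    (hf : Measurable f) : Measurable (polarize σ h f) :=
  Measurable.ite (measurableSet_swapSet hσ hh hf) (hf.comp hσ) hf

open Classical in
/-- Exchanging the values of `G` at `p` and `σ p` on a `σ`-invariant set does not change the
integral. -/
lemma IsReflection.lintegral_ite (hσ : IsReflection σ h) (hm : MeasurePreserving σ μ μ)
    {S : Set α} (hS : MeasurableSet S) (hS' : ∀ p, σ p ∈ S ↔ p ∈ S) (G : α → ℝ≥0∞) :
    ∫⁻ p, (if p ∈ S then G (σ p) else G p) ∂μ = ∫⁻ p, G p ∂μ := by
  rw [← lintegral_add_compl _ hS, ← lintegral_add_compl G hS]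
  congr 1
  · rw [setLIntegral_congr_fun (g := fun p => G (σ p)) hS (fun p hp => by simp [hp])]
    have := hm.setLIntegral_comp_preimage_emb
      (hσ.measurableEquiv hm.measurable).measurableEmbedding G S
    rw [show σ ⁻¹' S = S from Set.ext hS'] at this
    exact this
  · exact setLIntegral_congr_fun hS.compl (fun p hp => by simp [show p ∉ S from hp])

lemma IsReflection.lintegral_polarize (hσ : IsReflection σ h) (hm : MeasurePreserving σ μ μ)
    (hh : Measurable h) {f : α → ℝ} (hf : Measurable f) (Ψ : ℝ → ℝ≥0∞) :
    ∫⁻ p, Ψ (polarize σ h f p) ∂μ = ∫⁻ p, Ψ (f p) ∂μ := by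
  rw [← hσ.lintegral_ite hm (measurableSet_swapSet hm.measurable hh hf)
    (fun p => hσ.mem_swapSet) (fun p => Ψ (f p))]
  refine lintegral_congr fun p => ?_
  unfold polarize
  split_ifs <;> rfl

lemma IsReflection.measure_lt_polarize (hσ : IsReflection σ h) (hm : MeasurePreserving σ μ μ)
    (hh : Measurable h) {f : α → ℝ} (hf : Measurable f) (c : ℝ) :
    μ {p | c < polarize σ h f p} = μ {p | c < f p} := by
  have := hσ.lintegral_polarize hm hh hf ((Set.Ioi c).indicator 1)
  have e : ∀ g : α → ℝ, Measurable g →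
      ∫⁻ p, (Set.Ioi c).indicator 1 (g p) ∂μ = μ {p | c < g p} := by
    intro g hg
    rw [← lintegral_indicator_one (measurableSet_lt measurable_const hg)]
    rfl
  rwa [e _ (measurable_polarize hm.measurable hh hf), e _ hf] at this

lemma IsReflection.integrable_polarize (hσ : IsReflection σ h) (hm : MeasurePreserving σ μ μ)
    (hh : Measurable h) {f : α → ℝ} (hf : Measurable f) (hi : Integrable f μ) :
    Integrable (polarize σ h f) μ := by
  refine ⟨(measurable_polarize hm.measurable hh hf).aestronglyMeasurable, ?_⟩
  have := hσ.lintegral_polarize hm hh hf (fun x => ‖x‖ₑ)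
  unfold HasFiniteIntegral
  rw [this]; exact hi.2

lemma IsReflection.integral_polarize (hσ : IsReflection σ h) (hm : MeasurePreserving σ μ μ)
    (hh : Measurable h) {f : α → ℝ} (hf : Measurable f) (hi : Integrable f μ) :
    ∫ p, polarize σ h f p ∂μ = ∫ p, f p ∂μ := by
  rw [integral_eq_lintegral_pos_part_sub_lintegral_neg_part
    (hσ.integrable_polarize hm hh hf hi), integral_eq_lintegral_pos_part_sub_lintegral_neg_part hi,
    hσ.lintegral_polarize hm hh hf (fun x => ENNReal.ofReal x),
    hσ.lintegral_polarize hm hh hf (fun x => ENNReal.ofReal (-x))]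

end Polarization

/-! ### Order-preserving maps which preserve integrals are `L¹`-contractions -/

/-- The Crandall–Tartar argument: if `F` and `G` have the same integrals as `f` and `g`, and are
both dominated by some `K` with the same integral as `f ⊔ g`, then `‖F - G‖₁ ≤ ‖f - g‖₁`. -/
lemma integral_abs_sub_le_of_sup {α : Type*} [MeasurableSpace α] {μ : Measure α}
    {f g F G K : α → ℝ} (hf : Integrable f μ) (hg : Integrable g μ) (hF : Integrable F μ)
    (hG : Integrable G μ) (hK : Integrable K μ) (hFf : ∫ p, F p ∂μ = ∫ p, f p ∂μ)
    (hGg : ∫ p, G p ∂μ = ∫ p, g p ∂μ) (hKs : ∫ p, K p ∂μ = ∫ p, max (f p) (g p) ∂μ)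
    (hFK : F ≤ᵐ[μ] K) (hGK : G ≤ᵐ[μ] K) :
    ∫ p, |F p - G p| ∂μ ≤ ∫ p, |f p - g p| ∂μ := by
  have e1 : ∫ p, |f p - g p| ∂μ = 2 * ∫ p, max (f p) (g p) ∂μ - ∫ p, f p ∂μ - ∫ p, g p ∂μ := by
    have hs : Integrable (fun p => max (f p) (g p)) μ := hf.sup hg
    have hs2 : Integrable (fun p => 2 * max (f p) (g p) - f p) μ := (hs.const_mul 2).sub hf
    rw [← integral_const_mul, ← integral_sub (hs.const_mul 2) hf, ← integral_sub hs2 hg]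
    refine integral_congr_ae (Filter.Eventually.of_forall fun p => ?_)
    simp only
    rcases le_total (f p) (g p) with H | H
    · rw [max_eq_right H, abs_of_nonpos (by linarith)]; ring
    · rw [max_eq_left H, abs_of_nonneg (by linarith)]; ring
  have e2 : ∫ p, |F p - G p| ∂μ ≤ 2 * ∫ p, K p ∂μ - ∫ p, F p ∂μ - ∫ p, G p ∂μ := by
    have hK2 : Integrable (fun p => 2 * K p - F p) μ := (hK.const_mul 2).sub hF
    rw [← integral_const_mul, ← integral_sub (hK.const_mul 2) hF, ← integral_sub hK2 hG]
    refine integral_mono_ae (hF.sub hG).abs (((hK.const_mul 2).sub hF).sub hG) ?_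
    filter_upwards [hFK, hGK] with p h1 h2
    rw [abs_le]; constructor <;> linarith
  rw [e1]; rw [hKs, hFf, hGg] at e2; exact e2

section Polarization

variable {α : Type*} [MeasurableSpace α] {μ : Measure α} {σ : α → α} {h : α → ℝ}

lemma IsReflection.integral_abs_polarize_sub_le (hσ : IsReflection σ h)
    (hm : MeasurePreserving σ μ μ) (hh : Measurable h) {f g : α → ℝ} (hf : Measurable f)
    (hg : Measurable g) (hfi : Integrable f μ) (hgi : Integrable g μ) :
    ∫ p, |polarize σ h f p - polarize σ h g p| ∂μ ≤ ∫ p, |f p - g p| ∂μ := by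
  have hs : Measurable fun p => max (f p) (g p) := hf.max hg
  exact integral_abs_sub_le_of_sup hfi hgi (hσ.integrable_polarize hm hh hf hfi)
    (hσ.integrable_polarize hm hh hg hgi) (hσ.integrable_polarize hm hh hs (hfi.sup hgi))
    (hσ.integral_polarize hm hh hf hfi) (hσ.integral_polarize hm hh hg hgi)
    (hσ.integral_polarize hm hh hs (hfi.sup hgi))
    (Filter.Eventually.of_forall (polarize_mono fun p => le_max_left _ _))
    (Filter.Eventually.of_forall (polarize_mono fun p => le_max_right _ _))

end Polarization

/-! ### Reflections of Euclidean space -/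

section Reflect

variable {n : ℕ}

/-- The affine function `t - ⟨z, e⟩`, positive on the half-space which contains the origin when
`0 < t`. -/
def height (e : Eucl n) (t : ℝ) (z : Eucl n) : ℝ := t - inner ℝ z e

/-- The reflection of `ℝⁿ` in the hyperplane `⟨z, e⟩ = t`, for a unit vector `e`. -/
def reflect (e : Eucl n) (t : ℝ) (z : Eucl n) : Eucl n := z + (2 * height e t z) • e

lemma height_reflect {e : Eucl n} (he : ‖e‖ = 1) (t : ℝ) (z : Eucl n) :
    height e t (reflect e t z) = -height e t z := by
  have : inner ℝ e e = (1 : ℝ) := by rw [real_inner_self_eq_norm_sq, he]; norm_num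
  simp only [reflect, height, inner_add_left, inner_smul_left, this, map_mul, conj_trivial]
  ring

lemma isReflection_reflect {e : Eucl n} (he : ‖e‖ = 1) (t : ℝ) :
    IsReflection (reflect e t) (height e t) where
  invol z := by
    have := height_reflect he t z
    rw [reflect, this, reflect]
    module
  anti := height_reflect he t
  fix z hz := by simp [reflect, hz]

lemma continuous_height (e : Eucl n) (t : ℝ) : Continuous (height e t) := by
  unfold height; fun_prop

lemma continuous_reflect (e : Eucl n) (t : ℝ) : Continuous (reflect e t) := by
  unfold reflect height; fun_prop

lemma reflect_eq_reflection {e : Eucl n} (he : ‖e‖ = 1) (t : ℝ) (z : Eucl n) :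
    reflect e t z = (ℝ ∙ e)ᗮ.reflection z + (2 * t) • e := by
  rw [Submodule.reflection_orthogonal_apply, Submodule.reflection_singleton_apply, he, reflect,
    height, real_inner_comm]
  simp only [RCLike.ofReal_real_eq_id, id, one_pow, div_one]
  module

lemma measurePreserving_reflect {e : Eucl n} (he : ‖e‖ = 1) (t : ℝ) :
    MeasurePreserving (reflect e t) := by
  rw [show reflect e t = (fun z => z + (2 * t) • e) ∘ (ℝ ∙ e)ᗮ.reflection from
    funext (reflect_eq_reflection he t)]
  exact (measurePreserving_add_right volume _).comp
    ((ℝ ∙ e)ᗮ.reflection.measurePreserving)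

lemma dist_reflect_reflect {e : Eucl n} (he : ‖e‖ = 1) (t : ℝ) (y z : Eucl n) :
    dist (reflect e t y) (reflect e t z) = dist y z := by
  rw [reflect_eq_reflection he, reflect_eq_reflection he, dist_add_right,
    LinearIsometryEquiv.dist_map]

/-- The linear part of `reflect e t`. -/
def linReflect (e : Eucl n) : Eucl n ≃ₗᵢ[ℝ] Eucl n := (ℝ ∙ e)ᗮ.reflection

lemma linReflect_apply {e : Eucl n} (he : ‖e‖ = 1) (z : Eucl n) :
    linReflect e z = z - (2 * inner ℝ z e) • e := by
  have := reflect_eq_reflection he 0 z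
  simp only [reflect, height, mul_zero, zero_smul, add_zero, zero_sub] at this
  rw [linReflect, ← this]
  module

lemma norm_sq_reflect {e : Eucl n} (he : ‖e‖ = 1) (t : ℝ) (z : Eucl n) :
    ‖reflect e t z‖ ^ 2 = ‖z‖ ^ 2 + 4 * height e t z * t := by
  rw [reflect, norm_add_sq_real, norm_smul, he, inner_smul_right, height]
  rw [Real.norm_eq_abs, mul_one, sq_abs]
  ring

lemma norm_lt_norm_reflect {e : Eucl n} (he : ‖e‖ = 1) {t : ℝ} (ht : 0 < t) {z : Eucl n}
    (hz : 0 < height e t z) : ‖z‖ < ‖reflect e t z‖ := by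
  have := norm_sq_reflect he t z
  have h2 : 0 < height e t z * t := mul_pos hz ht
  exact lt_of_pow_lt_pow_left₀ 2 (norm_nonneg _) (by linarith)

/-- Points on opposite sides of the hyperplane come no further apart when one of them is
reflected. -/
lemma dist_reflect_le {e : Eucl n} (he : ‖e‖ = 1) {t : ℝ} {y z : Eucl n}
    (h : height e t y * height e t z ≤ 0) : dist y (reflect e t z) ≤ dist y z := by
  have h1 : dist y (reflect e t z) ^ 2 = dist y z ^ 2 + 4 * (height e t y * height e t z) := by
    rw [dist_eq_norm, dist_eq_norm, reflect,
      show y - (z + (2 * height e t z) • e) = (y - z) - (2 * height e t z) • e by abel,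
      norm_sub_sq_real, norm_smul, he, inner_smul_right, inner_sub_left, Real.norm_eq_abs,
      mul_one, sq_abs]
    simp only [height]
    ring
  exact le_of_sq_le_sq (by linarith) dist_nonneg

/-- Any two points of different norm are exchanged by a reflection which has the one of smaller
norm, and the origin, on its preferred side. -/
lemma exists_reflect_eq {y z : Eucl n} (h : ‖z‖ < ‖y‖) :
    ∃ e : Eucl n, ‖e‖ = 1 ∧ ∃ t : ℝ, 0 < t ∧ 0 < height e t z ∧ reflect e t z = y := by
  have hne : y - z ≠ 0 := by
    intro H; rw [sub_eq_zero.1 H] at h; exact lt_irrefl _ h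
  have hd : 0 < ‖y - z‖ := norm_pos_iff.2 hne
  have hh : height (‖y - z‖⁻¹ • (y - z)) ((‖y‖ ^ 2 - ‖z‖ ^ 2) / (2 * ‖y - z‖)) z
      = ‖y - z‖ / 2 := by
    rw [height, inner_smul_right, inner_sub_right, real_inner_self_eq_norm_sq]
    have h2 := norm_sub_sq_real y z
    rw [real_inner_comm] at h2
    field_simp
    linarith
  refine ⟨‖y - z‖⁻¹ • (y - z), by rw [norm_smul, norm_inv, norm_norm, inv_mul_cancel₀ hd.ne'],
    (‖y‖ ^ 2 - ‖z‖ ^ 2) / (2 * ‖y - z‖),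
    ?_, ?_, ?_⟩
  · apply div_pos _ (by positivity)
    nlinarith [norm_nonneg z]
  · rw [hh]; positivity
  · rw [reflect, hh, smul_smul]
    rw [show 2 * (‖y - z‖ / 2) * ‖y - z‖⁻¹ = 1 by field_simp]
    simp

end Reflect

/-! ### The symmetric decreasing rearrangement on `ℝⁿ` -/

section Rearrangement

variable {n : ℕ}

/-- The symmetric decreasing rearrangement of a function on `ℝⁿ`, with the value at the origin that
makes `steiner u` the fibrewise rearrangement of `u`. -/
def rearr (f : Eucl n → ℝ) (z : Eucl n) : ℝ :=
  sSup {c : ℝ | volume (Metric.ball (0 : Eucl n) ‖z‖) < volume {y | c < f y} ∨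
    (z = 0 ∧ {y | c < f y}.Nonempty)}

lemma steiner_eq_rearr {M : Type*} (u : M × Eucl n → ℝ) (p : M × Eucl n) :
    steiner u p = rearr (fun z => u (p.1, z)) p.2 := rfl

/-- A measurable nonnegative function all of whose positive superlevel sets have finite volume. -/
structure Vanishing (f : Eucl n → ℝ) : Prop where
  measurable : Measurable f
  nonneg : ∀ z, 0 ≤ f z
  finite : ∀ c > 0, volume {y | c < f y} < ⊤

lemma Vanishing.of_integrable {f : Eucl n → ℝ} (hm : Measurable f) (h0 : ∀ z, 0 ≤ f z)
    (hi : Integrable f) : Vanishing f :=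
  ⟨hm, h0, fun _ hc => hi.measure_gt_lt_top hc⟩

lemma rearr_of_ne_zero (f : Eucl n → ℝ) {z : Eucl n} (hz : z ≠ 0) :
    rearr f z = sSup {c : ℝ | volume (Metric.ball (0 : Eucl n) ‖z‖) < volume {y | c < f y}} := by
  simp [rearr, hz]

lemma Vanishing.tendsto {f : Eucl n → ℝ} (hf : Vanishing f) :
    Filter.Tendsto (fun k : ℕ => volume {y | (k : ℝ) + 1 < f y}) Filter.atTop (nhds 0) := by
  have := tendsto_measure_iInter_atTop (μ := (volume : Measure (Eucl n)))
    (s := fun k : ℕ => {y | (k : ℝ) + 1 < f y})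
    (fun k => (measurableSet_lt measurable_const hf.measurable).nullMeasurableSet)
    (fun i j hij y (hy : (j : ℝ) + 1 < f y) => lt_of_le_of_lt
      (by have : (i : ℝ) ≤ j := by exact_mod_cast hij
          linarith) hy)
    ⟨0, (hf.finite _ (by norm_num)).ne⟩
  have e : ⋂ k : ℕ, {y | (k : ℝ) + 1 < f y} = ∅ := by
    ext y
    simp only [Set.mem_iInter, Set.mem_ofPred_eq, Set.mem_empty_iff_false, iff_false, not_forall,
      not_lt]
    obtain ⟨k, hk⟩ := exists_nat_ge (f y)
    exact ⟨k, by linarith⟩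
  rwa [e, measure_empty] at this

lemma rearr_congr {f g : Eucl n → ℝ}
    (h : ∀ c, volume {y | c < f y} = volume {y | c < g y}) {z : Eucl n} (hz : z ≠ 0) :
    rearr f z = rearr g z := by
  rw [rearr_of_ne_zero f hz, rearr_of_ne_zero g hz]
  simp only [h]

lemma Vanishing.bddAbove {f : Eucl n → ℝ} (hf : Vanishing f) {z : Eucl n} (hz : z ≠ 0) :
    BddAbove {c : ℝ | volume (Metric.ball (0 : Eucl n) ‖z‖) < volume {y | c < f y}} := by
  have hpos : 0 < volume (Metric.ball (0 : Eucl n) ‖z‖) :=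
    Metric.measure_ball_pos _ _ (norm_pos_iff.2 hz)
  obtain ⟨k, hk⟩ := (hf.tendsto.eventually_lt_const hpos).exists
  refine ⟨k + 1, fun c hc => ?_⟩
  by_contra H
  refine lt_asymm hk (lt_of_lt_of_le hc (measure_mono fun y hy => ?_))
  exact lt_trans (not_le.1 H) hy

variable [NeZero n]

lemma volume_ball_lt_iff {r R : ℝ} (hr : 0 ≤ r) (hR : 0 ≤ R) :
    volume (Metric.ball (0 : Eucl n) r) < volume (Metric.ball (0 : Eucl n) R) ↔ r < R := by
  have mono : ∀ {a b : ℝ}, 0 ≤ a → a < b →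
      volume (Metric.ball (0 : Eucl n) a) < volume (Metric.ball (0 : Eucl n) b) := by
    intro a b ha hab
    rw [Measure.addHaar_ball volume 0 ha, Measure.addHaar_ball volume 0 (ha.trans hab.le)]
    refine ENNReal.mul_lt_mul_left (Metric.measure_ball_pos _ _ one_pos).ne'
      measure_ball_lt_top.ne ?_
    rw [finrank_euclideanSpace_fin]
    exact (ENNReal.ofReal_lt_ofReal_iff (pow_pos (ha.trans_lt hab) _)).2
      (pow_lt_pow_left₀ hab ha (NeZero.ne n))
  refine ⟨fun h => ?_, mono hr⟩
  by_contra H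
  rcases (not_lt.1 H).eq_or_lt with h1 | h1
  · rw [h1] at h; exact lt_irrefl _ h
  · exact lt_asymm h (mono hR h1)

lemma exists_volume_ball_eq {V : ℝ≥0∞} (hV : V ≠ ⊤) :
    ∃ r : ℝ, 0 ≤ r ∧ volume (Metric.ball (0 : Eucl n) r) = V := by
  set B := volume (Metric.ball (0 : Eucl n) 1)
  have hB : B ≠ 0 := (Metric.measure_ball_pos _ _ one_pos).ne'
  have hB' : B ≠ ⊤ := measure_ball_lt_top.ne
  refine ⟨(V / B).toReal ^ ((n : ℝ)⁻¹), by positivity, ?_⟩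
  rw [Measure.addHaar_ball volume 0 (by positivity), finrank_euclideanSpace_fin,
    ← Real.rpow_natCast, ← Real.rpow_mul ENNReal.toReal_nonneg,
    inv_mul_cancel₀ (by exact_mod_cast NeZero.ne n), Real.rpow_one,
    ENNReal.ofReal_toReal (ENNReal.div_ne_top hV hB), ENNReal.div_mul_cancel hB hB']

/-- The supremum in the definition of the rearrangement is not attained, because the volumes of the
superlevel sets depend right-continuously on the level. -/
lemma Vanishing.lt_rearr_iff {f : Eucl n → ℝ} (hf : Vanishing f) {z : Eucl n} (hz : z ≠ 0)
    (c : ℝ) :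
    c < rearr f z ↔ volume (Metric.ball (0 : Eucl n) ‖z‖) < volume {y | c < f y} := by
  rw [rearr_of_ne_zero f hz]
  constructor
  · intro h
    have hne : {c : ℝ | volume (Metric.ball (0 : Eucl n) ‖z‖) < volume {y | c < f y}}.Nonempty := by
      refine ⟨-1, ?_⟩
      have : {y | (-1 : ℝ) < f y} = Set.univ := by
        ext y; simpa using lt_of_lt_of_le (by norm_num) (hf.nonneg y)
      simp only [Set.mem_ofPred_eq, this]
      rw [measure_univ_of_isAddLeftInvariant]
      exact measure_ball_lt_top
    obtain ⟨c', hc', hlt⟩ := exists_lt_of_lt_csSup hne h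
    exact lt_of_lt_of_le hc' (measure_mono fun y hy => lt_trans hlt hy)
  · intro h
    have e : {y | c < f y} = ⋃ k : ℕ, {y | c + 1 / ((k : ℝ) + 1) < f y} := by
      ext y
      simp only [Set.mem_ofPred_eq, Set.mem_iUnion]
      constructor
      · intro hy
        obtain ⟨k, hk⟩ := exists_nat_one_div_lt (sub_pos.2 hy)
        exact ⟨k, by linarith⟩
      · rintro ⟨k, hk⟩
        have : (0 : ℝ) < 1 / ((k : ℝ) + 1) := by positivity
        linarith
    have hm : Monotone fun k : ℕ => {y | c + 1 / ((k : ℝ) + 1) < f y} := by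
      intro i j hij y (hy : c + 1 / ((i : ℝ) + 1) < f y)
      have : 1 / ((j : ℝ) + 1) ≤ 1 / ((i : ℝ) + 1) := Nat.one_div_le_one_div hij
      show c + 1 / ((j : ℝ) + 1) < f y
      linarith
    have ht := tendsto_measure_iUnion_atTop (μ := (volume : Measure (Eucl n))) hm
    rw [← e] at ht
    obtain ⟨k, hk⟩ := (ht.eventually_const_lt h).exists
    refine lt_of_lt_of_le ?_ (le_csSup (hf.bddAbove hz) hk)
    have : (0 : ℝ) < 1 / ((k : ℝ) + 1) := by positivity
    linarith

lemma Vanishing.rearr_nonneg {f : Eucl n → ℝ} (hf : Vanishing f) {z : Eucl n} (hz : z ≠ 0) :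
    0 ≤ rearr f z := by
  refine le_of_forall_lt fun c hc => (hf.lt_rearr_iff hz c).2 ?_
  have : {y | c < f y} = Set.univ := by
    ext y; simpa using lt_of_lt_of_le hc (hf.nonneg y)
  rw [this, measure_univ_of_isAddLeftInvariant]
  exact measure_ball_lt_top

lemma ae_ne_zero : ∀ᵐ z : Eucl n, z ≠ 0 := by
  rw [ae_iff]; simp

lemma Vanishing.rearr_mono {f g : Eucl n → ℝ} (hf : Vanishing f) (hg : Vanishing g)
    (h : ∀ z, f z ≤ g z) {z : Eucl n} (hz : z ≠ 0) : rearr f z ≤ rearr g z := by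
  refine le_of_forall_lt fun c hc => (hg.lt_rearr_iff hz c).2 ?_
  exact ((hf.lt_rearr_iff hz c).1 hc).trans_le (measure_mono fun y hy => lt_of_lt_of_le hy (h y))

/-- Rearrangement commutes with powers. -/
lemma Vanishing.rearr_rpow {f : Eucl n → ℝ} (hf : Vanishing f) {r : ℝ} (hr : 0 < r)
    (hf' : Vanishing fun z => f z ^ r) {z : Eucl n} (hz : z ≠ 0) :
    rearr (fun y => f y ^ r) z = rearr f z ^ r := by
  have h0 := hf.rearr_nonneg hz
  refine eq_of_forall_lt_iff fun c => ?_
  rcases lt_or_ge c 0 with hc | hc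
  · exact ⟨fun _ => hc.trans_le (Real.rpow_nonneg h0 _),
      fun _ => hc.trans_le (hf'.rearr_nonneg hz)⟩
  · have key : ∀ a : ℝ, 0 ≤ a → (c < a ^ r ↔ c ^ r⁻¹ < a) := fun a ha =>
      (Real.rpow_inv_lt_iff_of_pos hc ha hr).symm
    rw [hf'.lt_rearr_iff hz, key _ h0, hf.lt_rearr_iff hz]
    simp only [fun y => key _ (hf.nonneg y)]

lemma Vanishing.exists_radius {f : Eucl n → ℝ} (hf : Vanishing f) {c : ℝ} (hc : 0 < c) :
    ∃ r : ℝ, 0 ≤ r ∧ volume (Metric.ball (0 : Eucl n) r) = volume {y | c < f y} ∧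
      ∀ z ≠ 0, (c < rearr f z ↔ z ∈ Metric.ball (0 : Eucl n) r) := by
  obtain ⟨r, hr, hV⟩ := exists_volume_ball_eq (n := n) (hf.finite c hc).ne
  refine ⟨r, hr, hV, fun z hz => ?_⟩
  rw [hf.lt_rearr_iff hz, ← hV, volume_ball_lt_iff (norm_nonneg _) hr, mem_ball_zero_iff]

lemma Vanishing.aemeasurable_rearr {f : Eucl n → ℝ} (hf : Vanishing f) :
    AEMeasurable (rearr f) := by
  refine ⟨fun z => if z = 0 then 0 else rearr f z, measurable_of_Ioi fun c => ?_, ?_⟩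
  · rcases lt_or_ge c 0 with hc | hc
    · convert MeasurableSet.univ
      ext z
      simp only [Set.mem_preimage, Set.mem_Ioi, Set.mem_univ, iff_true]
      split_ifs with hz
      · exact hc
      · exact hc.trans_le (hf.rearr_nonneg hz)
    · have : (fun z => if z = 0 then 0 else rearr f z) ⁻¹' Set.Ioi c
          = {z | volume (Metric.ball (0 : Eucl n) ‖z‖) < volume {y | c < f y}} \ {0} := by
        ext z
        simp only [Set.mem_preimage, Set.mem_Ioi, Set.mem_sdiff, Set.mem_ofPred_eq,
          Set.mem_singleton_iff]
        split_ifs with hz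
        · simp [hz, hc]
        · simp [hz, hf.lt_rearr_iff hz c]
      rw [this]
      refine MeasurableSet.diff ?_ (measurableSet_singleton _)
      have hmono : Monotone fun r : ℝ => volume (Metric.ball (0 : Eucl n) r) :=
        fun a b hab => measure_mono (Metric.ball_subset_ball hab)
      exact measurableSet_lt (hmono.measurable.comp measurable_norm) measurable_const
  · filter_upwards [ae_ne_zero (n := n)] with z hz
    simp [hz]

lemma Vanishing.measure_lt_rearr {f : Eucl n → ℝ} (hf : Vanishing f) {c : ℝ} (hc : 0 < c) :
    volume {z | c < rearr f z} = volume {z | c < f z} := by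
  obtain ⟨r, -, hV, h⟩ := hf.exists_radius hc
  rw [← hV]
  refine measure_congr ?_
  filter_upwards [ae_ne_zero (n := n)] with z hz
  exact propext (h z hz)

/-- Rearrangement preserves integrals. -/
lemma Vanishing.lintegral_rearr {f : Eucl n → ℝ} (hf : Vanishing f) :
    ∫⁻ z, ENNReal.ofReal (rearr f z) = ∫⁻ z, ENNReal.ofReal (f z) := by
  rw [lintegral_eq_lintegral_meas_lt volume (Filter.Eventually.of_forall hf.nonneg)
    hf.measurable.aemeasurable, lintegral_eq_lintegral_meas_lt volume
    (by filter_upwards [ae_ne_zero (n := n)] with z hz using hf.rearr_nonneg hz)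
    hf.aemeasurable_rearr]
  exact setLIntegral_congr_fun measurableSet_Ioi fun c hc => hf.measure_lt_rearr hc

lemma Vanishing.integrable_rearr {f : Eucl n → ℝ} (hf : Vanishing f) (hi : Integrable f) :
    Integrable (rearr f) := by
  refine ⟨hf.aemeasurable_rearr.aestronglyMeasurable, ?_⟩
  rw [hasFiniteIntegral_iff_ofReal
    (by filter_upwards [ae_ne_zero (n := n)] with z hz using hf.rearr_nonneg hz),
    hf.lintegral_rearr]
  exact (hasFiniteIntegral_iff_ofReal (Filter.Eventually.of_forall hf.nonneg)).1 hi.2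

lemma Vanishing.integral_rearr {f : Eucl n → ℝ} (hf : Vanishing f) :
    ∫ z, rearr f z = ∫ z, f z := by
  rw [integral_eq_lintegral_of_nonneg_ae (Filter.Eventually.of_forall hf.nonneg)
    hf.measurable.aestronglyMeasurable, integral_eq_lintegral_of_nonneg_ae
    (by filter_upwards [ae_ne_zero (n := n)] with z hz using hf.rearr_nonneg hz)
    hf.aemeasurable_rearr.aestronglyMeasurable, hf.lintegral_rearr]

/-- Rearrangement is a contraction of `L¹`. -/
lemma integral_abs_rearr_sub_le {f g : Eucl n → ℝ} (hf : Measurable f) (hg : Measurable g)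
    (hf0 : ∀ z, 0 ≤ f z) (hg0 : ∀ z, 0 ≤ g z) (hfi : Integrable f) (hgi : Integrable g) :
    ∫ z, |rearr f z - rearr g z| ≤ ∫ z, |f z - g z| := by
  have vf := Vanishing.of_integrable hf hf0 hfi
  have vg := Vanishing.of_integrable hg hg0 hgi
  have vs : Vanishing (fun z => max (f z) (g z)) :=
    Vanishing.of_integrable (hf.max hg) (fun z => le_max_of_le_left (hf0 z)) (hfi.sup hgi)
  refine integral_abs_sub_le_of_sup hfi hgi (vf.integrable_rearr hfi) (vg.integrable_rearr hgi)
    (vs.integrable_rearr (hfi.sup hgi)) vf.integral_rearr vg.integral_rearr vs.integral_rearr ?_ ?_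
  · filter_upwards [ae_ne_zero (n := n)] with z hz
    exact vf.rearr_mono vs (fun z => le_max_left _ _) hz
  · filter_upwards [ae_ne_zero (n := n)] with z hz
    exact vg.rearr_mono vs (fun z => le_max_right _ _) hz

/-- A continuous radially nonincreasing function is its own rearrangement. -/
lemma rearr_eq_self {v : Eucl n → ℝ} (hv : Continuous v) (h : Vanishing v)
    (hd : ∀ y z, ‖z‖ < ‖y‖ → v y ≤ v z) {z : Eucl n} (hz : z ≠ 0) : rearr v z = v z := by
  refine eq_of_forall_lt_iff fun c => ?_
  rw [h.lt_rearr_iff hz]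
  constructor
  · intro H
    by_contra hc
    have hsub : {y | c < v y} ⊆ Metric.closedBall 0 ‖z‖ := by
      intro y hy
      rw [mem_closedBall_zero_iff]
      by_contra hyz
      exact absurd (lt_of_lt_of_le hy ((hd y z (not_le.1 hyz)).trans (not_lt.1 hc)))
        (lt_irrefl _)
    have := measure_mono (μ := volume) hsub
    rw [Measure.addHaar_closedBall_eq_addHaar_ball] at this
    exact absurd H (not_lt.2 this)
  · intro H
    -- By continuity `v > c` also at a slightly longer multiple of `z`.
    have hcont : Continuous fun t : ℝ => v (t • z) := by fun_prop
    have hnear : ∀ᶠ t : ℝ in nhds 1, c < v (t • z) :=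
      hcont.continuousAt.eventually_const_lt (by simpa using H)
    obtain ⟨t, ht1, ht⟩ : ∃ t : ℝ, 1 < t ∧ c < v (t • z) := by
      have := (hnear.filter_mono nhdsWithin_le_nhds).and
        (self_mem_nhdsWithin : Set.Ioi (1 : ℝ) ∈ nhdsWithin 1 (Set.Ioi 1))
      obtain ⟨t, h1, h2⟩ := this.exists
      exact ⟨t, h2, h1⟩
    have hnz : 0 < ‖z‖ := norm_pos_iff.2 hz
    have hn : ‖t • z‖ = t * ‖z‖ := by
      rw [norm_smul, Real.norm_eq_abs, abs_of_pos (by linarith)]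
    have h1 : ‖z‖ < ‖t • z‖ := by rw [hn]; nlinarith
    refine lt_of_lt_of_le ((volume_ball_lt_iff (norm_nonneg _) (norm_nonneg (t • z))).2 h1)
      (measure_mono fun y hy => ?_)
    exact lt_of_lt_of_le ht (hd _ _ (mem_ball_zero_iff.1 hy))

end Rearrangement

/-! ### Iterated polarizations converge to the rearrangement -/

section Iteration

variable {n : ℕ}

/-- Half-spaces of `ℝⁿ` with the origin in their interior: a unit vector `e` and `t > 0` stand for
`{z | ⟨z, e⟩ < t}`. -/
abbrev HalfSpace (n : ℕ) : Type := Metric.sphere (0 : Eucl n) 1 × Set.Ioi (0 : ℝ)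

/-- The polarization of a function on `ℝⁿ` with respect to a half-space. -/
def pol (H : HalfSpace n) (f : Eucl n → ℝ) : Eucl n → ℝ :=
  polarize (reflect (H.1 : Eucl n) (H.2 : ℝ)) (height (H.1 : Eucl n) (H.2 : ℝ)) f

lemma HalfSpace.norm_eq (H : HalfSpace n) : ‖(H.1 : Eucl n)‖ = 1 := by
  simp

lemma HalfSpace.pos (H : HalfSpace n) : 0 < (H.2 : ℝ) := H.2.2

lemma HalfSpace.isReflection (H : HalfSpace n) :
    IsReflection (reflect (H.1 : Eucl n) (H.2 : ℝ)) (height (H.1 : Eucl n) (H.2 : ℝ)) :=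
  isReflection_reflect H.norm_eq _

lemma HalfSpace.measurePreserving (H : HalfSpace n) :
    MeasurePreserving (reflect (H.1 : Eucl n) (H.2 : ℝ)) :=
  measurePreserving_reflect H.norm_eq _

lemma HalfSpace.measurable_height (H : HalfSpace n) :
    Measurable (height (H.1 : Eucl n) (H.2 : ℝ)) := (continuous_height _ _).measurable

lemma measurable_pol (H : HalfSpace n) {f : Eucl n → ℝ} (hf : Measurable f) :
    Measurable (pol H f) :=
  measurable_polarize H.measurePreserving.measurable H.measurable_height hf

lemma integrable_pol (H : HalfSpace n) {f : Eucl n → ℝ} (hf : Measurable f) (hi : Integrable f) :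
    Integrable (pol H f) :=
  H.isReflection.integrable_polarize H.measurePreserving H.measurable_height hf hi

/-- Polarization preserves a modulus of continuity. -/
lemma abs_pol_sub_pol_le (H : HalfSpace n) {f : Eucl n → ℝ} {δ ε : ℝ}
    (hf : ∀ x y, dist x y < δ → |f x - f y| ≤ ε) (x y : Eucl n) (hxy : dist x y < δ) :
    |pol H f x - pol H f y| ≤ ε := by
  set e := (H.1 : Eucl n)
  set t := (H.2 : ℝ)
  have he : ‖e‖ = 1 := H.norm_eq
  have hmax : ∀ z, 0 ≤ height e t z → pol H f z = max (f z) (f (reflect e t z)) := by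
    intro z hz
    rcases hz.eq_or_lt with h | h
    · rw [pol, polarize_of_zero h.symm, (H.isReflection).fix z h.symm, max_self]
    · exact polarize_of_pos h
  have hmin : ∀ z, height e t z ≤ 0 → pol H f z = min (f z) (f (reflect e t z)) := by
    intro z hz
    rcases hz.eq_or_lt with h | h
    · rw [pol, polarize_of_zero h, (H.isReflection).fix z h, min_self]
    · exact polarize_of_neg h
  have h1 := hf x y hxy
  have h2 := hf (reflect e t x) (reflect e t y) (by rwa [dist_reflect_reflect he])
  -- On opposite sides, all four distances between `{x, σ x}` and `{y, σ y}` are at most `dist x y`.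
  have cross : height e t x * height e t y ≤ 0 →
      |f x - f (reflect e t y)| ≤ ε ∧ |f (reflect e t x) - f y| ≤ ε := by
    intro hh
    refine ⟨hf _ _ ((dist_reflect_le he hh).trans_lt hxy), hf _ _ ?_⟩
    rw [dist_comm]
    exact (dist_reflect_le he (by linarith [mul_comm (height e t x) (height e t y)])).trans_lt
      (by rwa [dist_comm])
  rw [abs_le] at h1 h2
  rcases le_total 0 (height e t x) with hx | hx <;> rcases le_total 0 (height e t y) with hy | hy
  · rw [hmax x hx, hmax y hy]
    exact (abs_max_sub_max_le_max _ _ _ _).trans (max_le (abs_le.2 h1) (abs_le.2 h2))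
  · obtain ⟨h3, h4⟩ := cross (mul_nonpos_of_nonneg_of_nonpos hx hy)
    rw [abs_le] at h3 h4
    rw [hmax x hx, hmin y hy, abs_le]
    rcases max_cases (f x) (f (reflect e t x)) with h | h <;>
    rcases min_cases (f y) (f (reflect e t y)) with h' | h' <;>
    constructor <;> linarith
  · obtain ⟨h3, h4⟩ := cross (mul_nonpos_of_nonpos_of_nonneg hx hy)
    rw [abs_le] at h3 h4
    rw [hmin x hx, hmax y hy, abs_le]
    rcases min_cases (f x) (f (reflect e t x)) with h | h <;>
    rcases max_cases (f y) (f (reflect e t y)) with h' | h' <;>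
    constructor <;> linarith
  · rw [hmin x hx, hmin y hy]
    exact (abs_min_sub_min_le_max _ _ _ _).trans (max_le (abs_le.2 h1) (abs_le.2 h2))

/-- The nonnegative functions bounded by `B`, vanishing outside the ball of radius `R`, and with
modulus of continuity `δ`. -/
structure Tame (B R : ℝ) (δ : ℝ → ℝ) (f : Eucl n → ℝ) : Prop where
  nonneg : ∀ z, 0 ≤ f z
  le : ∀ z, f z ≤ B
  eq_zero : ∀ z, R < ‖z‖ → f z = 0
  modulus : ∀ ε > 0, ∀ x y, dist x y < δ ε → |f x - f y| ≤ ε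

variable {B R : ℝ} {δ : ℝ → ℝ}

lemma Tame.polarized {f : Eucl n → ℝ} (hf : Tame B R δ f) (H : HalfSpace n) :
    Tame B R δ (pol H f) where
  nonneg := polarize_nonneg hf.nonneg
  le z := by
    rcases polarize_eq_or (σ := reflect (H.1 : Eucl n) H.2) (h := height (H.1 : Eucl n) H.2) f z
      with h | h <;> rw [pol, h] <;> exact hf.le _
  eq_zero z hz := by
    have h0 := hf.eq_zero z hz
    rcases lt_trichotomy (height (H.1 : Eucl n) H.2 z) 0 with h | h | h
    · rw [pol, polarize_of_neg h, h0, min_eq_left (hf.nonneg _)]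
    · rw [pol, polarize_of_zero h, h0]
    · rw [pol, polarize_of_pos h, h0,
        hf.eq_zero _ (hz.trans (norm_lt_norm_reflect H.norm_eq H.pos h)), max_self]
  modulus ε hε := abs_pol_sub_pol_le H (hf.modulus ε hε)

lemma Tame.continuous (hδ : ∀ ε > 0, 0 < δ ε) {f : Eucl n → ℝ} (hf : Tame B R δ f) :
    Continuous f := by
  refine Metric.continuous_iff.2 fun x ε hε => ⟨δ (ε / 2), hδ _ (half_pos hε), fun y hy => ?_⟩
  rw [Real.dist_eq]
  exact (hf.modulus _ (half_pos hε) y x hy).trans_lt (half_lt_self hε)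

lemma Tame.abs_le {f : Eucl n → ℝ} (hf : Tame B R δ f) (z : Eucl n) :
    |f z| ≤ (Metric.closedBall (0 : Eucl n) R).indicator (fun _ => B) z := by
  rw [abs_of_nonneg (hf.nonneg z)]
  by_cases hz : z ∈ Metric.closedBall (0 : Eucl n) R
  · rw [Set.indicator_of_mem hz]; exact hf.le z
  · rw [Set.indicator_of_notMem hz, hf.eq_zero z (by simpa using hz)]

lemma integrable_indicator_closedBall (B R : ℝ) :
    Integrable ((Metric.closedBall (0 : Eucl n) R).indicator fun _ => B) := by
  rw [integrable_indicator_iff Metric.isClosed_closedBall.measurableSet]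
  exact integrableOn_const (isCompact_closedBall (0 : Eucl n) R).measure_lt_top.ne

lemma Tame.integrable (hδ : ∀ ε > 0, 0 < δ ε) {f : Eucl n → ℝ} (hf : Tame B R δ f) :
    Integrable f :=
  (integrable_indicator_closedBall B R).mono' (hf.continuous hδ).aestronglyMeasurable
    (Filter.Eventually.of_forall hf.abs_le)

/-- Arzelà–Ascoli for tame functions. -/
lemma Tame.exists_tendsto_subseq (hδ : ∀ ε > 0, 0 < δ ε) {f : ℕ → Eucl n → ℝ}
    (hf : ∀ k, Tame B R δ (f k)) :
    ∃ v, Tame B R δ v ∧ ∃ φ : ℕ → ℕ, StrictMono φ ∧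
      ∀ z, Filter.Tendsto (fun k => f (φ k) z) Filter.atTop (nhds (v z)) := by
  let S : Set C(Eucl n, ℝ) := {F | Tame B R δ F}
  have himage : ContinuousMap.toFun '' S = {F : Eucl n → ℝ | Tame B R δ F} := by
    ext F
    constructor
    · rintro ⟨G, hG, rfl⟩; exact hG
    · intro hF; exact ⟨⟨F, hF.continuous hδ⟩, hF, rfl⟩
  have hclosed : IsClosed {F : Eucl n → ℝ | Tame B R δ F} := by
    have : {F : Eucl n → ℝ | Tame B R δ F} =
        (⋂ z, {F | 0 ≤ F z}) ∩ (⋂ z, {F | F z ≤ B}) ∩ (⋂ z, ⋂ (_ : R < ‖z‖), {F | F z = 0}) ∩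
        (⋂ ε, ⋂ (_ : ε > 0), ⋂ x, ⋂ y, ⋂ (_ : dist x y < δ ε), {F | |F x - F y| ≤ ε}) := by
      ext F
      simp only [Set.mem_inter_iff, Set.mem_iInter, Set.mem_ofPred_eq]
      exact ⟨fun h => ⟨⟨⟨h.nonneg, h.le⟩, h.eq_zero⟩, h.modulus⟩,
        fun h => ⟨h.1.1.1, h.1.1.2, h.1.2, h.2⟩⟩
    rw [this]
    refine ((IsClosed.inter ?_ ?_).inter ?_).inter ?_
    · exact isClosed_iInter fun z => isClosed_le continuous_const (continuous_apply z)
    · exact isClosed_iInter fun z => isClosed_le (continuous_apply z) continuous_const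
    · exact isClosed_iInter fun z => isClosed_iInter fun _ =>
        isClosed_eq (continuous_apply z) continuous_const
    · exact isClosed_iInter fun ε => isClosed_iInter fun _ => isClosed_iInter fun x =>
        isClosed_iInter fun y => isClosed_iInter fun _ =>
          isClosed_le ((continuous_apply x).sub (continuous_apply y)).abs continuous_const
  have hcomp : IsCompact S := by
    refine ArzelaAscoli.isCompact_of_equicontinuous S ?_ ?_
    · rw [himage]
      refine (isCompact_univ_pi (fun _ : Eucl n =>
        isCompact_Icc (a := (0 : ℝ)) (b := B))).of_isClosed_subset hclosed
        fun F hF z _ => ⟨hF.nonneg z, hF.le z⟩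
    · intro x
      refine Metric.equicontinuousAt_iff.2 fun ε hε => ⟨δ (ε / 2), hδ _ (half_pos hε),
        fun y hy F => ?_⟩
      rw [Real.dist_eq]
      exact (F.2.modulus _ (half_pos hε) x y (by rwa [dist_comm])).trans_lt (half_lt_self hε)
  obtain ⟨v, hv, φ, hφ, hlim⟩ := hcomp.tendsto_subseq
    (x := fun k => (⟨f k, (hf k).continuous hδ⟩ : C(Eucl n, ℝ))) (fun k => hf k)
  refine ⟨v, hv, φ, hφ, fun z => ?_⟩
  exact ((continuous_eval_const z).tendsto v).comp hlim

/-- A strictly radially decreasing weight. -/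
def weight (z : Eucl n) : ℝ := (1 + ‖z‖ ^ 2)⁻¹

lemma weight_pos (z : Eucl n) : 0 < weight z := by unfold weight; positivity

lemma weight_le_one (z : Eucl n) : weight z ≤ 1 :=
  inv_le_one_of_one_le₀ (by nlinarith [sq_nonneg ‖z‖])

lemma continuous_weight : Continuous (weight : Eucl n → ℝ) := by
  unfold weight
  exact Continuous.inv₀ (by fun_prop) fun z => by positivity

lemma integrable_mul_weight {f : Eucl n → ℝ} (hi : Integrable f) :
    Integrable fun z => f z * weight z := by
  refine hi.mono (hi.1.mul continuous_weight.aestronglyMeasurable)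
    (Filter.Eventually.of_forall fun z => ?_)
  rw [norm_mul, Real.norm_of_nonneg (weight_pos z).le]
  exact mul_le_of_le_one_right (norm_nonneg _) (weight_le_one z)

lemma mul_weight_sub_nonneg (H : HalfSpace n) (f : Eucl n → ℝ) (z : Eucl n) :
    0 ≤ (pol H f z - f z) * (weight z - weight (reflect (H.1 : Eucl n) H.2 z)) := by
  have h1 := IsReflection.mul_polarize_sub_nonneg (σ := reflect (H.1 : Eucl n) (H.2 : ℝ))
    (h := height (H.1 : Eucl n) (H.2 : ℝ)) f z
  have h2 := norm_sq_reflect H.norm_eq (H.2 : ℝ) z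
  have hw : weight z - weight (reflect (H.1 : Eucl n) H.2 z) =
      height (H.1 : Eucl n) H.2 z * (4 * (H.2 : ℝ) * weight z *
        weight (reflect (H.1 : Eucl n) H.2 z)) := by
    simp only [weight]
    rw [inv_sub_inv (by positivity) (by positivity), h2]
    have : (1 + (‖z‖ ^ 2 + 4 * height (H.1 : Eucl n) H.2 z * (H.2 : ℝ))) ≠ 0 := by
      rw [← h2]; positivity
    field_simp
    ring
  rw [hw, ← mul_assoc]
  refine mul_nonneg (by rw [mul_comm]; exact h1) ?_
  have := H.pos; have := weight_pos z; have := weight_pos (reflect (H.1 : Eucl n) H.2 z)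
  positivity

/-- The gain of the weighted integral under polarization. -/
lemma two_mul_integral_pol_sub (H : HalfSpace n) {f : Eucl n → ℝ} (hf : Measurable f)
    (hi : Integrable f) :
    2 * ((∫ z, pol H f z * weight z) - ∫ z, f z * weight z) =
      ∫ z, (pol H f z - f z) * (weight z - weight (reflect (H.1 : Eucl n) H.2 z)) := by
  set σ := reflect (H.1 : Eucl n) (H.2 : ℝ)
  have hd : Integrable fun z => pol H f z - f z := (integrable_pol H hf hi).sub hi
  have h1 : (∫ z, pol H f z * weight z) - ∫ z, f z * weight z
      = ∫ z, (pol H f z - f z) * weight z := by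
    rw [← integral_sub (integrable_mul_weight (integrable_pol H hf hi))
      (integrable_mul_weight hi)]
    simp only [sub_mul]
  have hemb := (H.isReflection.measurableEquiv H.measurePreserving.measurable).measurableEmbedding
  have h2 : ∫ z, (pol H f z - f z) * weight z = - ∫ z, (pol H f z - f z) * weight (σ z) := by
    rw [← H.measurePreserving.integral_comp hemb, ← integral_neg]
    refine integral_congr_ae (Filter.Eventually.of_forall fun z => ?_)
    have := H.isReflection.polarize_sub f z
    simp only [pol]
    rw [this]; ring
  have h3 : Integrable fun z => (pol H f z - f z) * weight (σ z) := by
    have := (H.measurePreserving.integrable_comp_emb hemb).2 (integrable_mul_weight hd)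
    refine this.neg.congr (Filter.Eventually.of_forall fun z => ?_)
    have := H.isReflection.polarize_sub f z
    simp only [Pi.neg_apply, Function.comp]
    simp only [pol]
    rw [this]; ring
  have h4 : ∫ z, (pol H f z - f z) * (weight z - weight (σ z)) =
      (∫ z, (pol H f z - f z) * weight z) - ∫ z, (pol H f z - f z) * weight (σ z) := by
    rw [← integral_sub (integrable_mul_weight hd) h3]
    simp only [mul_sub]
  rw [h4, h1]; linarith

lemma integral_mul_weight_le_pol (H : HalfSpace n) {f : Eucl n → ℝ} (hf : Measurable f)
    (hi : Integrable f) : ∫ z, f z * weight z ≤ ∫ z, pol H f z * weight z := by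
  have := two_mul_integral_pol_sub H hf hi
  have h0 : 0 ≤ ∫ z, (pol H f z - f z) * (weight z - weight (reflect (H.1 : Eucl n) H.2 z)) :=
    integral_nonneg (mul_weight_sub_nonneg H f)
  linarith

/-- A continuous function whose weighted integral is not increased by a polarization is invariant
under it. -/
lemma pol_eq_self_of_integral_eq (H : HalfSpace n) (hδ : ∀ ε > 0, 0 < δ ε) {v : Eucl n → ℝ}
    (hv : Tame B R δ v) (h : ∫ z, pol H v z * weight z = ∫ z, v z * weight z) :
    pol H v = v := by
  set σ := reflect (H.1 : Eucl n) (H.2 : ℝ)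
  have hc := hv.continuous hδ
  have hcp := (hv.polarized H).continuous hδ
  have hi := hv.integrable hδ
  have key := two_mul_integral_pol_sub H hc.measurable hi
  rw [h, sub_self, mul_zero] at key
  have hd : Integrable fun z => pol H v z - v z := (integrable_pol H hc.measurable hi).sub hi
  have hcont : Continuous fun z => (pol H v z - v z) * (weight z - weight (σ z)) :=
    (hcp.sub hc).mul (continuous_weight.sub (continuous_weight.comp (continuous_reflect _ _)))
  have hint : Integrable fun z => (pol H v z - v z) * (weight z - weight (σ z)) := by
    refine hd.mono hcont.aestronglyMeasurable (Filter.Eventually.of_forall fun z => ?_)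
    rw [norm_mul]
    refine mul_le_of_le_one_right (norm_nonneg _) ?_
    rw [Real.norm_eq_abs, abs_le]
    constructor <;> linarith [weight_pos z, weight_pos (σ z), weight_le_one z,
      weight_le_one (σ z)]
  have hzero := (integral_eq_zero_iff_of_nonneg (mul_weight_sub_nonneg H v) hint).1 key.symm
  have heq := (Continuous.ae_eq_iff_eq volume hcont continuous_const).1 hzero
  funext z
  have hz : (pol H v z - v z) * (weight z - weight (σ z)) = 0 := congrFun heq z
  rcases mul_eq_zero.1 hz with h' | h'
  · linarith
  · have hn := norm_sq_reflect H.norm_eq (H.2 : ℝ) z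
    have : ‖z‖ ^ 2 = ‖σ z‖ ^ 2 := by
      have := inv_injective (sub_eq_zero.1 h')
      linarith
    have hh : height (H.1 : Eucl n) H.2 z = 0 := by
      have h4 : 4 * height (H.1 : Eucl n) H.2 z * (H.2 : ℝ) = 0 := by linarith
      have := H.pos.ne'
      simpa [this] using h4
    exact polarize_of_zero hh

/-- The composition of the first `k` polarizations of a sequence. -/
def iterPol (H : ℕ → HalfSpace n) : ℕ → (Eucl n → ℝ) → Eucl n → ℝ
  | 0, f => f
  | k + 1, f => pol (H k) (iterPol H k f)

/-- The sweeps of a sequence of half-spaces: step `k` applies the first `k + 1` polarizations. -/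
def sweep (H : ℕ → HalfSpace n) : ℕ → (Eucl n → ℝ) → Eucl n → ℝ
  | 0, f => f
  | k + 1, f => iterPol H (k + 1) (sweep H k f)

lemma iterPol_induction {P : (Eucl n → ℝ) → Prop} (hP : ∀ H f, P f → P (pol H f))
    (H : ℕ → HalfSpace n) (k : ℕ) {f : Eucl n → ℝ} (hf : P f) : P (iterPol H k f) := by
  induction k with
  | zero => exact hf
  | succ k ih => exact hP _ _ ih

lemma sweep_induction {P : (Eucl n → ℝ) → Prop} (hP : ∀ H f, P f → P (pol H f))
    (H : ℕ → HalfSpace n) (k : ℕ) {f : Eucl n → ℝ} (hf : P f) : P (sweep H k f) := by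
  induction k with
  | zero => exact hf
  | succ k ih => exact iterPol_induction hP H _ ih

lemma iterPol_induction₂ {P : (Eucl n → ℝ) → (Eucl n → ℝ) → Prop}
    (hP : ∀ H f g, P f g → P (pol H f) (pol H g))
    (H : ℕ → HalfSpace n) (k : ℕ) {f g : Eucl n → ℝ} (hf : P f g) :
    P (iterPol H k f) (iterPol H k g) := by
  induction k with
  | zero => exact hf
  | succ k ih => exact hP _ _ _ ih

lemma sweep_induction₂ {P : (Eucl n → ℝ) → (Eucl n → ℝ) → Prop}
    (hP : ∀ H f g, P f g → P (pol H f) (pol H g))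
    (H : ℕ → HalfSpace n) (k : ℕ) {f g : Eucl n → ℝ} (hf : P f g) :
    P (sweep H k f) (sweep H k g) := by
  induction k with
  | zero => exact hf
  | succ k ih => exact iterPol_induction₂ hP H _ ih

/-- The pair `(f, g)` consists of measurable integrable functions at `L¹`-distance at most `d`. -/
structure L1Close (d : ℝ) (f g : Eucl n → ℝ) : Prop where
  measurable_left : Measurable f
  measurable_right : Measurable g
  integrable_left : Integrable f
  integrable_right : Integrable g
  le : ∫ z, |f z - g z| ≤ d

lemma L1Close.pol {d : ℝ} (H : HalfSpace n) (f g : Eucl n → ℝ) (h : L1Close d f g) :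
    L1Close d (pol H f) (pol H g) :=
  ⟨measurable_pol H h.1, measurable_pol H h.2, integrable_pol H h.1 h.3, integrable_pol H h.2 h.4,
    (H.isReflection.integral_abs_polarize_sub_le H.measurePreserving H.measurable_height h.1 h.2
      h.3 h.4).trans h.5⟩

lemma integral_mul_weight_le_iterPol (H : ℕ → HalfSpace n) {f : Eucl n → ℝ} (hf : Measurable f)
    (hi : Integrable f) {k m : ℕ} (hkm : k ≤ m) :
    ∫ z, iterPol H k f z * weight z ≤ ∫ z, iterPol H m f z * weight z := by
  induction m, hkm using Nat.le_induction with
  | base => exact le_rfl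
  | succ m _ ih =>
    have := iterPol_induction (P := fun f => Measurable f ∧ Integrable f)
      (fun H f h => ⟨measurable_pol H h.1, integrable_pol H h.1 h.2⟩) H m ⟨hf, hi⟩
    exact ih.trans (integral_mul_weight_le_pol _ this.1 this.2)

lemma abs_integral_mul_weight_sub_le {f g : Eucl n → ℝ} {d : ℝ} (h : L1Close d f g) :
    |(∫ z, f z * weight z) - ∫ z, g z * weight z| ≤ d := by
  rw [← integral_sub (integrable_mul_weight h.3) (integrable_mul_weight h.4)]
  refine (abs_integral_le_integral_abs).trans (le_trans ?_ h.5)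
  refine integral_mono (((integrable_mul_weight h.3).sub (integrable_mul_weight h.4)).abs)
    (h.3.sub h.4).abs fun z => ?_
  simp only
  rw [← sub_mul, abs_mul, abs_of_pos (weight_pos z)]
  exact mul_le_of_le_one_right (abs_nonneg _) (weight_le_one z)

/-- A continuous function which is invariant under a dense set of polarizations is radially
nonincreasing. -/
lemma le_of_pol_eq_self {H : ℕ → HalfSpace n} (hH : DenseRange H) {v : Eucl n → ℝ}
    (hv : Continuous v) (h : ∀ k, pol (H k) v = v) {y z : Eucl n} (hyz : ‖z‖ < ‖y‖) :
    v y ≤ v z := by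
  obtain ⟨e, he, t, ht, hpos, hrefl⟩ := exists_reflect_eq hyz
  by_contra hlt
  rw [not_le] at hlt
  have c1 : Continuous fun K : HalfSpace n => height (K.1 : Eucl n) (K.2 : ℝ) z := by
    unfold height; fun_prop
  have c2 : Continuous fun K : HalfSpace n => v (reflect (K.1 : Eucl n) (K.2 : ℝ) z) := by
    unfold reflect height; fun_prop
  have hopen : IsOpen {K : HalfSpace n | 0 < height (K.1 : Eucl n) (K.2 : ℝ) z ∧
      v z < v (reflect (K.1 : Eucl n) (K.2 : ℝ) z)} :=
    (isOpen_lt continuous_const c1).inter (isOpen_lt continuous_const c2)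
  obtain ⟨k, hk1, hk2⟩ := hH.exists_mem_open hopen
    ⟨(⟨e, by simpa using he⟩, ⟨t, ht⟩), hpos, by simpa [hrefl] using hlt⟩
  have := congrFun (h k) z
  rw [pol, polarize_of_pos hk1] at this
  exact absurd (this ▸ le_max_right _ _) (not_le.2 hk2)

lemma rearr_pol (H : HalfSpace n) {f : Eucl n → ℝ} (hf : Measurable f) {z : Eucl n}
    (hz : z ≠ 0) : rearr (pol H f) z = rearr f z :=
  rearr_congr (fun c => H.isReflection.measure_lt_polarize H.measurePreserving
    H.measurable_height hf c) hz

variable [NeZero n]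

/-- The limit of a subsequence of the sweeps of a tame function is its rearrangement. The weighted
integrals increase along the sweeps, so they are constant under the polarizations of the limit,
which is therefore invariant under them all. -/
lemma Tame.limit_eq_rearr {H : ℕ → HalfSpace n} (hH : DenseRange H) (hδ : ∀ ε > 0, 0 < δ ε)
    {g v : Eucl n → ℝ} (hg : Tame B R δ g) (hv : Tame B R δ v) {φ : ℕ → ℕ} (hφ : StrictMono φ)
    (hlim : ∀ z, Filter.Tendsto (fun k => sweep H (φ k) g z) Filter.atTop (nhds (v z))) :
    v =ᵐ[volume] rearr g := by
  have ht : ∀ k, Tame B R δ (sweep H k g) := fun k =>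
    sweep_induction (P := Tame B R δ) (fun H f hf => Tame.polarized hf H) H k hg
  have hm : ∀ k, Measurable (sweep H k g) := fun k => ((ht k).continuous hδ).measurable
  have hi : ∀ k, Integrable (sweep H k g) := fun k => (ht k).integrable hδ
  have hvi := hv.integrable hδ
  have hvm := (hv.continuous hδ).measurable
  have hL1 : Filter.Tendsto (fun k => ∫ z, |sweep H (φ k) g z - v z|) Filter.atTop (nhds 0) := by
    have := tendsto_integral_of_dominated_convergence
      (μ := (volume : Measure (Eucl n)))
      (F := fun k z => |sweep H (φ k) g z - v z|) (f := fun _ => 0)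
      (fun z => 2 * (Metric.closedBall (0 : Eucl n) R).indicator (fun _ => B) z)
      (fun k => ((hm _).sub hvm).abs.aestronglyMeasurable)
      ((integrable_indicator_closedBall B R).const_mul 2)
      (fun k => Filter.Eventually.of_forall fun z => by
        rw [Real.norm_eq_abs, abs_abs]
        linarith [abs_sub (sweep H (φ k) g z) (v z), (ht (φ k)).abs_le z, hv.abs_le z])
      (Filter.Eventually.of_forall fun z => by
        have := ((hlim z).sub_const (v z)).abs
        simpa using this)
    simpa using this
  have hclose : ∀ k, L1Close (∫ z, |sweep H (φ k) g z - v z|) (sweep H (φ k) g) v := fun k =>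
    ⟨hm _, hvm, hi _, hvi, le_rfl⟩
  let I : (Eucl n → ℝ) → ℝ := fun f => ∫ z, f z * weight z
  have hmono : Monotone fun k => I (sweep H k g) :=
    monotone_nat_of_le_succ fun k =>
      integral_mul_weight_le_iterPol H (hm k) (hi k) (Nat.zero_le (k + 1))
  have htend : ∀ m, Filter.Tendsto (fun k => I (iterPol H m (sweep H (φ k) g))) Filter.atTop
      (nhds (I (iterPol H m v))) := by
    intro m
    rw [tendsto_iff_dist_tendsto_zero]
    refine squeeze_zero (fun _ => dist_nonneg) (fun k => ?_) hL1
    exact abs_integral_mul_weight_sub_le (iterPol_induction₂ (fun H f g => L1Close.pol H f g) H m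
      (hclose k))
  -- For `m ≤ φ k` the weighted integral of `iterPol H m (sweep H (φ k) g)` lies between those of
  -- the sweeps `φ k` and `φ k + 1`, and both tend to `I v`.
  have hI : ∀ m, I (iterPol H m v) = I v := by
    intro m
    refine le_antisymm ?_ (integral_mul_weight_le_iterPol H hvm hvi (Nat.zero_le m))
    have h0 : Filter.Tendsto (fun k => I (sweep H k g)) Filter.atTop (nhds (I v)) :=
      (tendsto_iff_tendsto_subseq_of_monotone hmono hφ.tendsto_atTop).2 (htend 0)
    refine le_of_tendsto_of_tendsto (htend m)
      (h0.comp ((Filter.tendsto_add_atTop_nat 1).comp hφ.tendsto_atTop)) ?_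
    filter_upwards [Filter.eventually_ge_atTop m] with k hk
    exact integral_mul_weight_le_iterPol H (hm _) (hi _) (hk.trans ((hφ.id_le k).trans
      (Nat.le_succ _)))
  have hinv : ∀ m, iterPol H m v = v := by
    intro m
    induction m with
    | zero => rfl
    | succ m ih =>
      have := hI (m + 1)
      simp only [iterPol] at this ⊢
      rw [ih] at this ⊢
      exact pol_eq_self_of_integral_eq (H m) hδ hv this
  have hpol : ∀ m, pol (H m) v = v := fun m => by
    have := hinv (m + 1)
    simp only [iterPol] at this
    rwa [hinv m] at this
  have hself : ∀ z ≠ 0, rearr v z = v z := fun z hz =>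
    rearr_eq_self (hv.continuous hδ) (Vanishing.of_integrable hvm hv.nonneg hvi)
      (fun y z h => le_of_pol_eq_self hH (hv.continuous hδ) hpol h) hz
  have hgv : ∀ k, ∀ z ≠ 0, rearr (sweep H k g) z = rearr g z := by
    intro k z hz
    exact (sweep_induction (P := fun f => Measurable f ∧ rearr f z = rearr g z)
      (fun H f h => ⟨measurable_pol H h.1, (rearr_pol H h.1 hz).trans h.2⟩) H k
      ⟨(hg.continuous hδ).measurable, rfl⟩).2
  have hvg := Vanishing.of_integrable (hg.continuous hδ).measurable hg.nonneg (hg.integrable hδ)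
  have hvv := Vanishing.of_integrable hvm hv.nonneg hvi
  -- Sweeps leave the rearrangement of `g` unchanged, and rearrangement is an `L¹` contraction.
  have hle : ∀ k, ∫ z, |rearr g z - rearr v z| ≤ ∫ z, |sweep H (φ k) g z - v z| := by
    intro k
    refine le_trans (le_of_eq (integral_congr_ae ?_)) (integral_abs_rearr_sub_le (hm (φ k)) hvm
      (ht _).nonneg hv.nonneg (hi _) hvi)
    filter_upwards [ae_ne_zero (n := n)] with z hz
    rw [hgv _ z hz]
  have hzero : ∫ z, |rearr g z - rearr v z| = 0 :=
    le_antisymm (ge_of_tendsto' hL1 hle) (integral_nonneg fun z => abs_nonneg _)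
  have := (integral_eq_zero_iff_of_nonneg (fun z => abs_nonneg _)
    ((hvg.integrable_rearr (hg.integrable hδ)).sub (hvv.integrable_rearr hvi)).abs).1 hzero
  filter_upwards [this, ae_ne_zero (n := n)] with z hz hz0
  have h1 : rearr g z - rearr v z = 0 := abs_eq_zero.1 hz
  rw [← hself z hz0]; linarith

lemma Tame.tendsto_sweep {H : ℕ → HalfSpace n} (hH : DenseRange H) (hδ : ∀ ε > 0, 0 < δ ε)
    {g : Eucl n → ℝ} (hg : Tame B R δ g) :
    Filter.Tendsto (fun k => ∫ z, |sweep H k g z - rearr g z|) Filter.atTop (nhds 0) := by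
  have ht : ∀ k, Tame B R δ (sweep H k g) := fun k =>
    sweep_induction (P := Tame B R δ) (fun H f hf => Tame.polarized hf H) H k hg
  refine Filter.tendsto_of_subseq_tendsto fun ns hns => ?_
  obtain ⟨ψ, hψ, hψ'⟩ := Filter.strictMono_subseq_of_tendsto_atTop hns
  obtain ⟨v, hv, φ, hφ, hlim⟩ := Tame.exists_tendsto_subseq hδ (fun k => ht (ns (ψ k)))
  refine ⟨ψ ∘ φ, ?_⟩
  have heq := hg.limit_eq_rearr hH hδ hv (hψ'.comp hφ) hlim
  have hvm := (hv.continuous hδ).measurable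
  have := tendsto_integral_of_dominated_convergence
      (μ := (volume : Measure (Eucl n)))
      (F := fun k z => |sweep H (ns (ψ (φ k))) g z - v z|) (f := fun _ => 0)
      (fun z => 2 * (Metric.closedBall (0 : Eucl n) R).indicator (fun _ => B) z)
      (fun k => (((ht _).continuous hδ).measurable.sub hvm).abs.aestronglyMeasurable)
      ((integrable_indicator_closedBall B R).const_mul 2)
      (fun k => Filter.Eventually.of_forall fun z => by
        rw [Real.norm_eq_abs, abs_abs]
        linarith [abs_sub (sweep H (ns (ψ (φ k))) g z) (v z), (ht (ns (ψ (φ k)))).abs_le z,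
          hv.abs_le z])
      (Filter.Eventually.of_forall fun z => by
        have := ((hlim z).sub_const (v z)).abs
        simpa using this)
  rw [integral_zero] at this
  refine this.congr fun k => integral_congr_ae ?_
  filter_upwards [heq] with z hz
  rw [hz]; rfl

/-- The sweeps of a dense sequence of half-spaces converge in `L¹` to the rearrangement, for every
nonnegative integrable function. -/
lemma tendsto_integral_sweep {H : ℕ → HalfSpace n} (hH : DenseRange H) {f : Eucl n → ℝ}
    (hf : Measurable f) (hf0 : ∀ z, 0 ≤ f z) (hfi : Integrable f) :
    Filter.Tendsto (fun k => ∫ z, |sweep H k f z - rearr f z|) Filter.atTop (nhds 0) := by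
  refine Metric.tendsto_atTop.2 fun ε hε => ?_
  obtain ⟨g', hg'c, hg'd, hg'cont, hg'i⟩ :=
    hfi.exists_hasCompactSupport_integral_sub_le (show 0 < ε / 4 by positivity)
  let g : Eucl n → ℝ := fun z => max (g' z) 0
  have hgcont : Continuous g := hg'cont.max continuous_const
  have hgi : Integrable g := hg'i.sup (integrable_zero _ _ _)
  have hgc : HasCompactSupport g := hg'c.comp_left (g := fun x : ℝ => max x 0) (by simp)
  have hg0 : ∀ z, 0 ≤ g z := fun z => le_max_right _ _
  have hfg : ∫ z, |f z - g z| ≤ ε / 4 := by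
    refine le_trans (integral_mono (hfi.sub hgi).abs (hfi.sub hg'i).norm fun z => ?_) hg'd
    have := abs_max_sub_max_le_abs (f z) (g' z) 0
    rwa [max_eq_left (hf0 z)] at this
  obtain ⟨R, hR⟩ := hgc.isCompact.isBounded.subset_closedBall 0
  obtain ⟨B, hB⟩ := hgcont.bounded_above_of_compact_support hgc
  have huc := Metric.uniformContinuous_iff.1 (hgc.uniformContinuous_of_continuous hgcont)
  choose! δ hδ hδ' using huc
  have hg : Tame B R δ g := by
    refine ⟨hg0, fun z => (le_abs_self _).trans (hB z), fun z hz => ?_, fun ε hε x y hxy => ?_⟩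
    · by_contra h
      have := hR (subset_tsupport g h)
      rw [mem_closedBall_zero_iff] at this
      exact absurd hz (not_lt.2 this)
    · have := hδ' ε hε hxy
      rw [Real.dist_eq] at this
      exact this.le
  obtain ⟨N, hN⟩ := Metric.tendsto_atTop.1 (hg.tendsto_sweep hH hδ) (ε / 4) (by positivity)
  refine ⟨N, fun k hk => ?_⟩
  have h1 := hN k hk
  rw [Real.dist_eq, sub_zero, abs_of_nonneg (integral_nonneg fun z => abs_nonneg _)] at h1 ⊢
  have hc : L1Close (ε / 4) (sweep H k f) (sweep H k g) :=
    sweep_induction₂ (fun H f g => L1Close.pol H f g) H k ⟨hf, hgcont.measurable, hfi, hgi, hfg⟩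
  have hr : ∫ z, |rearr f z - rearr g z| ≤ ε / 4 :=
    (integral_abs_rearr_sub_le hf hgcont.measurable hf0 hg0 hfi hgi).trans hfg
  have irf := (Vanishing.of_integrable hf hf0 hfi).integrable_rearr hfi
  have irg := (Vanishing.of_integrable hgcont.measurable hg0 hgi).integrable_rearr hgi
  have i1 : Integrable fun z => |sweep H k f z - sweep H k g z| := (hc.3.sub hc.4).abs
  have i2 : Integrable fun z => |sweep H k g z - rearr g z| := (hc.4.sub irg).abs
  have i3 : Integrable fun z => |rearr f z - rearr g z| := (irf.sub irg).abs
  have : ∫ z, |sweep H k f z - rearr f z| ≤ (∫ z, |sweep H k f z - sweep H k g z|) +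
      (∫ z, |sweep H k g z - rearr g z|) + ∫ z, |rearr f z - rearr g z| := by
    have hi12 : Integrable fun z => |sweep H k f z - sweep H k g z| +
        |sweep H k g z - rearr g z| := i1.add i2
    rw [← integral_add i1 i2, ← integral_add hi12 i3]
    refine integral_mono (hc.3.sub irf).abs (hi12.add i3) fun z => ?_
    simp only
    have e1 := abs_sub_le (sweep H k f z) (sweep H k g z) (rearr f z)
    have e2 := abs_sub_le (sweep H k g z) (rearr g z) (rearr f z)
    have e3 := abs_sub_comm (rearr g z) (rearr f z)
    linarith
  linarith [hc.5]

lemma exists_denseRange_halfSpace : ∃ H : ℕ → HalfSpace n, DenseRange H := by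
  have : Nonempty (Metric.sphere (0 : Eucl n) 1) :=
    ⟨⟨EuclideanSpace.single (0 : Fin n) 1, by simp⟩⟩
  have : Nonempty (Set.Ioi (0 : ℝ)) := ⟨⟨1, Set.mem_Ioi.2 one_pos⟩⟩
  exact ⟨TopologicalSpace.denseSeq _, TopologicalSpace.denseRange_denseSeq _⟩

end Iteration

/-! ### Weak derivatives and absolute continuity on lines -/

section OneDimensional

/-- The polarization of a pair of absolutely continuous functions on a line, along which the
function `h` is affine, is absolutely continuous, and its derivative is the corresponding selection
of their derivatives. -/
lemma absolutelyContinuous_selection {f₁ f₂ c₁ c₂ : ℝ → ℝ} (hc₁ : Integrable c₁)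
    (hc₂ : Integrable c₂) (hf₁ : ∀ ρ, f₁ ρ = f₁ 0 + ∫ r in (0 : ℝ)..ρ, c₁ r)
    (hf₂ : ∀ ρ, f₂ ρ = f₂ 0 + ∫ r in (0 : ℝ)..ρ, c₂ r) {α β : ℝ}
    (hfix : ∀ ρ, α + ρ * β = 0 → f₁ ρ = f₂ ρ) {Φ C : ℝ → ℝ}
    (hΦ : ∀ ρ, Φ ρ = if 0 < (α + ρ * β) * (f₂ ρ - f₁ ρ) then f₂ ρ else f₁ ρ)
    (hC : ∀ ρ, C ρ = if 0 < (α + ρ * β) * (f₂ ρ - f₁ ρ) then c₂ ρ else c₁ ρ) :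
    AbsolutelyContinuousOnInterval Φ 0 1 ∧ ∀ᵐ ρ, ρ ∈ Set.uIcc (0 : ℝ) 1 → HasDerivAt Φ (C ρ) ρ := by
  have hsub : ∀ {f c : ℝ → ℝ}, Integrable c → (∀ ρ, f ρ = f 0 + ∫ r in (0 : ℝ)..ρ, c r) →
      ∀ a b, f b - f a = ∫ r in a..b, c r := by
    intro f c hc hf a b
    rw [hf b, hf a, ← intervalIntegral.integral_interval_sub_left (a := 0) (b := b) (c := a)
      hc.intervalIntegrable hc.intervalIntegrable]
    ring
  have hK : Integrable fun r => |c₁ r| + |c₂ r| := hc₁.abs.add hc₂.abs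
  -- `K` dominates the increments of `f₁` and `f₂`, hence those of `Φ`; an interval on which
  -- `α + ρ * β` changes sign is split at its zero, where `f₁` and `f₂` agree.
  let K : ℝ → ℝ := fun ρ => ∫ r in (0 : ℝ)..ρ, (|c₁ r| + |c₂ r|)
  have hKsub : ∀ a b, K b - K a = ∫ r in a..b, (|c₁ r| + |c₂ r|) := fun a b =>
    intervalIntegral.integral_interval_sub_left hK.intervalIntegrable hK.intervalIntegrable
  have hb₁ : ∀ a b, a ≤ b → |f₁ b - f₁ a| ≤ K b - K a := by
    intro a b hab
    rw [hsub hc₁ hf₁, hKsub]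
    refine (intervalIntegral.abs_integral_le_integral_abs hab).trans
      (intervalIntegral.integral_mono_on hab hc₁.abs.intervalIntegrable hK.intervalIntegrable
        fun x _ => ?_)
    linarith [abs_nonneg (c₂ x)]
  have hb₂ : ∀ a b, a ≤ b → |f₂ b - f₂ a| ≤ K b - K a := by
    intro a b hab
    rw [hsub hc₂ hf₂, hKsub]
    refine (intervalIntegral.abs_integral_le_integral_abs hab).trans
      (intervalIntegral.integral_mono_on hab hc₂.abs.intervalIntegrable hK.intervalIntegrable
        fun x _ => ?_)
    linarith [abs_nonneg (c₁ x)]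
  have hmax : ∀ ρ, 0 ≤ α + ρ * β → Φ ρ = max (f₁ ρ) (f₂ ρ) := by
    intro ρ h
    rw [hΦ]
    rcases h.eq_or_lt with h | h
    · simp [← h, hfix ρ h.symm]
    · simp only [mul_pos_iff_of_pos_left h, sub_pos]
      split_ifs with H
      · rw [max_eq_right H.le]
      · rw [max_eq_left (not_lt.1 H)]
  have hmin : ∀ ρ, α + ρ * β ≤ 0 → Φ ρ = min (f₁ ρ) (f₂ ρ) := by
    intro ρ h
    rw [hΦ]
    rcases h.eq_or_lt with h | h
    · simp [h, hfix ρ h]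
    · have : 0 < (α + ρ * β) * (f₂ ρ - f₁ ρ) ↔ f₂ ρ < f₁ ρ :=
        ⟨fun H => by nlinarith, fun H => by nlinarith⟩
      simp only [this]
      split_ifs with H
      · rw [min_eq_right H.le]
      · rw [min_eq_left (not_lt.1 H)]
  have hpp : ∀ a b, a ≤ b → 0 ≤ α + a * β → 0 ≤ α + b * β → |Φ b - Φ a| ≤ K b - K a := by
    intro a b hab ha hb
    rw [hmax a ha, hmax b hb]
    exact (abs_max_sub_max_le_max _ _ _ _).trans (max_le (hb₁ a b hab) (hb₂ a b hab))
  have hnn : ∀ a b, a ≤ b → α + a * β ≤ 0 → α + b * β ≤ 0 → |Φ b - Φ a| ≤ K b - K a := by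
    intro a b hab ha hb
    rw [hmin a ha, hmin b hb]
    exact (abs_min_sub_min_le_max _ _ _ _).trans (max_le (hb₁ a b hab) (hb₂ a b hab))
  have hcont : Continuous fun ρ : ℝ => α + ρ * β := by fun_prop
  have hbound : ∀ a b, a ≤ b → |Φ b - Φ a| ≤ K b - K a := by
    intro a b hab
    rcases le_total 0 (α + a * β) with ha | ha <;> rcases le_total 0 (α + b * β) with hb | hb
    · exact hpp a b hab ha hb
    · obtain ⟨r, hr, hr0⟩ := intermediate_value_Icc' hab hcont.continuousOn ⟨hb, ha⟩
      simp only at hr0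
      have h1 := hpp a r hr.1 ha hr0.ge
      have h2 := hnn r b hr.2 hr0.le hb
      have := abs_sub_le (Φ b) (Φ r) (Φ a)
      linarith
    · obtain ⟨r, hr, hr0⟩ := intermediate_value_Icc hab hcont.continuousOn ⟨ha, hb⟩
      simp only at hr0
      have h1 := hnn a r hr.1 ha hr0.le
      have h2 := hpp r b hr.2 hr0.ge hb
      have := abs_sub_le (Φ b) (Φ r) (Φ a)
      linarith
    · exact hnn a b hab ha hb
  have hdist : ∀ a b, dist (Φ a) (Φ b) ≤ dist (K a) (K b) := by
    intro a b
    rcases le_total a b with hab | hab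
    · rw [dist_comm, dist_comm (K a), Real.dist_eq, Real.dist_eq]
      exact (hbound a b hab).trans (le_abs_self _)
    · rw [Real.dist_eq, Real.dist_eq]
      exact (hbound b a hab).trans (le_abs_self _)
  have hAC : AbsolutelyContinuousOnInterval Φ 0 1 := by
    have hKac : AbsolutelyContinuousOnInterval K 0 1 :=
      hK.intervalIntegrable.absolutelyContinuousOnInterval_intervalIntegral (by simp)
    exact squeeze_zero (fun _ => Finset.sum_nonneg fun i _ => dist_nonneg)
      (fun E => Finset.sum_le_sum fun i _ => hdist _ _) hKac
  refine ⟨hAC, ?_⟩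
  have hd₁ : ∀ᵐ ρ, HasDerivAt f₁ (c₁ ρ) ρ := by
    filter_upwards [LocallyIntegrable.ae_hasDerivAt_integral hc₁.locallyIntegrable] with ρ hρ
    rw [show f₁ = fun ρ => f₁ 0 + ∫ r in (0 : ℝ)..ρ, c₁ r from funext hf₁]
    exact (hρ 0).const_add _
  have hd₂ : ∀ᵐ ρ, HasDerivAt f₂ (c₂ ρ) ρ := by
    filter_upwards [LocallyIntegrable.ae_hasDerivAt_integral hc₂.locallyIntegrable] with ρ hρ
    rw [show f₂ = fun ρ => f₂ 0 + ∫ r in (0 : ℝ)..ρ, c₂ r from funext hf₂]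
    exact (hρ 0).const_add _
  have hη : (∀ ρ, α + ρ * β = 0) ∨ ∀ᵐ ρ : ℝ, α + ρ * β ≠ 0 := by
    by_cases hβ : β = 0
    · by_cases hα : α = 0
      · left; intro ρ; simp [hα, hβ]
      · right; exact Filter.Eventually.of_forall fun ρ => by simpa [hβ] using hα
    · right
      have : ∀ᵐ ρ : ℝ, ρ ≠ -α / β := by simp [ae_iff]
      filter_upwards [this] with ρ hρ h0
      apply hρ
      field_simp
      linarith
  rcases hη with hη | hη
  · have e : Φ = f₁ := by funext ρ; rw [hΦ, hη]; simp
    filter_upwards [hd₁] with ρ h1 _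
    rw [hC, hη, e]; simpa using h1
  -- Where `h ≠ 0`, the function `Φ` touches the selected one of `f₁`, `f₂` from one side.
  filter_upwards [hd₁, hd₂, hη, hAC.ae_differentiableAt] with ρ h1 h2 h3 h4 hρ
  have h5 := (h4 hρ).hasDerivAt
  suffices hs : ∀ {f c : ℝ → ℝ}, HasDerivAt f (c ρ) ρ → Φ ρ = f ρ →
      ((∀ r, 0 < α + r * β → f r ≤ Φ r) ∧ (∀ r, α + r * β < 0 → Φ r ≤ f r)) →
      HasDerivAt Φ (c ρ) ρ by
    have hΦρ := hΦ ρ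
    rw [hC]
    split_ifs at hΦρ ⊢ with H
    · exact hs h2 hΦρ ⟨fun r hr => by rw [hmax r hr.le]; exact le_max_right _ _,
        fun r hr => by rw [hmin r hr.le]; exact min_le_right _ _⟩
    · exact hs h1 hΦρ ⟨fun r hr => by rw [hmax r hr.le]; exact le_max_left _ _,
        fun r hr => by rw [hmin r hr.le]; exact min_le_left _ _⟩
  intro f c hf heq hle
  have hd := h5.sub hf
  have : deriv Φ ρ - c ρ = 0 := by
    rcases lt_or_gt_of_ne h3 with hneg | hpos
    · refine IsLocalMax.hasDerivAt_eq_zero ?_ hd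
      filter_upwards [hcont.continuousAt.eventually_lt_const hneg] with r hr
      simp only [Pi.sub_apply, heq, sub_self]
      linarith [hle.2 r hr]
    · refine IsLocalMin.hasDerivAt_eq_zero ?_ hd
      filter_upwards [hcont.continuousAt.eventually_const_lt hpos] with r hr
      simp only [Pi.sub_apply, heq, sub_self]
      linarith [hle.1 r hr]
  rwa [sub_eq_zero.1 this] at h5

/-- Integration by parts on a line. -/
lemma integral_add_mul_of_absolutelyContinuous {Φ C ψ ψ' : ℝ → ℝ}
    (hΦ : AbsolutelyContinuousOnInterval Φ 0 1)
    (hC : ∀ᵐ ρ, ρ ∈ Set.uIcc (0 : ℝ) 1 → HasDerivAt Φ (C ρ) ρ)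
    (hψ : ∀ ρ, HasDerivAt ψ (ψ' ρ) ρ) (hψ1 : ContDiff ℝ 1 ψ) :
    ∫ ρ in (0 : ℝ)..1, (Φ ρ * ψ' ρ + C ρ * ψ ρ) = Φ 1 * ψ 1 - Φ 0 * ψ 0 := by
  have hac := hΦ.mul hψ1.contDiffOn.absolutelyContinuousOnInterval
  have := hac.integral_deriv_eq_sub
  simp only [Pi.mul_apply] at this
  rw [← this]
  refine intervalIntegral.integral_congr_ae ?_
  filter_upwards [hC] with ρ hρ hρ'
  have h1 := (hρ (Set.uIoc_subset_uIcc hρ')).mul (hψ ρ)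
  rw [h1.deriv]; ring

end OneDimensional

section Lines

variable {E : Type*} [NormedAddCommGroup E]

lemma exists_bound_of_hasCompactSupport {ψ : E → ℝ} (hψ : Continuous ψ)
    (hc : HasCompactSupport ψ) :
    ∃ B R : ℝ, ∀ p, ‖ψ p‖ ≤ (Metric.closedBall (0 : E) R).indicator (fun _ => B) p := by
  obtain ⟨B, hB⟩ := hψ.bounded_above_of_compact_support hc
  obtain ⟨R, hR⟩ := hc.isCompact.isBounded.subset_closedBall 0
  refine ⟨B, R, fun p => ?_⟩
  by_cases hp : p ∈ Metric.closedBall (0 : E) R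
  · rw [Set.indicator_of_mem hp]; exact hB p
  · rw [Set.indicator_of_notMem hp, image_eq_zero_of_notMem_tsupport fun h => hp (hR h), norm_zero]

variable [NormedSpace ℝ E]

/-- The primitive of `c` along the lines of direction `w`. -/
def linePrimitive (c : E → ℝ) (w p : E) : ℝ := ∫ ρ in Set.Iic (0 : ℝ), c (p + ρ • w)

lemma linePrimitive_add_smul {c : E → ℝ} {w p : E} (h : Integrable fun ρ : ℝ => c (p + ρ • w))
    (a : ℝ) :
    linePrimitive c w (p + a • w) = linePrimitive c w p + ∫ r in (0 : ℝ)..a, c (p + r • w) := by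
  have e : linePrimitive c w (p + a • w) = ∫ ρ in Set.Iic a, c (p + ρ • w) := by
    unfold linePrimitive
    have := (measurePreserving_add_right (volume : Measure ℝ) a).setIntegral_preimage_emb
      (measurableEmbedding_addRight a) (fun ρ => c (p + ρ • w)) (Set.Iic a)
    rw [← this]
    simp only [Set.preimage_add_const_Iic, sub_self]
    refine integral_congr_ae (Filter.Eventually.of_forall fun ρ => ?_)
    simp only
    congr 1
    module
  rw [e, linePrimitive, ← intervalIntegral.integral_Iic_sub_Iic h.integrableOn h.integrableOn]
  ring

/-- A line of direction `w ≠ 0` meets a bounded set in a set of bounded length. -/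
lemma volume_line_le {w : E} (hw : w ≠ 0) (p : E) (R : ℝ) :
    volume {ρ : ℝ | p - ρ • w ∈ Metric.closedBall (0 : E) R} ≤ ENNReal.ofReal (2 * R / ‖w‖) := by
  refine (Real.volume_le_diam _).trans (Metric.ediam_le fun a ha b hb => ?_)
  rw [edist_dist]
  refine ENNReal.ofReal_le_ofReal ?_
  rw [le_div_iff₀ (norm_pos_iff.2 hw), Real.dist_eq, ← Real.norm_eq_abs, ← norm_smul]
  rw [Set.mem_ofPred_eq, mem_closedBall_zero_iff] at ha hb
  calc ‖(a - b) • w‖ = ‖(p - b • w) - (p - a • w)‖ := by congr 1; module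
    _ ≤ _ := by linarith [norm_sub_le (p - b • w) (p - a • w)]

variable [MeasurableSpace E] [BorelSpace E]

/-- The function `c` on `E` is the distributional derivative of `f` along `w`. -/
def HasWeakDeriv (μ : Measure E) (f : E → ℝ) (w : E) (c : E → ℝ) : Prop :=
  ∀ ψ : E → ℝ, ContDiff ℝ ∞ ψ → HasCompactSupport ψ →
    ∫ q, f q * fderiv ℝ ψ q w ∂μ = - ∫ q, c q * ψ q ∂μ

variable [FiniteDimensional ℝ E] {μ : Measure E} [μ.IsAddHaarMeasure]

lemma measurePreserving_shear (ν : Measure ℝ) [SFinite ν] (w : E) :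
    MeasurePreserving (fun q : ℝ × E => (q.1, q.2 + q.1 • w)) (ν.prod μ) (ν.prod μ) :=
  (MeasurePreserving.id ν).skew_product (g := fun ρ p => p + ρ • w)
    (by fun_prop) (Filter.Eventually.of_forall fun ρ => map_add_right_eq_self μ (ρ • w))

lemma integrable_mul_comp_sub {f χ : E → ℝ} {w : E} (hw : w ≠ 0) (hf : Integrable f μ)
    (hχm : Measurable χ) {B R : ℝ}
    (hχ : ∀ p, ‖χ p‖ ≤ (Metric.closedBall (0 : E) R).indicator (fun _ => B) p) :
    Integrable (fun q : ℝ × E => f q.2 * χ (q.2 - q.1 • w)) (volume.prod μ) := by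
  have hB : 0 ≤ |B| := abs_nonneg B
  have hmeas : AEStronglyMeasurable (fun q : ℝ × E => f q.2 * χ (q.2 - q.1 • w))
      (volume.prod μ) :=
    hf.1.comp_snd.mul (hχm.comp (by fun_prop)).aestronglyMeasurable
  refine ⟨hmeas, ?_⟩
  unfold HasFiniteIntegral
  rw [lintegral_prod_symm _ hmeas.enorm]
  have hbd : ∀ p, ∫⁻ ρ : ℝ, ‖f p * χ (p - ρ • w)‖ₑ ≤
      ‖f p‖ₑ * (ENNReal.ofReal |B| * ENNReal.ofReal (2 * R / ‖w‖)) := by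
    intro p
    simp only [enorm_mul]
    rw [lintegral_const_mul' _ _ enorm_ne_top]
    gcongr
    calc ∫⁻ ρ : ℝ, ‖χ (p - ρ • w)‖ₑ
        ≤ ∫⁻ ρ : ℝ, {ρ : ℝ | p - ρ • w ∈ Metric.closedBall (0 : E) R}.indicator
            (fun _ => ENNReal.ofReal |B|) ρ := by
          refine lintegral_mono fun ρ => ?_
          have := hχ (p - ρ • w)
          by_cases h : p - ρ • w ∈ Metric.closedBall (0 : E) R
          · rw [Set.indicator_of_mem (by exact h)]
            rw [Set.indicator_of_mem h] at this
            rw [← ofReal_norm]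
            exact ENNReal.ofReal_le_ofReal (this.trans (le_abs_self B))
          · rw [Set.indicator_of_notMem h] at this
            rw [norm_le_zero_iff.1 this]; simp
      _ ≤ _ := by
          refine (lintegral_indicator_const_le _ _).trans ?_
          gcongr
          exact volume_line_le hw p R
  refine (lintegral_mono hbd).trans_lt ?_
  rw [lintegral_mul_const' _ _ (by finiteness)]
  exact ENNReal.mul_lt_top hf.2 (by finiteness)

lemma integrable_comp_add_mul {c χ : E → ℝ} {w : E} (hw : w ≠ 0) (hc : Integrable c μ)
    (hχm : Measurable χ) {B R : ℝ}
    (hχ : ∀ p, ‖χ p‖ ≤ (Metric.closedBall (0 : E) R).indicator (fun _ => B) p) :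
    Integrable (fun q : ℝ × E => c (q.2 + q.1 • w) * χ q.2) (volume.prod μ) := by
  have := (measurePreserving_shear (μ := μ) volume w).integrable_comp_of_integrable
    (integrable_mul_comp_sub hw hc hχm hχ)
  refine this.congr (Filter.Eventually.of_forall fun q => ?_)
  simp

lemma ae_integrable_line {c : E → ℝ} {w : E} (hw : w ≠ 0) (hc : Integrable c μ) :
    ∀ᵐ p ∂μ, Integrable fun ρ : ℝ => c (p + ρ • w) := by
  have hk : ∀ k : ℕ, ∀ᵐ p ∂μ, p ∈ Metric.closedBall (0 : E) k →
      Integrable fun ρ : ℝ => c (p + ρ • w) := by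
    intro k
    have h := integrable_comp_add_mul (χ := (Metric.closedBall (0 : E) k).indicator fun _ => 1)
      hw hc (measurable_const.indicator Metric.isClosed_closedBall.measurableSet)
      (B := 1) (R := k) (fun p => by
        by_cases hp : p ∈ Metric.closedBall (0 : E) k
        · simp [Set.indicator_of_mem hp]
        · simp [Set.indicator_of_notMem hp])
    filter_upwards [h.prod_left_ae] with p hp hpk
    simpa [Set.indicator_of_mem hpk] using hp
  filter_upwards [ae_all_iff.2 hk] with p hp
  obtain ⟨k, hk⟩ := exists_nat_ge ‖p‖
  exact hp k (by simpa using hk)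

/-- An integrable function with an integrable weak derivative along `w` is, up to a null set, the
primitive of that derivative along the lines of direction `w`. -/
lemma ae_eq_linePrimitive {f c : E → ℝ} {w : E} (hw : w ≠ 0) (hf : Integrable f μ)
    (hc : Integrable c μ) (h : HasWeakDeriv μ f w c) :
    f =ᵐ[μ] linePrimitive c w := by
  have hprod : ∀ ψ : E → ℝ, Measurable ψ → (∃ B R : ℝ, ∀ p, ‖ψ p‖ ≤
      (Metric.closedBall (0 : E) R).indicator (fun _ => B) p) →
      Integrable (fun q : ℝ × E => c (q.2 + q.1 • w) * ψ q.2)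
        ((volume.restrict (Set.Iic 0)).prod μ) := by
    rintro ψ hψ ⟨B, R, hB⟩
    refine (integrable_comp_add_mul hw hc hψ hB).mono_measure ?_
    exact Measure.prod_mono Measure.restrict_le_self le_rfl
  have hmul : ∀ ψ : E → ℝ, Measurable ψ → (∃ B R : ℝ, ∀ p, ‖ψ p‖ ≤
      (Metric.closedBall (0 : E) R).indicator (fun _ => B) p) →
      Integrable (fun p => linePrimitive c w p * ψ p) μ := by
    intro ψ hψ hB
    refine (hprod ψ hψ hB).integral_prod_right.congr (Filter.Eventually.of_forall fun p => ?_)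
    simp only [linePrimitive]
    rw [integral_mul_const]
  refine ae_eq_of_integral_contDiff_smul_eq hf.locallyIntegrable ?_ ?_
  · intro x
    refine ⟨Metric.ball x 1, Metric.ball_mem_nhds x one_pos, ?_⟩
    have := hmul ((Metric.ball x 1).indicator fun _ => 1)
      (measurable_const.indicator Metric.isOpen_ball.measurableSet) ⟨1, ‖x‖ + 1, fun p => by
        by_cases hp : p ∈ Metric.ball x 1
        · have : p ∈ Metric.closedBall (0 : E) (‖x‖ + 1) := by
            rw [mem_closedBall_zero_iff]
            have h1 := norm_le_norm_add_norm_sub' p x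
            rw [← dist_eq_norm] at h1
            linarith [Metric.mem_ball.1 hp]
          simp [Set.indicator_of_mem hp, Set.indicator_of_mem this]
        · rw [Set.indicator_of_notMem hp, norm_zero]
          exact Set.indicator_nonneg (fun _ _ => zero_le_one) _⟩
    change IntegrableOn (linePrimitive c w) (Metric.ball x 1) μ
    rw [← integrable_indicator_iff Metric.isOpen_ball.measurableSet]
    refine this.congr (Filter.Eventually.of_forall fun p => ?_)
    by_cases hp : p ∈ Metric.ball x 1 <;> simp [hp]
  intro ψ hψ hψc
  have hψ1 : ContDiff ℝ 1 ψ := hψ.of_le (by exact_mod_cast le_top)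
  have hψd : Continuous fun q => fderiv ℝ ψ q w :=
    (hψ1.continuous_fderiv one_ne_zero).clm_apply continuous_const
  have hψdc : HasCompactSupport fun q => fderiv ℝ ψ q w := hψc.fderiv_apply ℝ w
  obtain ⟨B', R', hB'⟩ := exists_bound_of_hasCompactSupport hψd hψdc
  have hder : ∀ p, ∀ ρ : ℝ, HasDerivAt (fun ρ : ℝ => ψ (p - ρ • w))
      (-fderiv ℝ ψ (p - ρ • w) w) ρ := by
    intro p ρ
    have h1 : HasDerivAt (fun ρ : ℝ => p - ρ • w) (-w) ρ := by
      simpa using ((hasDerivAt_id ρ).smul_const w).const_sub p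
    have h2 := (hψ1.differentiable one_ne_zero (p - ρ • w)).hasFDerivAt.comp_hasDerivAt ρ h1
    rwa [map_neg] at h2
  have hint : Integrable (fun q : ℝ × E => f q.2 * fderiv ℝ ψ (q.2 - q.1 • w) w)
      (volume.prod μ) := integrable_mul_comp_sub hw hf hψd.measurable hB'
  have hint' : Integrable (fun q : ℝ × E => f q.2 * fderiv ℝ ψ (q.2 - q.1 • w) w)
      ((volume.restrict (Set.Iic 0)).prod μ) :=
    hint.mono_measure (Measure.prod_mono Measure.restrict_le_self le_rfl)
  have hcpt : ∀ p : E, HasCompactSupport fun ρ : ℝ => ψ (p - ρ • w) := by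
    intro p
    have hemb : Topology.IsClosedEmbedding fun ρ : ℝ => p - ρ • w :=
      (Homeomorph.subLeft p).isClosedEmbedding.comp
        (isClosedEmbedding_smul_left hw)
    exact hψc.comp_isClosedEmbedding hemb
  have hline : ∀ p : E, ∫ ρ in Set.Iic (0 : ℝ), fderiv ℝ ψ (p - ρ • w) w = -ψ p := by
    intro p
    have hcd : HasCompactSupport fun ρ : ℝ => fderiv ℝ ψ (p - ρ • w) w := by
      have hemb : Topology.IsClosedEmbedding fun ρ : ℝ => p - ρ • w :=
        (Homeomorph.subLeft p).isClosedEmbedding.comp (isClosedEmbedding_smul_left hw)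
      exact hψdc.comp_isClosedEmbedding hemb
    have hi : Integrable fun ρ : ℝ => fderiv ℝ ψ (p - ρ • w) w :=
      (hψd.comp (by fun_prop)).integrable_of_hasCompactSupport hcd
    have := integral_Iic_of_hasDerivAt_of_tendsto' (a := (0 : ℝ)) (m := 0)
      (fun ρ _ => hder p ρ) hi.neg.integrableOn
      ((hcpt p).is_zero_at_infty.mono_left atBot_le_cocompact)
    rw [integral_neg] at this
    simp only [zero_smul, sub_zero] at this
    linarith
  have hψb := exists_bound_of_hasCompactSupport hψ.continuous hψc
  symm
  -- Fubini and translation move the half-line integral from `c` to `ψ`; the half-line integral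
  -- of the derivative of a compactly supported function is a value of that function.
  calc ∫ p, ψ p • linePrimitive c w p ∂μ
      = ∫ p, (∫ ρ in Set.Iic (0 : ℝ), c (p + ρ • w) * ψ p) ∂μ := by
        refine integral_congr_ae (Filter.Eventually.of_forall fun p => ?_)
        simp only [smul_eq_mul, linePrimitive]
        rw [integral_mul_const, mul_comm]
    _ = ∫ ρ in Set.Iic (0 : ℝ), (∫ p, c (p + ρ • w) * ψ p ∂μ) :=
        (integral_integral_swap (hprod ψ hψ.continuous.measurable hψb)).symm
    _ = ∫ ρ in Set.Iic (0 : ℝ), -∫ p, f p * fderiv ℝ ψ (p - ρ • w) w ∂μ := by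
        refine integral_congr_ae (Filter.Eventually.of_forall fun ρ => ?_)
        have h1 := h (fun p => ψ (p - ρ • w)) (hψ.comp (by fun_prop))
          (hψc.comp_homeomorph (Homeomorph.subRight (ρ • w)))
        have h2 : ∫ p, c (p + ρ • w) * ψ p ∂μ = ∫ p, c p * ψ (p - ρ • w) ∂μ := by
          rw [← integral_add_right_eq_self (fun p => c p * ψ (p - ρ • w)) (ρ • w)]
          simp
        simp only
        rw [h2, ← neg_eq_iff_eq_neg, ← h1]
        refine integral_congr_ae (Filter.Eventually.of_forall fun p => ?_)
        simp only
        rw [fderiv_comp_sub]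
    _ = -∫ p, (∫ ρ in Set.Iic (0 : ℝ), f p * fderiv ℝ ψ (p - ρ • w) w) ∂μ := by
        rw [integral_neg, integral_integral_swap hint']
    _ = ∫ p, ψ p • f p ∂μ := by
        rw [← integral_neg]
        refine integral_congr_ae (Filter.Eventually.of_forall fun p => ?_)
        simp only
        rw [integral_const_mul, hline, smul_eq_mul]; ring

end Lines

/-! ### Weak derivatives of polarizations -/

section PolarizeDeriv

variable {α : Type*} {σ : α → α} {h : α → ℝ}

open Classical in
/-- The selection, by the swap set of `f`, of `c` and of `κ` times its reflection. If `σ` maps the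
direction `w` to `κ w`, it is the derivative along `w` of the polarization of `f`, for `c` the
derivative of `f`. -/
def polarizeDeriv (σ : α → α) (h f : α → ℝ) (κ : ℝ) (c : α → ℝ) (p : α) : ℝ :=
  if p ∈ swapSet σ h f then κ * c (σ p) else c p

lemma mem_swapSet_congr {f f' : α → ℝ} {p : α} (h1 : f p = f' p) (h2 : f (σ p) = f' (σ p)) :
    p ∈ swapSet σ h f ↔ p ∈ swapSet σ h f' := by
  simp only [swapSet, Set.mem_ofPred_eq, h1, h2]

lemma polarize_congr {f f' : α → ℝ} {p : α} (h1 : f p = f' p) (h2 : f (σ p) = f' (σ p)) :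
    polarize σ h f p = polarize σ h f' p := by
  have e := mem_swapSet_congr (h := h) h1 h2
  by_cases hp : p ∈ swapSet σ h f
  · rw [polarize, polarize, if_pos hp, if_pos (e.1 hp), h2]
  · rw [polarize, polarize, if_neg hp, if_neg (mt e.2 hp), h1]

lemma polarizeDeriv_congr {f f' c c' : α → ℝ} (κ : ℝ) {p : α} (h1 : f p = f' p)
    (h2 : f (σ p) = f' (σ p)) (h3 : c p = c' p) (h4 : c (σ p) = c' (σ p)) :
    polarizeDeriv σ h f κ c p = polarizeDeriv σ h f' κ c' p := by
  have e := mem_swapSet_congr (h := h) h1 h2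
  by_cases hp : p ∈ swapSet σ h f
  · rw [polarizeDeriv, polarizeDeriv, if_pos hp, if_pos (e.1 hp), h4]
  · rw [polarizeDeriv, polarizeDeriv, if_neg hp, if_neg (mt e.2 hp), h3]

lemma abs_polarizeDeriv_le (f c : α → ℝ) (κ : ℝ) (p : α) :
    |polarizeDeriv σ h f κ c p| ≤ |c p| + |κ * c (σ p)| := by
  unfold polarizeDeriv
  split_ifs
  · linarith [abs_nonneg (c p)]
  · linarith [abs_nonneg (κ * c (σ p))]

variable [MeasurableSpace α] {μ : Measure α}

lemma ae_eq_comp_reflection (hm : MeasurePreserving σ μ μ) {β : Type*} {f f' : α → β}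
    (hff : f =ᵐ[μ] f') : ∀ᵐ p ∂μ, f p = f' p ∧ f (σ p) = f' (σ p) := by
  filter_upwards [hff, hm.quasiMeasurePreserving.ae hff] with p h1 h2 using ⟨h1, h2⟩

lemma polarize_congr_ae (hm : MeasurePreserving σ μ μ) {f f' : α → ℝ} (hff : f =ᵐ[μ] f') :
    polarize σ h f =ᵐ[μ] polarize σ h f' := by
  filter_upwards [ae_eq_comp_reflection hm hff] with p hp using polarize_congr hp.1 hp.2

lemma polarizeDeriv_congr_ae (hm : MeasurePreserving σ μ μ) {f f' c c' : α → ℝ} (κ : ℝ)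
    (hff : f =ᵐ[μ] f') (hcc : c =ᵐ[μ] c') :
    polarizeDeriv σ h f κ c =ᵐ[μ] polarizeDeriv σ h f' κ c' := by
  filter_upwards [ae_eq_comp_reflection hm hff, ae_eq_comp_reflection hm hcc] with p hp hp'
  exact polarizeDeriv_congr κ hp.1 hp.2 hp'.1 hp'.2

lemma measurable_polarizeDeriv (hσ : Measurable σ) (hh : Measurable h) {f c : α → ℝ} (κ : ℝ)
    (hf : Measurable f) (hc : Measurable c) : Measurable (polarizeDeriv σ h f κ c) :=
  Measurable.ite (measurableSet_swapSet hσ hh hf) ((hc.comp hσ).const_mul κ) hc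

lemma integrable_polarizeDeriv (hm : MeasurePreserving σ μ μ) (hh : Measurable h) {f c : α → ℝ}
    (κ : ℝ) (hf : Measurable f) (hc : Measurable c) (hi : Integrable c μ) :
    Integrable (polarizeDeriv σ h f κ c) μ :=
  (hi.abs.add ((hm.integrable_comp_of_integrable hi).const_mul κ).abs).mono'
    (measurable_polarizeDeriv hm.measurable hh κ hf hc).aestronglyMeasurable
    (Filter.Eventually.of_forall fun p => abs_polarizeDeriv_le f c κ p)

variable {E : Type*} [NormedAddCommGroup E] [NormedSpace ℝ E] [MeasurableSpace E]
  {μ : Measure E} {σ : E → E} {h : E → ℝ}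

lemma HasWeakDeriv.congr_ae {f f' c c' : E → ℝ} {w : E} (H : HasWeakDeriv μ f w c)
    (hf : f =ᵐ[μ] f') (hc : c =ᵐ[μ] c') : HasWeakDeriv μ f' w c' := by
  intro ψ hψ hψc
  have h1 : ∫ q, f q * fderiv ℝ ψ q w ∂μ = ∫ q, f' q * fderiv ℝ ψ q w ∂μ :=
    integral_congr_ae (by filter_upwards [hf] with q hq; rw [hq])
  have h2 : ∫ q, c q * ψ q ∂μ = ∫ q, c' q * ψ q ∂μ :=
    integral_congr_ae (by filter_upwards [hc] with q hq; rw [hq])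
  rw [← h1, ← h2]
  exact H ψ hψ hψc

variable [BorelSpace E]

variable [FiniteDimensional ℝ E] [μ.IsAddHaarMeasure]

/-- A function which is absolutely continuous along almost every segment `[p, p + w]` has the
derivative along these segments as its weak derivative. -/
lemma hasWeakDeriv_of_absolutelyContinuous {F D : E → ℝ} {w : E} (hF : Integrable F μ)
    (hD : Integrable D μ)
    (hac : ∀ᵐ p ∂μ, AbsolutelyContinuousOnInterval (fun ρ : ℝ => F (p + ρ • w)) 0 1 ∧
      ∀ᵐ ρ : ℝ, ρ ∈ Set.uIcc (0 : ℝ) 1 →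
        HasDerivAt (fun ρ : ℝ => F (p + ρ • w)) (D (p + ρ • w)) ρ) :
    HasWeakDeriv μ F w D := by
  intro ψ hψ hψc
  have hψ1 : ContDiff ℝ 1 ψ := hψ.of_le (by exact_mod_cast le_top)
  have hψd : Continuous fun q => fderiv ℝ ψ q w :=
    (hψ1.continuous_fderiv one_ne_zero).clm_apply continuous_const
  obtain ⟨B, hB⟩ := hψ.continuous.bounded_above_of_compact_support hψc
  obtain ⟨B', hB'⟩ := hψd.bounded_above_of_compact_support (hψc.fderiv_apply ℝ w)
  have i1 : Integrable (fun q => F q * fderiv ℝ ψ q w) μ :=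
    hF.mul_bdd hψd.aestronglyMeasurable (Filter.Eventually.of_forall hB')
  have i2 : Integrable (fun q => D q * ψ q) μ :=
    hD.mul_bdd hψ.continuous.aestronglyMeasurable (Filter.Eventually.of_forall hB)
  have i3 : Integrable (fun q => F q * ψ q) μ :=
    hF.mul_bdd hψ.continuous.aestronglyMeasurable (Filter.Eventually.of_forall hB)
  let G : E → ℝ := fun q => F q * fderiv ℝ ψ q w + D q * ψ q
  have iG : Integrable G μ := i1.add i2
  have hline : ∀ᵐ p ∂μ, ∫ ρ in Set.Ioc (0 : ℝ) 1, G (p + ρ • w) =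
      F (p + w) * ψ (p + w) - F p * ψ p := by
    filter_upwards [hac] with p hp
    have hlin : ∀ ρ : ℝ, HasDerivAt (fun ρ : ℝ => p + ρ • w) w ρ := fun ρ => by
      simpa using ((hasDerivAt_id ρ).smul_const w).const_add p
    have hd : ∀ ρ : ℝ, HasDerivAt (fun ρ : ℝ => ψ (p + ρ • w)) (fderiv ℝ ψ (p + ρ • w) w) ρ :=
      fun ρ => (hψ1.differentiable one_ne_zero (p + ρ • w)).hasFDerivAt.comp_hasDerivAt ρ (hlin ρ)
    have := integral_add_mul_of_absolutelyContinuous hp.1 hp.2 hd (hψ1.comp (by fun_prop))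
    rw [intervalIntegral.integral_of_le zero_le_one] at this
    simpa using this
  have hswap : Integrable (fun q : ℝ × E => G (q.2 + q.1 • w))
      ((volume.restrict (Set.Ioc (0 : ℝ) 1)).prod μ) :=
    (measurePreserving_shear (μ := μ) (volume.restrict
      (Set.Ioc (0 : ℝ) 1)) w).integrable_comp_of_integrable
        (g := fun q : ℝ × E => G q.2) (iG.comp_snd _)
  -- By translation invariance the integral of `G` is the integral of the mean of `G` over the
  -- segments `q + [0, 1] • w`.
  have key : ∫ q, G q ∂μ = 0 := by
    calc ∫ q, G q ∂μ = ∫ ρ in Set.Ioc (0 : ℝ) 1, (∫ q, G q ∂μ) := by simp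
      _ = ∫ ρ in Set.Ioc (0 : ℝ) 1, (∫ p, G (p + ρ • w) ∂μ) := by
          refine integral_congr_ae (Filter.Eventually.of_forall fun ρ => ?_)
          exact (integral_add_right_eq_self G (ρ • w)).symm
      _ = ∫ p, (∫ ρ in Set.Ioc (0 : ℝ) 1, G (p + ρ • w)) ∂μ := integral_integral_swap hswap
      _ = ∫ p, (F (p + w) * ψ (p + w) - F p * ψ p) ∂μ := integral_congr_ae hline
      _ = 0 := by
          rw [integral_sub (i3.comp_add_right w) i3,
            integral_add_right_eq_self (fun q => F q * ψ q) w, sub_self]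
  have := integral_add i1 i2
  rw [show ∫ q, (F q * fderiv ℝ ψ q w + D q * ψ q) ∂μ = 0 from key] at this
  linarith

/-- The case of a measurable derivative `c`, in which `f` is replaced by the line primitive of `c`. -/
lemma HasWeakDeriv.polarize_of_measurable (hσ : IsReflection σ h) (hm : MeasurePreserving σ μ μ)
    (hh : Measurable h) {w : E} (hw : w ≠ 0) {κ β : ℝ} (hκ : κ ≠ 0)
    (hline : ∀ p, ∀ ρ : ℝ, σ (p + ρ • w) = σ p + (κ * ρ) • w)
    (hhline : ∀ p, ∀ ρ : ℝ, h (p + ρ • w) = h p + ρ * β) {f c : E → ℝ}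
    (hcm : Measurable c) (hf : Integrable f μ) (hc : Integrable c μ) (H : HasWeakDeriv μ f w c) :
    HasWeakDeriv μ (polarize σ h f) w (polarizeDeriv σ h f κ c) := by
  let F := linePrimitive c w
  have hfF : f =ᵐ[μ] F := ae_eq_linePrimitive hw hf hc H
  have hFm : Measurable F := by
    have : StronglyMeasurable fun p : E => ∫ ρ in Set.Iic (0 : ℝ), c (p + ρ • w) :=
      StronglyMeasurable.integral_prod_right (f := fun (p : E) (ρ : ℝ) => c (p + ρ • w))
        (hcm.comp (by fun_prop)).stronglyMeasurable
    exact this.measurable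
  have hFi : Integrable F μ := hf.congr hfF
  refine HasWeakDeriv.congr_ae (f := polarize σ h F) (c := polarizeDeriv σ h F κ c) ?_
    (polarize_congr_ae hm hfF.symm)
    (polarizeDeriv_congr_ae hm κ hfF.symm (Filter.EventuallyEq.refl _ c))
  refine hasWeakDeriv_of_absolutelyContinuous (hσ.integrable_polarize hm hh hFm hFi)
    (integrable_polarizeDeriv hm hh κ hFm hcm hc) ?_
  have hgood := ae_integrable_line (μ := μ) hw hc
  filter_upwards [hgood, hm.quasiMeasurePreserving.ae hgood] with p hp hσp
  refine absolutelyContinuous_selection (f₁ := fun ρ => F (p + ρ • w))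
    (f₂ := fun ρ => F (σ (p + ρ • w))) (c₁ := fun ρ => c (p + ρ • w))
    (c₂ := fun ρ => κ * c (σ (p + ρ • w))) (α := h p) (β := β) hp ?_ ?_ ?_ ?_ ?_ ?_
  · simp only [hline]
    have := hσp.comp_mul_left' hκ
    exact this.const_mul κ
  · intro ρ
    simp only [zero_smul, add_zero]
    exact linePrimitive_add_smul hp ρ
  · intro ρ
    simp only [hline, zero_smul, add_zero]
    rw [intervalIntegral.integral_const_mul]
    have := linePrimitive_add_smul hσp (κ * ρ)
    rw [show F (σ p + (κ * ρ) • w) = _ from this]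
    congr 1
    have h2 := intervalIntegral.integral_comp_mul_left (fun r => c (σ p + r • w)) (a := 0)
      (b := ρ) hκ
    rw [h2, mul_zero, smul_eq_mul, ← mul_assoc, mul_inv_cancel₀ hκ, one_mul]
  · intro ρ hρ
    rw [hσ.fix _ (by rw [hhline, hρ])]
  · intro ρ
    simp only [polarize, swapSet, Set.mem_ofPred_eq, hhline]
  · intro ρ
    simp only [polarizeDeriv, swapSet, Set.mem_ofPred_eq, hhline]

/-- The weak derivative of the polarization of `f`, along a direction `w` which the reflection maps
to a multiple of itself: it is `c`, or its reflection, according to which of `f`, `f ∘ σ` is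
selected. -/
lemma HasWeakDeriv.polarize (hσ : IsReflection σ h) (hm : MeasurePreserving σ μ μ)
    (hh : Measurable h) {w : E} (hw : w ≠ 0) {κ β : ℝ} (hκ : κ ≠ 0)
    (hline : ∀ p, ∀ ρ : ℝ, σ (p + ρ • w) = σ p + (κ * ρ) • w)
    (hhline : ∀ p, ∀ ρ : ℝ, h (p + ρ • w) = h p + ρ * β) {f c : E → ℝ}
    (hf : Integrable f μ) (hc : Integrable c μ) (H : HasWeakDeriv μ f w c) :
    HasWeakDeriv μ (SteinerProduct.polarize σ h f) w (polarizeDeriv σ h f κ c) := by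
  obtain ⟨c', hc'm, hcc'⟩ := hc.1
  have := HasWeakDeriv.polarize_of_measurable hσ hm hh hw hκ hline hhline hc'm.measurable hf
    (hc.congr hcc') (H.congr_ae (Filter.EventuallyEq.refl _ f) hcc')
  exact this.congr_ae (Filter.EventuallyEq.refl _ _)
    (polarizeDeriv_congr_ae hm κ (Filter.EventuallyEq.refl _ f) hcc'.symm)

end PolarizeDeriv

/-! ### The volume of a Riemannian manifold in charts -/

instance {m n : ℕ} : (volume : Measure (Eucl m × Eucl n)).IsAddHaarMeasure :=
  inferInstanceAs ((volume : Measure (Eucl m)).prod (volume : Measure (Eucl n))).IsAddHaarMeasure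

section Charts

variable {m : ℕ} {M : Type*} [TopologicalSpace M] [ChartedSpace (Eucl m) M]

section Derivative

variable [IsManifold (𝓡 m) ∞ M]

lemma continuousOn_coordVector (x : M) (v : Eucl m) :
    ContinuousOn (fun y => (⟨(chartAt (Eucl m) x).symm y, coordVector x y v⟩ :
      TangentBundle (𝓡 m) M)) (chartAt (Eucl m) x).target := by
  have : IsManifold (𝓡 m) 1 M := IsManifold.of_le (n := ∞) (by exact_mod_cast le_top)
  have h := (contMDiffOn_chart_symm (I := 𝓡 m) (n := 1) (x := x)).continuousOn_tangentMapWithin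
    le_rfl (chartAt (Eucl m) x).open_target.uniqueMDiffOn
  have hc : Continuous fun y : Eucl m => (⟨y, v⟩ : TangentBundle (𝓡 m) (Eucl m)) :=
    (tangentBundleModelSpaceHomeomorph (𝓡 m)).symm.continuous.comp
      (f := fun y : Eucl m => ((y, v) : ModelProd (Eucl m) (Eucl m)))
      (continuous_id.prodMk continuous_const)
  refine (h.comp hc.continuousOn fun y hy => hy).congr fun y hy => ?_
  simp only [tangentMapWithin, Function.comp]
  rw [mfderivWithin_of_isOpen (chartAt (Eucl m) x).open_target hy]
  rfl

lemma continuousOn_inner_coordVector (g : SmoothMetric m M) (x : M) (v w : Eucl m) :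
    ContinuousOn (fun y => g.inner ((chartAt (Eucl m) x).symm y) (coordVector x y v)
      (coordVector x y w)) (chartAt (Eucl m) x).target := by
  intro y hy
  have hv := continuousOn_coordVector x v y hy
  have hw := continuousOn_coordVector x w y hy
  have hb := (chartAt (Eucl m) x).continuousOn_symm y hy
  have := (g.contMDiff.continuous.continuousAt.comp_continuousWithinAt hb).clm_bundle_apply₂
    (F₁ := Eucl m) (F₂ := Eucl m) (F₃ := ℝ) (E₃ := Bundle.Trivial M ℝ) hv hw
  simp only [FiberBundle.continuousWithinAt_totalSpace] at this
  exact this.2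

lemma bijective_coordVector (x : M) {y : Eucl m} (hy : y ∈ (chartAt (Eucl m) x).target) :
    Function.Bijective (coordVector x y) := by
  have : IsManifold (𝓡 m) 1 M := IsManifold.of_le (n := ∞) (by exact_mod_cast le_top)
  exact (mdifferentiable_chart (I := 𝓡 m) x).symm.mfderiv_bijective hy

end Derivative

/-- `coordVector x y` as a linear map. -/
def coordLinear (x : M) (y : Eucl m) :
    Eucl m →ₗ[ℝ] TangentSpace (𝓡 m) ((chartAt (Eucl m) x).symm y) where
  toFun := coordVector x y
  map_add' := (mfderiv 𝓘(ℝ, Eucl m) (𝓡 m) (chartAt (Eucl m) x).symm y).map_add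
  map_smul' := (mfderiv 𝓘(ℝ, Eucl m) (𝓡 m) (chartAt (Eucl m) x).symm y).map_smul

variable [IsManifold (𝓡 m) ∞ M]

lemma continuousOn_volumeDensity (g : SmoothMetric m M) (x : M) :
    ContinuousOn (volumeDensity g x) (chartAt (Eucl m) x).target := by
  unfold volumeDensity
  refine Real.continuous_sqrt.comp_continuousOn ?_
  simp only [Matrix.det_apply]
  refine continuousOn_finsetSum _ fun σ _ => ContinuousOn.const_smul ?_ _
  exact continuousOn_finsetProd _ fun i _ => continuousOn_inner_coordVector g x _ _

lemma volumeDensity_pos (g : SmoothMetric m M) (x : M) {y : Eucl m}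
    (hy : y ∈ (chartAt (Eucl m) x).target) : 0 < volumeDensity g x y := by
  refine Real.sqrt_pos.2 (Matrix.PosDef.det_pos
    (Matrix.PosDef.of_dotProduct_mulVec_pos ?_ fun a ha => ?_))
  · ext i j
    simp [Matrix.conjTranspose_apply, g.symm]
  · let b := g.inner ((chartAt (Eucl m) x).symm y)
    let v : Eucl m := ∑ i, a i • EuclideanSpace.single i 1
    have hv : coordVector x y v = ∑ i, a i • coordVector x y (EuclideanSpace.single i 1) := by
      change coordLinear x y v = _
      rw [map_sum]
      exact Finset.sum_congr rfl fun i _ => (coordLinear x y).map_smul _ _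
    have hv0 : v ≠ 0 := by
      intro h
      apply ha
      funext i
      have := congrArg (fun w : Eucl m => w i) h
      simpa [v, Finset.sum_apply, Pi.single_apply] using this
    have hne : coordVector x y v ≠ 0 := fun h => hv0 ((bijective_coordVector x hy).1
      (h.trans (coordLinear x y).map_zero.symm))
    have hpos : 0 < b (coordVector x y v) (coordVector x y v) := g.pos _ _ hne
    have e : b (coordVector x y v) (coordVector x y v) = ∑ i, a i * ∑ j,
        b (coordVector x y (EuclideanSpace.single i 1))
          (coordVector x y (EuclideanSpace.single j 1)) * a j := by
      rw [hv, map_sum b, sum_apply]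
      refine Finset.sum_congr rfl fun i _ => ?_
      rw [map_smul b, smul_apply, map_sum, smul_eq_mul]
      congr 1
      refine Finset.sum_congr rfl fun j _ => ?_
      rw [map_smul, smul_eq_mul, mul_comm]
    rw [e] at hpos
    simpa [dotProduct, Matrix.mulVec] using hpos

variable [MeasurableSpace M] [BorelSpace M]

open Classical in
/-- The inverse of the preferred chart at `x`, extended from the target of the chart to a measurable
function on `ℝᵐ`. -/
def invM (x : M) (y : Eucl m) : M :=
  if y ∈ (chartAt (Eucl m) x).target then (chartAt (Eucl m) x).symm y else x

omit [IsManifold (𝓡 m) ∞ M] in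
lemma measurable_invM (x : M) : Measurable (invM (m := m) x) := by
  classical
  have := ((chartAt (Eucl m) x).continuousOn_symm).measurable_piecewise
    (g := fun _ => x) continuousOn_const (chartAt (Eucl m) x).open_target.measurableSet
  convert this using 1
  funext y
  simp [invM, Set.piecewise]

omit [IsManifold (𝓡 m) ∞ M] [MeasurableSpace M] [BorelSpace M] in
lemma invM_of_mem {x : M} {y : Eucl m} (hy : y ∈ (chartAt (Eucl m) x).target) :
    invM x y = (chartAt (Eucl m) x).symm y := if_pos hy

omit [MeasurableSpace M] [BorelSpace M] in
lemma aemeasurable_volumeDensity (g : SmoothMetric m M) (x : M) :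
    AEMeasurable (fun y => ENNReal.ofReal (volumeDensity g x y))
      (volume.restrict (chartAt (Eucl m) x).target) :=
  ((continuousOn_volumeDensity g x).aemeasurable
    (chartAt (Eucl m) x).open_target.measurableSet).ennreal_ofReal

omit [BorelSpace M] in
lemma chartVolume_eq (g : SmoothMetric m M) (x : M) :
    chartVolume g x = Measure.map (invM x)
      ((volume.restrict (chartAt (Eucl m) x).target).withDensity
        fun y => ENNReal.ofReal (volumeDensity g x y)) := by
  refine Measure.map_congr ?_
  refine (withDensity_absolutelyContinuous _ _).ae_le ?_
  filter_upwards [ae_restrict_mem (chartAt (Eucl m) x).open_target.measurableSet] with y hy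
  exact (invM_of_mem hy).symm

/-- On compact subsets of a chart, Lebesgue measure is bounded by the Riemannian volume. -/
lemma map_restrict_le (g : SmoothMetric m M) (x : M) {K : Set (Eucl m)} (hK : IsCompact K)
    (hKt : K ⊆ (chartAt (Eucl m) x).target) :
    ∃ C : ℝ≥0∞, C ≠ ⊤ ∧ Measure.map (invM x) (volume.restrict K) ≤ C • riemannianVolume g := by
  obtain ⟨δ, hδ, hle⟩ : ∃ δ : ℝ, 0 < δ ∧ ∀ y ∈ K, δ ≤ volumeDensity g x y := by
    rcases K.eq_empty_or_nonempty with rfl | hne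
    · exact ⟨1, one_pos, by simp⟩
    · obtain ⟨y, hy, hmin⟩ := hK.exists_isMinOn hne ((continuousOn_volumeDensity g x).mono hKt)
      exact ⟨_, volumeDensity_pos g x (hKt hy), hmin⟩
  have hd0 : ENNReal.ofReal δ ≠ 0 := by simpa using hδ
  refine ⟨(ENNReal.ofReal δ)⁻¹, ENNReal.inv_ne_top.2 hd0, ?_⟩
  have h1 : (volume : Measure (Eucl m)).restrict K ≤ (ENNReal.ofReal δ)⁻¹ •
      ((volume.restrict (chartAt (Eucl m) x).target).withDensity
        fun y => ENNReal.ofReal (volumeDensity g x y)) := by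
    refine Measure.le_iff.2 fun A hA => ?_
    rw [Measure.smul_apply, withDensity_apply _ hA, smul_eq_mul,
      ← ENNReal.div_eq_inv_mul,
      ENNReal.le_div_iff_mul_le (Or.inl hd0) (Or.inl ENNReal.ofReal_ne_top), mul_comm,
      Measure.restrict_restrict hA, Measure.restrict_apply hA,
      ← setLIntegral_const]
    calc ∫⁻ _ in A ∩ K, ENNReal.ofReal δ
        ≤ ∫⁻ y in A ∩ K, ENNReal.ofReal (volumeDensity g x y) :=
          setLIntegral_mono' (hA.inter hK.measurableSet) fun y hy =>
            ENNReal.ofReal_le_ofReal (hle y hy.2)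
      _ ≤ _ := lintegral_mono_set (Set.inter_subset_inter_right _ hKt)
  calc Measure.map (invM x) (volume.restrict K)
      ≤ Measure.map (invM x) ((ENNReal.ofReal δ)⁻¹ •
        ((volume.restrict (chartAt (Eucl m) x).target).withDensity
          fun y => ENNReal.ofReal (volumeDensity g x y))) :=
        Measure.map_mono h1 (measurable_invM x)
    _ = (ENNReal.ofReal δ)⁻¹ • chartVolume g x := by
        rw [Measure.map_smul, chartVolume_eq]
    _ ≤ _ := by
        gcongr
        exact le_iSup (chartVolume g) x

/-- The density of the Riemannian volume in a chart is positive, so that null sets of the manifold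
are Lebesgue null in charts. -/
lemma map_invM_absolutelyContinuous (g : SmoothMetric m M) (x : M) :
    Measure.map (invM x) (volume.restrict (chartAt (Eucl m) x).target) ≪ riemannianVolume g := by
  have h1 := withDensity_absolutelyContinuous' (aemeasurable_volumeDensity g x) (by
    filter_upwards [ae_restrict_mem (chartAt (Eucl m) x).open_target.measurableSet] with y hy
    simpa using volumeDensity_pos g x hy)
  refine (h1.map (measurable_invM x)).trans ?_
  rw [← chartVolume_eq]
  exact Measure.absolutelyContinuous_of_le (le_iSup (chartVolume g) x)

/-- A measurable subset of a chart domain which is Lebesgue null in that chart is null for the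
Riemannian volume: the transition maps preserve null sets, so it is null for every chart volume, and
the restriction of the supremum to the complement still dominates all of them. -/
lemma riemannianVolume_eq_zero (g : SmoothMetric m M) (x : M) {D : Set M} (hD : MeasurableSet D)
    (hDs : D ⊆ (chartAt (Eucl m) x).source)
    (h0 : volume ((chartAt (Eucl m) x).target ∩ (chartAt (Eucl m) x).symm ⁻¹' D) = 0) :
    riemannianVolume g D = 0 := by
  have hchart : ∀ x', chartVolume g x' D = 0 := by
    intro x'
    set φ := chartAt (Eucl m) x
    set φ' := chartAt (Eucl m) x'
    have hsub : φ'.target ∩ φ'.symm ⁻¹' D ⊆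
        (φ' ∘ φ.symm) '' (φ.target ∩ φ.symm ⁻¹' (D ∩ φ'.source)) := by
      rintro y ⟨hy, hyD⟩
      have h1 : φ'.symm y ∈ φ.source := hDs hyD
      refine ⟨φ (φ'.symm y), ⟨φ.map_source h1, ?_⟩, ?_⟩
      · rw [Set.mem_preimage, φ.left_inv h1]
        exact ⟨hyD, φ'.map_target hy⟩
      · rw [Function.comp, φ.left_inv h1, φ'.right_inv hy]
    have hnull : volume (φ'.target ∩ φ'.symm ⁻¹' D) = 0 := by
      refine measure_mono_null hsub ?_
      refine addHaar_image_eq_zero_of_differentiableOn_of_addHaar_eq_zero volume ?_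
        (measure_mono_null (Set.inter_subset_inter_right _
          (Set.preimage_mono Set.inter_subset_left)) h0)
      have h1 : ContMDiffOn (𝓡 m) (𝓡 m) ∞ (φ' ∘ φ.symm) (φ.target ∩ φ.symm ⁻¹' (D ∩ φ'.source)) :=
        (contMDiffOn_chart (I := 𝓡 m) (x := x')).comp
          ((contMDiffOn_chart_symm (I := 𝓡 m) (x := x)).mono Set.inter_subset_left)
          fun y hy => hy.2.2
      exact (contMDiffOn_iff_contDiffOn.1 h1).differentiableOn (by simp)
    rw [chartVolume_eq, Measure.map_apply (measurable_invM x') hD]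
    refine withDensity_absolutelyContinuous _ _ ?_
    rw [Measure.restrict_apply (measurable_invM x' hD)]
    refine measure_mono_null ?_ hnull
    rintro y ⟨hy, hyt⟩
    refine ⟨hyt, ?_⟩
    rw [Set.mem_preimage, invM_of_mem hyt] at hy
    exact hy
  have hle : riemannianVolume g ≤ (riemannianVolume g).restrict Dᶜ := by
    refine iSup_le fun x' => ?_
    refine Measure.le_iff.2 fun A hA => ?_
    rw [Measure.restrict_apply hA]
    calc chartVolume g x' A ≤ chartVolume g x' (A ∩ Dᶜ) + chartVolume g x' D := by
          refine (measure_mono fun p hp => ?_).trans (measure_union_le _ _)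
          by_cases hpD : p ∈ D
          · exact Or.inr hpD
          · exact Or.inl ⟨hp, hpD⟩
      _ = chartVolume g x' (A ∩ Dᶜ) := by rw [hchart, add_zero]
      _ ≤ _ := le_iSup (chartVolume g) x' _
  have := Measure.le_iff.1 hle D hD
  rw [Measure.restrict_apply hD, Set.inter_compl_self, measure_empty] at this
  exact le_antisymm this zero_le

end Charts

section ProductCharts

variable {m n : ℕ} {M : Type*} [TopologicalSpace M] [ChartedSpace (Eucl m) M]
  [IsManifold (𝓡 m) ∞ M] [MeasurableSpace M] [BorelSpace M]

variable (n) in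
/-- The domain of the chart `φ × id` of `M × ℝⁿ` in `ℝᵐ × ℝⁿ`. -/
def prodTarget (x : M) : Set (Eucl m × Eucl n) := (chartAt (Eucl m) x).target ×ˢ Set.univ

omit [IsManifold (𝓡 m) ∞ M] [MeasurableSpace M] [BorelSpace M] in
lemma isOpen_prodTarget (x : M) : IsOpen (prodTarget (m := m) n x) :=
  (chartAt (Eucl m) x).open_target.prod isOpen_univ

variable (n) in
/-- The inverse of `φ × id`, extended to a measurable function. -/
def prodInvM (x : M) : Eucl m × Eucl n → M × Eucl n := Prod.map (invM x) id

omit [IsManifold (𝓡 m) ∞ M] in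
lemma measurable_prodInvM (x : M) : Measurable (prodInvM (m := m) n x) :=
  (measurable_invM x).prodMap measurable_id

omit [IsManifold (𝓡 m) ∞ M] [MeasurableSpace M] [BorelSpace M] in
lemma prodInvM_of_mem {x : M} {q : Eucl m × Eucl n} (hq : q ∈ prodTarget (m := m) n x) :
    prodInvM n x q = prodChartInv x q := by
  simp [prodInvM, prodChartInv, invM_of_mem hq.1, Prod.map]

lemma volume_restrict_prod (K : Set (Eucl m)) :
    (volume : Measure (Eucl m × Eucl n)).restrict (K ×ˢ Set.univ) =
      ((volume : Measure (Eucl m)).restrict K).prod volume := by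
  rw [Measure.volume_eq_prod, ← Measure.prod_restrict, Measure.restrict_univ]

lemma map_prodInvM_le (g : SmoothMetric m M) (x : M) {K : Set (Eucl m)} (hK : IsCompact K)
    (hKt : K ⊆ (chartAt (Eucl m) x).target) :
    ∃ C : ℝ≥0∞, C ≠ ⊤ ∧ Measure.map (prodInvM n x) (volume.restrict (K ×ˢ Set.univ)) ≤
      C • productVolume g n := by
  obtain ⟨C, hC, hle⟩ := map_restrict_le g x hK hKt
  refine ⟨C, hC, ?_⟩
  rw [volume_restrict_prod, prodInvM, ← Measure.map_prod_map _ _ (measurable_invM x) measurable_id,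
    Measure.map_id]
  refine (Measure.prod_mono hle le_rfl).trans ?_
  rw [Measure.prod_smul_left, productVolume]

/-- A property which holds almost everywhere on `M × ℝⁿ` holds almost everywhere in every chart. -/
lemma ae_chart_of_ae (g : SmoothMetric m M) (x : M) {P : M × Eucl n → Prop}
    (hP : ∀ᵐ p ∂productVolume g n, P p) :
    ∀ᵐ q ∂(volume.restrict (prodTarget (m := m) n x)), P (prodChartInv x q) := by
  have hac : Measure.map (prodInvM n x) (volume.restrict (prodTarget (m := m) n x)) ≪
      productVolume g n := by
    rw [prodTarget, volume_restrict_prod, prodInvM,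
      ← Measure.map_prod_map _ _ (measurable_invM x) measurable_id, Measure.map_id]
    exact (map_invM_absolutelyContinuous g x).prod Measure.AbsolutelyContinuous.rfl
  have := ae_of_ae_map (measurable_prodInvM x).aemeasurable (hac.ae_le hP)
  filter_upwards [this, ae_restrict_mem (isOpen_prodTarget (m := m) x).measurableSet] with q hq hqt
  rwa [prodInvM_of_mem hqt] at hq

lemma aemeasurable_chart (g : SmoothMetric m M) (x : M) {β : Type*} [MeasurableSpace β]
    {f : M × Eucl n → β} (hf : AEMeasurable f (productVolume g n)) :
    AEMeasurable (fun q => f (prodChartInv x q))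
      (volume.restrict (prodTarget (m := m) n x)) := by
  obtain ⟨f', hf', hff'⟩ := hf
  refine ⟨f' ∘ prodInvM n x, hf'.comp (measurable_prodInvM x), ?_⟩
  filter_upwards [ae_chart_of_ae g x hff',
    ae_restrict_mem (isOpen_prodTarget (m := m) x).measurableSet] with q hq hqt
  rw [hq, Function.comp, prodInvM_of_mem hqt]

variable (n) in
/-- The domain of the chart `φ × id` in `M × ℝⁿ`. -/
def prodSource (x : M) : Set (M × Eucl n) := (chartAt (Eucl m) x).source ×ˢ Set.univ

variable (n) in
/-- The chart `φ × id` of `M × ℝⁿ`. -/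
def prodChart (x : M) (p : M × Eucl n) : Eucl m × Eucl n := (chartAt (Eucl m) x p.1, p.2)

omit [IsManifold (𝓡 m) ∞ M] [MeasurableSpace M] [BorelSpace M] in
lemma prodChartInv_prodChart {x : M} {p : M × Eucl n} (hp : p ∈ prodSource (m := m) n x) :
    prodChartInv x (prodChart (m := m) n x p) = p := by
  simp [prodChartInv, prodChart, (chartAt (Eucl m) x).left_inv hp.1]

omit [IsManifold (𝓡 m) ∞ M] [MeasurableSpace M] [BorelSpace M] in
lemma prodChart_prodChartInv {x : M} {q : Eucl m × Eucl n} (hq : q ∈ prodTarget (m := m) n x) :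
    prodChart (m := m) n x (prodChartInv x q) = q := by
  simp [prodChartInv, prodChart, (chartAt (Eucl m) x).right_inv hq.1]

omit [IsManifold (𝓡 m) ∞ M] [MeasurableSpace M] [BorelSpace M] in
lemma prodChartInv_mem {x : M} {q : Eucl m × Eucl n} (hq : q ∈ prodTarget (m := m) n x) :
    prodChartInv x q ∈ prodSource (m := m) n x :=
  ⟨(chartAt (Eucl m) x).map_target hq.1, trivial⟩

omit [IsManifold (𝓡 m) ∞ M] in
lemma measurableSet_prodSource (x : M) : MeasurableSet (prodSource (m := m) n x) :=
  (chartAt (Eucl m) x).open_source.measurableSet.prod MeasurableSet.univ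

open Classical in
omit [IsManifold (𝓡 m) ∞ M] in
lemma exists_measurable_prodChart (x : M) : ∃ Φ : M × Eucl n → Eucl m × Eucl n, Measurable Φ ∧
    ∀ p ∈ prodSource (m := m) n x, Φ p = prodChart (m := m) n x p := by
  have h := ((chartAt (Eucl m) x).continuousOn).measurable_piecewise
    (g := fun _ => (0 : Eucl m)) continuousOn_const (chartAt (Eucl m) x).open_source.measurableSet
  refine ⟨Prod.map ((chartAt (Eucl m) x).source.piecewise (chartAt (Eucl m) x) fun _ => 0) id,
    h.prodMap measurable_id, fun p hp => ?_⟩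
  simp [prodChart, Prod.map, Set.piecewise_eq_of_mem _ _ _ hp.1]

/-- A property which holds almost everywhere in the chart at `x` holds almost everywhere on the
corresponding part of `M × ℝⁿ`. -/
lemma ae_of_ae_chart (g : SmoothMetric m M) (x : M) {P : M × Eucl n → Prop}
    (hP : ∀ᵐ q ∂(volume.restrict (prodTarget (m := m) n x)), P (prodChartInv x q)) :
    ∀ᵐ p ∂productVolume g n, p ∈ prodSource (m := m) n x → P p := by
  obtain ⟨Φ, hΦm, hΦ⟩ := exists_measurable_prodChart (m := m) (n := n) x
  set T := toMeasurable (volume.restrict (prodTarget (m := m) n x))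
    {q | ¬ P (prodChartInv x q)}
  have hTm : MeasurableSet T := measurableSet_toMeasurable _ _
  have hT0 : volume.restrict (prodTarget (m := m) n x) T = 0 := by
    rw [measure_toMeasurable]; exact hP
  have hTsub := subset_toMeasurable (volume.restrict (prodTarget (m := m) n x))
    {q | ¬ P (prodChartInv x q)}
  let B : Set (M × Eucl n) := prodSource (m := m) n x ∩ Φ ⁻¹' T
  have hB : MeasurableSet B := (measurableSet_prodSource x).inter (hΦm hTm)
  suffices h : productVolume g n B = 0 by
    rw [ae_iff]
    refine measure_mono_null (fun p hp => ?_) h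
    simp only [Set.mem_ofPred_eq, Classical.not_imp] at hp
    refine ⟨hp.1, ?_⟩
    rw [Set.mem_preimage, hΦ p hp.1]
    apply hTsub
    simpa [prodChartInv_prodChart hp.1] using hp.2
  rw [productVolume, Measure.measure_prod_null hB]
  let D : Set M := {a | volume (Prod.mk a ⁻¹' B) ≠ 0}
  have hDm : MeasurableSet D :=
    (measurable_measure_prodMk_left hB) (measurableSet_singleton 0).compl
  have hDs : D ⊆ (chartAt (Eucl m) x).source := by
    intro a ha
    by_contra hna
    refine ha ?_
    have : Prod.mk a ⁻¹' B = ∅ := by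
      ext z
      simp only [Set.mem_preimage, Set.mem_empty_iff_false, iff_false]
      exact fun hz => hna hz.1.1
    rw [this, measure_empty]
  refine ae_iff.2 (riemannianVolume_eq_zero g x hDm hDs ?_)
  rw [prodTarget, volume_restrict_prod, Measure.measure_prod_null hTm, Filter.EventuallyEq,
    ae_restrict_iff' (chartAt (Eucl m) x).open_target.measurableSet, ae_iff] at hT0
  refine measure_mono_null ?_ hT0
  rintro y ⟨hyt, hyD⟩
  simp only [Set.mem_ofPred_eq, Classical.not_imp]
  refine ⟨hyt, fun h => hyD (measure_mono_null (fun z hz => ?_) h)⟩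
  have h1 := hz.2
  rw [Set.mem_preimage, hΦ _ hz.1] at h1
  simpa [prodChart, (chartAt (Eucl m) x).right_inv hyt] using h1

variable (M) in
omit [IsManifold (𝓡 m) ∞ M] [MeasurableSpace M] [BorelSpace M] in
lemma exists_finset_cover [CompactSpace M] :
    ∃ t : Finset M, ⋃ x : t, prodSource (m := m) n (x : M) = Set.univ := by
  obtain ⟨t, ht⟩ := isCompact_univ.elim_finite_subcover (fun x : M => (chartAt (Eucl m) x).source)
    (fun x => (chartAt (Eucl m) x).open_source) (fun x _ => Set.mem_iUnion.2
      ⟨x, mem_chart_source (Eucl m) x⟩)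
  refine ⟨t, Set.eq_univ_of_forall fun p => ?_⟩
  obtain ⟨x, hx⟩ := Set.mem_iUnion.1 (ht (Set.mem_univ p.1))
  obtain ⟨hxt, hx⟩ := Set.mem_iUnion.1 hx
  exact Set.mem_iUnion.2 ⟨⟨x, hxt⟩, hx, trivial⟩

lemma ae_of_forall_ae_chart [CompactSpace M] (g : SmoothMetric m M) {P : M × Eucl n → Prop}
    (hP : ∀ x : M, ∀ᵐ q ∂(volume.restrict (prodTarget (m := m) n x)), P (prodChartInv x q)) :
    ∀ᵐ p ∂productVolume g n, P p := by
  obtain ⟨t, ht⟩ := exists_finset_cover (m := m) (n := n) M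
  filter_upwards [ae_all_iff.2 fun x : t => ae_of_ae_chart g (x : M) (hP x)] with p hp
  obtain ⟨x, hx⟩ := Set.mem_iUnion.1 (ht ▸ Set.mem_univ p)
  exact hp x hx

lemma aemeasurable_of_forall_chart [CompactSpace M] (g : SmoothMetric m M) {β : Type*}
    [MeasurableSpace β] [Nonempty β] {f : M × Eucl n → β}
    (hf : ∀ x : M, AEMeasurable (fun q => f (prodChartInv x q))
      (volume.restrict (prodTarget (m := m) n x))) : AEMeasurable f (productVolume g n) := by
  obtain ⟨t, ht⟩ := exists_finset_cover (m := m) (n := n) M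
  rw [← Measure.restrict_univ (μ := productVolume g n), ← ht, aemeasurable_iUnion_iff]
  intro x
  obtain ⟨Φ, hΦm, hΦ⟩ := exists_measurable_prodChart (m := m) (n := n) (x : M)
  obtain ⟨f', hf', hff'⟩ := hf x
  refine ⟨f' ∘ Φ, hf'.comp hΦm, ?_⟩
  rw [Filter.EventuallyEq, ae_restrict_iff' (measurableSet_prodSource _)]
  refine ae_of_ae_chart g (x : M) (P := fun p => f p = (f' ∘ Φ) p) ?_
  filter_upwards [hff',
    ae_restrict_mem (isOpen_prodTarget (m := m) (x : M)).measurableSet] with q hq hqt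
  rw [hq, Function.comp, hΦ _ (prodChartInv_mem hqt), prodChart_prodChartInv hqt]

/-- In a chart, the `L¹`-norm over a compact set is controlled by the `L^s`-norm over `M × ℝⁿ`. -/
lemma exists_setLIntegral_chart_le (g : SmoothMetric m M) (x : M) {s : ℝ≥0∞} (hs : 1 ≤ s)
    {K : Set (Eucl m × Eucl n)} (hK : IsCompact K) (hKt : K ⊆ prodTarget (m := m) n x) :
    ∃ C : ℝ≥0∞, C ≠ ⊤ ∧ ∀ f : M × Eucl n → ℝ, AEStronglyMeasurable f (productVolume g n) →
      ∫⁻ q in K, ‖f (prodChartInv x q)‖ₑ ≤ C * eLpNorm f s (productVolume g n) := by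
  have hK1 : IsCompact (Prod.fst '' K) := hK.image continuous_fst
  have hK1t : Prod.fst '' K ⊆ (chartAt (Eucl m) x).target := by
    rintro _ ⟨q, hq, rfl⟩; exact (hKt hq).1
  obtain ⟨C, hC, hle⟩ := map_prodInvM_le (n := n) g x hK1 hK1t
  have hsub : K ⊆ (Prod.fst '' K) ×ˢ Set.univ := fun q hq => ⟨⟨q, hq, rfl⟩, trivial⟩
  have hle' : Measure.map (prodInvM n x) (volume.restrict K) ≤ C • productVolume g n :=
    (Measure.map_mono (Measure.restrict_mono hsub le_rfl) (measurable_prodInvM x)).trans hle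
  have hKfin : volume K ≠ ⊤ := hK.measure_lt_top.ne
  refine ⟨C ^ (1 / s.toReal) * volume K ^ (1 / (1 : ℝ≥0∞).toReal - 1 / s.toReal), ?_,
    fun f hf => ?_⟩
  · refine ENNReal.mul_ne_top (ENNReal.rpow_ne_top_of_nonneg (by positivity) hC)
      (ENNReal.rpow_ne_top_of_nonneg ?_ hKfin)
    rcases eq_or_ne s ⊤ with rfl | hs'
    · simp
    · have h1 : 1 ≤ s.toReal := by
        rw [← ENNReal.toReal_one]; exact ENNReal.toReal_mono hs' hs
      simp only [ENNReal.toReal_one, div_one, sub_nonneg]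
      rw [one_div]; exact inv_le_one_of_one_le₀ h1
  have hf1 : AEStronglyMeasurable f (Measure.map (prodInvM n x) (volume.restrict K)) :=
    (hf.smul_measure C).mono_measure hle'
  have e1 : ∫⁻ q in K, ‖f (prodChartInv x q)‖ₑ =
      eLpNorm (f ∘ prodInvM n x) 1 (volume.restrict K) := by
    rw [eLpNorm_one_eq_lintegral_enorm]
    refine setLIntegral_congr_fun hK.measurableSet fun q hq => ?_
    simp only [Function.comp]
    rw [prodInvM_of_mem (hKt hq)]
  rw [e1]
  have h2 := eLpNorm_le_eLpNorm_mul_rpow_measure_univ (μ := volume.restrict K) hs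
    (hf1.comp_measurable (measurable_prodInvM x))
  refine h2.trans ?_
  rw [Measure.restrict_apply_univ, ← eLpNorm_map_measure hf1 (measurable_prodInvM x).aemeasurable]
  have h3 := eLpNorm_mono_measure f (p := s) hle'
  rcases eq_or_ne s ⊤ with rfl | hs'
  · have h4 : eLpNorm f ⊤ (C • productVolume g n) ≤ eLpNorm f ⊤ (productVolume g n) :=
      eLpNormEssSup_mono_measure f (Measure.smul_absolutelyContinuous)
    calc _ ≤ eLpNorm f ⊤ (productVolume g n) * _ := mul_le_mul' (h3.trans h4) le_rfl
      _ = _ := by simp [mul_comm]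
  · rw [eLpNorm_smul_measure_of_ne_top hs', smul_eq_mul] at h3
    calc _ ≤ (C ^ (1 / s.toReal) * eLpNorm f s (productVolume g n)) * _ :=
          mul_le_mul' (by simpa [one_div] using h3) le_rfl
      _ = _ := by ring

lemma MemLp.locallyIntegrableOn_chart (g : SmoothMetric m M) (x : M) {s : ℝ≥0∞} (hs : 1 ≤ s)
    {f : M × Eucl n → ℝ} (hf : MemLp f s (productVolume g n)) :
    LocallyIntegrableOn (fun q => f (prodChartInv x q)) (prodTarget (m := m) n x) := by
  rw [locallyIntegrableOn_iff (isOpen_prodTarget (m := m) x).isLocallyClosed]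
  intro K hKt hK
  obtain ⟨C, hC, h⟩ := exists_setLIntegral_chart_le g x hs hK hKt
  exact ⟨((aemeasurable_chart g x hf.1.aemeasurable).mono_measure
    (Measure.restrict_mono hKt le_rfl)).aestronglyMeasurable,
    (h f hf.1).trans_lt (ENNReal.mul_lt_top hC.lt_top hf.2)⟩

end ProductCharts

/-! ### Vector fields on the product and their weak gradients -/

section Tangent

variable {m n : ℕ} {M : Type*} [TopologicalSpace M] [ChartedSpace (Eucl m) M]
  [IsManifold (𝓡 m) ∞ M]

/-- The tangent space `T_p N`, with the norm and the inner product of the metric `g + g_E`. -/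
def TVec (_g : SmoothMetric m M) (p : M × Eucl n) : Type := ProdTangent (m := m) p

instance (g : SmoothMetric m M) (p : M × Eucl n) : AddCommGroup (TVec g p) :=
  inferInstanceAs (AddCommGroup (Eucl m × Eucl n))

instance (g : SmoothMetric m M) (p : M × Eucl n) : Module ℝ (TVec g p) :=
  inferInstanceAs (Module ℝ (Eucl m × Eucl n))

instance (g : SmoothMetric m M) (p : M × Eucl n) : FiniteDimensional ℝ (TVec g p) :=
  inferInstanceAs (FiniteDimensional ℝ (Eucl m × Eucl n))

/-- The metric `g + g_E` on `T_p N` as an inner product. -/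
abbrev tvecCore (g : SmoothMetric m M) (p : M × Eucl n) : InnerProductSpace.Core ℝ (TVec g p) where
  inner a b := prodInner g p a b
  conj_inner_symm a b := by
    change prodInner g p b a = prodInner g p a b
    simp only [prodInner]
    rw [g.symm, real_inner_comm]
  re_inner_nonneg a := by
    change 0 ≤ prodInner g p a a
    refine add_nonneg ?_ real_inner_self_nonneg
    by_cases h : a.1 = 0
    · rw [h]; simp
    · exact (g.pos _ _ h).le
  add_left a b c := by
    change prodInner g p (a + b) c = prodInner g p a c + prodInner g p b c
    have h : g.inner p.1 (a.1 + b.1) c.1 = g.inner p.1 a.1 c.1 + g.inner p.1 b.1 c.1 := by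
      rw [map_add]; rfl
    have e1 : (a + b).1 = a.1 + b.1 := rfl
    have e2 : (a + b).2 = a.2 + b.2 := rfl
    simp only [prodInner, e1, e2, h, inner_add_left]
    ring
  smul_left a b r := by
    change prodInner g p (r • a) b = r * prodInner g p a b
    have h : g.inner p.1 (r • a.1) b.1 = r * g.inner p.1 a.1 b.1 := by
      rw [map_smul]; rfl
    have e1 : (r • a).1 = r • a.1 := rfl
    have e2 : (r • a).2 = r • a.2 := rfl
    simp only [prodInner, e1, e2, h, real_inner_smul_left]
    ring
  definite a h := by
    change prodInner g p a a = 0 at h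
    have h2 : 0 ≤ inner ℝ a.2 a.2 := real_inner_self_nonneg
    have h1 : a.1 = 0 := by
      by_contra hne
      have := g.pos _ _ hne
      simp only [prodInner] at h
      linarith
    have h3 : a.2 = 0 := by
      simp only [prodInner, h1, map_zero, zero_add] at h
      exact inner_self_eq_zero.1 h
    exact Prod.ext h1 h3

instance (g : SmoothMetric m M) (p : M × Eucl n) : NormedAddCommGroup (TVec g p) :=
  (tvecCore g p).toNormedAddCommGroup

instance (g : SmoothMetric m M) (p : M × Eucl n) : InnerProductSpace ℝ (TVec g p) :=
  InnerProductSpace.ofCore (tvecCore g p).toCore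

instance (g : SmoothMetric m M) (p : M × Eucl n) : CompleteSpace (TVec g p) :=
  FiniteDimensional.complete ℝ _

/-- The value of a vector field at a point, as an element of the inner product space `T_p N`. -/
def vec (g : SmoothMetric m M) (X : ∀ p : M × Eucl n, ProdTangent (m := m) p) (p : M × Eucl n) :
    TVec g p := X p

/-- A family of elements of the inner product spaces `T_p N`, as a vector field on `N`. -/
def toField {g : SmoothMetric m M} (Z : ∀ p : M × Eucl n, TVec g p) (p : M × Eucl n) :
    ProdTangent (m := m) p := Z p

lemma fieldLength_eq_norm (g : SmoothMetric m M)
    (X : ∀ p : M × Eucl n, ProdTangent (m := m) p) (p : M × Eucl n) :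
    fieldLength g X p = ‖vec g X p‖ := rfl

/-- In the chart `φ × id` at `x`, the linear map sending a constant coordinate vector to the
corresponding tangent vector of `N`. -/
def frame (g : SmoothMetric m M) (x : M) (q : Eucl m × Eucl n) :
    Eucl m × Eucl n →ₗ[ℝ] TVec g (prodChartInv x q) :=
  (coordLinear x q.1).prodMap LinearMap.id

lemma chartCoeff_eq_inner (g : SmoothMetric m M)
    (X : ∀ p : M × Eucl n, ProdTangent (m := m) p) (x : M) (w q : Eucl m × Eucl n) :
    chartCoeff g X x w q = inner ℝ (vec g X (prodChartInv x q)) (frame g x q w) := rfl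

lemma surjective_frame (g : SmoothMetric m M) (x : M) {q : Eucl m × Eucl n}
    (hq : q ∈ prodTarget (m := m) n x) : Function.Surjective (frame g x q) := by
  rintro ⟨a, b⟩
  obtain ⟨y, hy⟩ := (bijective_coordVector x hq.1).2 a
  exact ⟨(y, b), Prod.ext hy rfl⟩

lemma continuous_frame (g : SmoothMetric m M) (x : M) (q : Eucl m × Eucl n) :
    Continuous (frame g x q) := LinearMap.continuous_of_finiteDimensional _

lemma continuousOn_norm_frame (g : SmoothMetric m M) (x : M) (w : Eucl m × Eucl n) :
    ContinuousOn (fun q => ‖frame g x q w‖) (prodTarget (m := m) n x) := by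
  have : ContinuousOn (fun q : Eucl m × Eucl n => Real.sqrt
      (g.inner ((chartAt (Eucl m) x).symm q.1) (coordVector x q.1 w.1) (coordVector x q.1 w.1)
        + inner ℝ w.2 w.2)) (prodTarget (m := m) n x) := by
    refine Real.continuous_sqrt.comp_continuousOn (ContinuousOn.add ?_ continuousOn_const)
    exact (continuousOn_inner_coordVector g x w.1 w.1).comp continuousOn_fst fun q hq => hq.1
  exact this

lemma abs_chartCoeff_le (g : SmoothMetric m M)
    (X : ∀ p : M × Eucl n, ProdTangent (m := m) p) (x : M) (w q : Eucl m × Eucl n) :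
    |chartCoeff g X x w q| ≤ fieldLength g X (prodChartInv x q) * ‖frame g x q w‖ := by
  rw [chartCoeff_eq_inner, fieldLength_eq_norm]
  exact abs_real_inner_le_norm _ _

lemma chartCoeff_linComb (g : SmoothMetric m M)
    (X Y : ∀ p : M × Eucl n, ProdTangent (m := m) p) (a b : ℝ) (x : M) (w q : Eucl m × Eucl n) :
    chartCoeff g (fun p => a • X p + b • Y p) x w q =
      a * chartCoeff g X x w q + b * chartCoeff g Y x w q := by
  simp only [chartCoeff_eq_inner]
  rw [← real_inner_smul_left, ← real_inner_smul_left, ← inner_add_left]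
  rfl

lemma chartCoeff_add_right (g : SmoothMetric m M)
    (X : ∀ p : M × Eucl n, ProdTangent (m := m) p) (x : M) (w w' q : Eucl m × Eucl n) :
    chartCoeff g X x (w + w') q = chartCoeff g X x w q + chartCoeff g X x w' q := by
  simp only [chartCoeff_eq_inner, map_add, inner_add_right]

lemma chartCoeff_smul_right (g : SmoothMetric m M)
    (X : ∀ p : M × Eucl n, ProdTangent (m := m) p) (x : M) (r : ℝ) (w q : Eucl m × Eucl n) :
    chartCoeff g X x (r • w) q = r * chartCoeff g X x w q := by
  simp only [chartCoeff_eq_inner, map_smul, real_inner_smul_right]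

/-- A tangent vector orthogonal to a dense set of coordinate vectors vanishes. -/
lemma vec_eq_zero_of_chartCoeff (g : SmoothMetric m M)
    (X : ∀ p : M × Eucl n, ProdTangent (m := m) p) (x : M) {q : Eucl m × Eucl n}
    (hq : q ∈ prodTarget (m := m) n x)
    (h : ∀ k, chartCoeff g X x (TopologicalSpace.denseSeq _ k) q = 0) :
    vec g X (prodChartInv x q) = 0 := by
  have h' : (fun w => inner ℝ (vec g X (prodChartInv x q)) (frame g x q w)) = fun _ => (0 : ℝ) :=
    Continuous.ext_on (TopologicalSpace.denseRange_denseSeq (Eucl m × Eucl n))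
      (continuous_const.inner (continuous_frame g x q)) continuous_const
      (by rintro _ ⟨k, rfl⟩; exact h k)
  obtain ⟨w, hw⟩ := surjective_frame g x hq (vec g X (prodChartInv x q))
  have := congrFun h' w
  rw [hw] at this
  exact inner_self_eq_zero.1 this

/-- The length of a tangent vector `X` as a supremum over countably many coordinate vectors `w`:
`|X|² = sup_w (2⟨X, w⟩ - |w|²)`. -/
lemma iSup_chartCoeff (g : SmoothMetric m M)
    (X : ∀ p : M × Eucl n, ProdTangent (m := m) p) (x : M) {q : Eucl m × Eucl n}
    (hq : q ∈ prodTarget (m := m) n x) :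
    ⨆ k, ENNReal.ofReal (2 * chartCoeff g X x (TopologicalSpace.denseSeq _ k) q -
      ‖frame g x q (TopologicalSpace.denseSeq _ k)‖ ^ 2) =
      ENNReal.ofReal (fieldLength g X (prodChartInv x q) ^ 2) := by
  set D := vec g X (prodChartInv x q) with hD
  have key : ∀ w, 2 * inner ℝ D (frame g x q w) - ‖frame g x q w‖ ^ 2 =
      ‖D‖ ^ 2 - ‖D - frame g x q w‖ ^ 2 := by
    intro w
    rw [norm_sub_sq_real]; ring
  simp only [chartCoeff_eq_inner, ← hD, key, fieldLength_eq_norm]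
  have hc : Continuous fun w => ENNReal.ofReal (‖D‖ ^ 2 - ‖D - frame g x q w‖ ^ 2) :=
    ENNReal.continuous_ofReal.comp
      (continuous_const.sub ((continuous_const.sub (continuous_frame g x q)).norm.pow 2))
  refine le_antisymm (iSup_le fun k => ENNReal.ofReal_le_ofReal (by
    have := sq_nonneg ‖D - frame g x q (TopologicalSpace.denseSeq _ k)‖; linarith)) ?_
  obtain ⟨w, hw⟩ := surjective_frame g x hq D
  have hcl : IsClosed {w | ENNReal.ofReal (‖D‖ ^ 2 - ‖D - frame g x q w‖ ^ 2) ≤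
      ⨆ k, ENNReal.ofReal (‖D‖ ^ 2 - ‖D - frame g x q (TopologicalSpace.denseSeq _ k)‖ ^ 2)} :=
    isClosed_le hc continuous_const
  have hall := (TopologicalSpace.denseRange_denseSeq (Eucl m × Eucl n)).induction_on
    (p := fun w => ENNReal.ofReal (‖D‖ ^ 2 - ‖D - frame g x q w‖ ^ 2) ≤
      ⨆ k, ENNReal.ofReal (‖D‖ ^ 2 - ‖D - frame g x q (TopologicalSpace.denseSeq _ k)‖ ^ 2)) w hcl
    fun k => le_iSup (fun k =>
      ENNReal.ofReal (‖D‖ ^ 2 - ‖D - frame g x q (TopologicalSpace.denseSeq _ k)‖ ^ 2)) k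
  simpa [hw] using hall

end Tangent

/-- The product of a locally integrable function with a continuous function, compactly supported in
the same open set, is integrable. -/
lemma integrable_mul_compactSupport {E : Type*} [NormedAddCommGroup E]
    [MeasurableSpace E] [BorelSpace E] {μ : Measure E} {f ψ : E → ℝ} {Ω : Set E}
    (hf : LocallyIntegrableOn f Ω μ) (hψ : Continuous ψ) (hc : HasCompactSupport ψ)
    (hs : tsupport ψ ⊆ Ω) : Integrable (fun q => f q * ψ q) μ := by
  have h1 : IntegrableOn f (tsupport ψ) μ := hf.integrableOn_compact_subset hs hc
  have h2 : IntegrableOn (fun q => f q * ψ q) (tsupport ψ) μ :=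
    h1.mul_continuousOn hψ.continuousOn hc
  refine (integrableOn_iff_integrable_of_support_subset ?_).1 h2
  exact (Function.support_mul_subset_right _ _).trans (subset_tsupport ψ)

section WeakGradient

variable {m n : ℕ} {M : Type*} [TopologicalSpace M] [ChartedSpace (Eucl m) M]
  [IsManifold (𝓡 m) ∞ M]

lemma IsWeakGradient.linComb {g : SmoothMetric m M} {u v : M × Eucl n → ℝ}
    {X Y : ∀ p : M × Eucl n, ProdTangent (m := m) p} (hu : IsWeakGradient g u X)
    (hv : IsWeakGradient g v Y) (a b : ℝ) :
    IsWeakGradient g (fun p => a * u p + b * v p) (fun p => a • X p + b • Y p) where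
  locallyIntegrable x := ((hu.locallyIntegrable x).smul a).add ((hv.locallyIntegrable x).smul b)
  locallyIntegrable_coeff x w := by
    simp only [funext (chartCoeff_linComb g X Y a b x w)]
    exact ((hu.locallyIntegrable_coeff x w).smul a).add ((hv.locallyIntegrable_coeff x w).smul b)
  integral_eq x w ψ hψ hc hs := by
    have hcf : Continuous fun q => fderiv ℝ ψ q w :=
      (hψ.continuous_fderiv (by simp)).clm_apply continuous_const
    have hs' : tsupport (fun q => fderiv ℝ ψ q w) ⊆ (chartAt (Eucl m) x).target ×ˢ Set.univ :=
      (tsupport_fderiv_apply_subset ℝ w).trans hs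
    have i1 := integrable_mul_compactSupport (hu.locallyIntegrable x) hcf
      (hc.fderiv_apply (𝕜 := ℝ) w) hs'
    have i2 := integrable_mul_compactSupport (hv.locallyIntegrable x) hcf
      (hc.fderiv_apply (𝕜 := ℝ) w) hs'
    have i3 := integrable_mul_compactSupport (hu.locallyIntegrable_coeff x w) hψ.continuous hc hs
    have i4 := integrable_mul_compactSupport (hv.locallyIntegrable_coeff x w) hψ.continuous hc hs
    simp only [chartCoeff_linComb, add_mul, mul_assoc]
    rw [integral_add (i1.const_mul a) (i2.const_mul b),
      integral_add (i3.const_mul a) (i4.const_mul b), integral_const_mul, integral_const_mul,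
      integral_const_mul, integral_const_mul, hu.integral_eq x w ψ hψ hc hs,
      hv.integral_eq x w ψ hψ hc hs]
    ring

variable [MeasurableSpace M] [BorelSpace M]

lemma IsWeakGradient.congr_ae {g : SmoothMetric m M} {u v : M × Eucl n → ℝ}
    {X : ∀ p : M × Eucl n, ProdTangent (m := m) p} (hu : IsWeakGradient g u X)
    (huv : u =ᵐ[productVolume g n] v) : IsWeakGradient g v X where
  locallyIntegrable x := by
    have h := ae_chart_of_ae g x huv
    intro q hq
    obtain ⟨U, hU, hi⟩ := hu.locallyIntegrable x q hq
    refine ⟨U ∩ prodTarget (m := m) n x, Filter.inter_mem hU self_mem_nhdsWithin, ?_⟩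
    refine (hi.mono_set Set.inter_subset_left).congr ?_
    exact ae_mono (Measure.restrict_mono Set.inter_subset_right le_rfl) h
  locallyIntegrable_coeff := hu.locallyIntegrable_coeff
  integral_eq x w ψ hψ hc hs := by
    rw [← hu.integral_eq x w ψ hψ hc hs]
    refine integral_congr_ae ?_
    have h := ae_chart_of_ae g x huv
    rw [ae_restrict_iff' (isOpen_prodTarget (m := m) x).measurableSet] at h
    filter_upwards [h] with q hq
    by_cases hqt : q ∈ prodTarget (m := m) n x
    · rw [hq hqt]
    · have : fderiv ℝ ψ q w = 0 :=
        image_eq_zero_of_notMem_tsupport (f := fun q => fderiv ℝ ψ q w)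
          fun h => hqt (hs (tsupport_fderiv_apply_subset ℝ w h))
      simp [this]

variable [CompactSpace M]

/-- Measurability of the length of a weak gradient comes from that of its coefficients, which are
locally integrable in every chart. -/
lemma IsWeakGradient.aemeasurable_fieldLength {g : SmoothMetric m M} {u : M × Eucl n → ℝ}
    {X : ∀ p : M × Eucl n, ProdTangent (m := m) p} (hu : IsWeakGradient g u X) :
    AEMeasurable (fieldLength g X) (productVolume g n) := by
  refine aemeasurable_of_forall_chart g fun x => ?_
  have hm := (isOpen_prodTarget (m := m) (n := n) x).measurableSet
  have h : AEMeasurable (fun q => ⨆ k, ENNReal.ofReal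
      (2 * chartCoeff g X x (TopologicalSpace.denseSeq _ k) q -
        ‖frame g x q (TopologicalSpace.denseSeq _ k)‖ ^ 2))
      (volume.restrict (prodTarget (m := m) n x)) := by
    refine AEMeasurable.iSup fun k => AEMeasurable.ennreal_ofReal (AEMeasurable.sub ?_ ?_)
    · exact (hu.locallyIntegrable_coeff x _).aestronglyMeasurable.aemeasurable.const_mul 2
    · exact ((continuousOn_norm_frame g x _).pow 2).aemeasurable hm
  refine (h.ennreal_toReal.sqrt).congr ?_
  filter_upwards [ae_restrict_mem hm] with q hq
  rw [iSup_chartCoeff g X x hq, ENNReal.toReal_ofReal (sq_nonneg _),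
    Real.sqrt_sq (show 0 ≤ fieldLength g X _ from Real.sqrt_nonneg _)]

/-- The weak gradient is unique up to null sets; the statement is about its length. -/
lemma IsWeakGradient.fieldLength_ae_eq {g : SmoothMetric m M} {u : M × Eucl n → ℝ}
    {X Y : ∀ p : M × Eucl n, ProdTangent (m := m) p} (hX : IsWeakGradient g u X)
    (hY : IsWeakGradient g u Y) : fieldLength g X =ᵐ[productVolume g n] fieldLength g Y := by
  have hD := hX.linComb hY 1 (-1)
  suffices h : ∀ᵐ p ∂productVolume g n, vec g (fun p => (1 : ℝ) • X p + (-1 : ℝ) • Y p) p = 0 by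
    filter_upwards [h] with p hp
    have : (1 : ℝ) • vec g X p + (-1 : ℝ) • vec g Y p = 0 := hp
    rw [one_smul, neg_one_smul, ← sub_eq_add_neg, sub_eq_zero] at this
    rw [fieldLength_eq_norm, fieldLength_eq_norm, this]
  refine ae_of_forall_ae_chart g fun x => ?_
  have hopen := isOpen_prodTarget (m := m) (n := n) x
  have hk : ∀ k, ∀ᵐ q : Eucl m × Eucl n, q ∈ prodTarget (m := m) n x →
      chartCoeff g (fun p => (1 : ℝ) • X p + (-1 : ℝ) • Y p) x
        (TopologicalSpace.denseSeq _ k) q = 0 := fun k => by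
    refine hopen.ae_eq_zero_of_integral_contDiff_smul_eq_zero (hD.locallyIntegrable_coeff x _)
      fun ψ hψ hc hs => ?_
    have := hD.integral_eq x (TopologicalSpace.denseSeq _ k) ψ hψ hc hs
    simp only [one_mul, neg_one_mul, add_neg_cancel, zero_mul, integral_zero] at this
    simp only [smul_eq_mul, mul_comm (ψ _)]
    linarith
  rw [ae_restrict_iff' hopen.measurableSet]
  filter_upwards [ae_all_iff.2 hk] with q hq hqt
  exact vec_eq_zero_of_chartCoeff g _ x hqt fun k => hq k hqt

end WeakGradient

/-! ### Polarization of weak derivatives on open sets -/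

section LocalPolarization

variable {E : Type*} [NormedAddCommGroup E] [NormedSpace ℝ E] [FiniteDimensional ℝ E]

/-- A smooth cutoff function for a compact subset of an open set. -/
lemma exists_cutoff {K Ω : Set E} (hK : IsCompact K) (hΩ : IsOpen Ω) (hKΩ : K ⊆ Ω) :
    ∃ χ : E → ℝ, ContDiff ℝ ∞ χ ∧ HasCompactSupport χ ∧ tsupport χ ⊆ Ω ∧
      ∀ q ∈ K, ∀ᶠ q' in nhds q, χ q' = 1 := by
  obtain ⟨L, hL, hKL, hLΩ⟩ := exists_compact_between hK hΩ hKΩ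
  obtain ⟨χ, h1, h0, -⟩ := exists_contMDiffMap_one_nhds_of_subset_interior (n := ⊤)
    𝓘(ℝ, E) hK.isClosed hKL
  have hsub : tsupport χ ⊆ L := closure_minimal
    (fun q hq => by_contra fun h => hq (h0 q h)) hL.isClosed
  exact ⟨χ, contMDiff_iff_contDiff.1 χ.contMDiff,
    hL.of_isClosed_subset (isClosed_tsupport _) hsub, hsub.trans hLΩ,
    fun q hq => Filter.eventually_iff_exists_mem.2
      ⟨_, (Filter.eventually_iff_exists_mem.1 (h1.filter_mono (nhds_le_nhdsSet hq))).choose_spec⟩⟩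

variable [MeasurableSpace E] [BorelSpace E] {μ : Measure E} {σ : E → E} {h : E → ℝ} {Ω : Set E}

omit [FiniteDimensional ℝ E] in
/-- Multiplying by a cutoff function turns a function with a weak derivative on an open set into an
integrable function with an integrable weak derivative on the whole space. -/
lemma hasWeakDeriv_mul_cutoff [IsFiniteMeasureOnCompacts μ] {f c χ : E → ℝ} {w : E}
    (hf : LocallyIntegrableOn f Ω μ) (hc : LocallyIntegrableOn c Ω μ)
    (H : ∀ ψ : E → ℝ, ContDiff ℝ ∞ ψ → HasCompactSupport ψ → tsupport ψ ⊆ Ω →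
      ∫ q, f q * fderiv ℝ ψ q w ∂μ = - ∫ q, c q * ψ q ∂μ)
    (hχ : ContDiff ℝ ∞ χ) (hχc : HasCompactSupport χ) (hχs : tsupport χ ⊆ Ω) :
    Integrable (fun q => f q * χ q) μ ∧
    Integrable (fun q => c q * χ q + f q * fderiv ℝ χ q w) μ ∧
    HasWeakDeriv μ (fun q => f q * χ q) w (fun q => c q * χ q + f q * fderiv ℝ χ q w) := by
  have hdc : Continuous fun q => fderiv ℝ χ q w :=
    (hχ.continuous_fderiv (by simp)).clm_apply continuous_const
  have hds : tsupport (fun q => fderiv ℝ χ q w) ⊆ Ω := (tsupport_fderiv_apply_subset ℝ w).trans hχs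
  refine ⟨integrable_mul_compactSupport hf hχ.continuous hχc hχs,
    (integrable_mul_compactSupport hc hχ.continuous hχc hχs).add
      (integrable_mul_compactSupport hf hdc (hχc.fderiv_apply (𝕜 := ℝ) w) hds), ?_⟩
  intro ψ hψ hψc
  have hψd : Continuous fun q => fderiv ℝ ψ q w :=
    (hψ.continuous_fderiv (by simp)).clm_apply continuous_const
  have hs : tsupport (fun q => χ q * ψ q) ⊆ Ω := (tsupport_mul_subset_left).trans hχs
  have key := H (fun q => χ q * ψ q) (hχ.mul hψ) hχc.mul_right hs
  have e : ∀ q, fderiv ℝ (fun q => χ q * ψ q) q w = χ q * fderiv ℝ ψ q w +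
      fderiv ℝ χ q w * ψ q := fun q => by
    rw [fderiv_fun_mul (hχ.differentiable (by simp) q) (hψ.differentiable (by simp) q)]
    simp only [FunLike.coe_add, Pi.add_apply, FunLike.coe_smul, Pi.smul_apply, smul_eq_mul]
    ring
  have i1 : Integrable (fun q => f q * (χ q * fderiv ℝ ψ q w)) μ :=
    integrable_mul_compactSupport hf (hχ.continuous.mul hψd) hχc.mul_right
      ((tsupport_mul_subset_left).trans hχs)
  have i2 : Integrable (fun q => f q * (fderiv ℝ χ q w * ψ q)) μ :=
    integrable_mul_compactSupport hf (hdc.mul hψ.continuous)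
      (hχc.fderiv_apply (𝕜 := ℝ) w).mul_right ((tsupport_mul_subset_left).trans hds)
  have i3 : Integrable (fun q => c q * (χ q * ψ q)) μ :=
    integrable_mul_compactSupport hc (hχ.continuous.mul hψ.continuous) hχc.mul_right hs
  simp only [e, mul_add] at key
  rw [integral_add i1 i2] at key
  simp only [mul_assoc, add_mul]
  rw [integral_add i3 i2]
  linarith

/-- The derivative of a polarization, for functions which are only defined on an open set invariant
under the reflection. -/
lemma integral_polarize_mul_fderiv [μ.IsAddHaarMeasure] (hσ : IsReflection σ h)
    (hm : MeasurePreserving σ μ μ) (hσc : Continuous σ) (hh : Measurable h) (hΩ : IsOpen Ω)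
    (hσΩ : ∀ p ∈ Ω, σ p ∈ Ω) {w : E} (hw : w ≠ 0) {κ β : ℝ} (hκ : κ ≠ 0)
    (hline : ∀ p, ∀ ρ : ℝ, σ (p + ρ • w) = σ p + (κ * ρ) • w)
    (hhline : ∀ p, ∀ ρ : ℝ, h (p + ρ • w) = h p + ρ * β) {f c : E → ℝ}
    (hf : LocallyIntegrableOn f Ω μ) (hc : LocallyIntegrableOn c Ω μ)
    (H : ∀ ψ : E → ℝ, ContDiff ℝ ∞ ψ → HasCompactSupport ψ → tsupport ψ ⊆ Ω →
      ∫ q, f q * fderiv ℝ ψ q w ∂μ = - ∫ q, c q * ψ q ∂μ)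
    {ψ : E → ℝ} (hψ : ContDiff ℝ ∞ ψ) (hψc : HasCompactSupport ψ) (hψs : tsupport ψ ⊆ Ω) :
    ∫ q, polarize σ h f q * fderiv ℝ ψ q w ∂μ =
      - ∫ q, polarizeDeriv σ h f κ c q * ψ q ∂μ := by
  have hK : IsCompact (tsupport ψ ∪ σ '' tsupport ψ) := hψc.isCompact.union
    (hψc.isCompact.image hσc)
  obtain ⟨χ, hχ, hχc, hχs, hχ1⟩ := exists_cutoff hK hΩ (Set.union_subset hψs (by
    rintro _ ⟨q, hq, rfl⟩; exact hσΩ q (hψs hq)))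
  obtain ⟨hi1, hi2, hwd⟩ := hasWeakDeriv_mul_cutoff hf hc H hχ hχc hχs
  have key := hwd.polarize hσ hm hh hw hκ hline hhline hi1 hi2 ψ hψ hψc
  have e1 : ∀ q ∈ tsupport ψ ∪ σ '' tsupport ψ, f q * χ q = f q := fun q hq => by
    rw [(hχ1 q hq).self_of_nhds, mul_one]
  have e2 : ∀ q ∈ tsupport ψ ∪ σ '' tsupport ψ, c q * χ q + f q * fderiv ℝ χ q w = c q :=
    fun q hq => by
      have : χ =ᶠ[nhds q] fun _ => (1 : ℝ) := hχ1 q hq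
      rw [(hχ1 q hq).self_of_nhds, this.fderiv_eq]
      simp
  have hmem : ∀ q ∈ tsupport ψ, q ∈ tsupport ψ ∪ σ '' tsupport ψ ∧
      σ q ∈ tsupport ψ ∪ σ '' tsupport ψ := fun q hq => ⟨Or.inl hq, Or.inr ⟨q, hq, rfl⟩⟩
  have h1 : (fun q => polarize σ h (fun q => f q * χ q) q * fderiv ℝ ψ q w) =
      fun q => polarize σ h f q * fderiv ℝ ψ q w := by
    funext q
    by_cases hq : q ∈ tsupport ψ
    · rw [polarize_congr (e1 q (hmem q hq).1) (e1 _ (hmem q hq).2)]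
    · have : fderiv ℝ ψ q w = 0 := image_eq_zero_of_notMem_tsupport
        (f := fun q => fderiv ℝ ψ q w) fun h => hq (tsupport_fderiv_apply_subset ℝ w h)
      rw [this, mul_zero, mul_zero]
  have h2 : (fun q => polarizeDeriv σ h (fun q => f q * χ q) κ
      (fun q => c q * χ q + f q * fderiv ℝ χ q w) q * ψ q) =
      fun q => polarizeDeriv σ h f κ c q * ψ q := by
    funext q
    by_cases hq : q ∈ tsupport ψ
    · rw [polarizeDeriv_congr κ (e1 q (hmem q hq).1) (e1 _ (hmem q hq).2) (e2 q (hmem q hq).1)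
        (e2 _ (hmem q hq).2)]
    · rw [image_eq_zero_of_notMem_tsupport hq, mul_zero, mul_zero]
  rwa [h1, h2] at key

open Classical in
omit [BorelSpace E] in
/-- Selecting, on a measurable set, the reflection of a locally integrable function. -/
lemma locallyIntegrableOn_ite (hσ : IsReflection σ h) (hm : MeasurePreserving σ μ μ)
    (hσc : Continuous σ) (hΩ : IsOpen Ω) (hσΩ : ∀ p ∈ Ω, σ p ∈ Ω) {S : Set E}
    (hS : MeasurableSet S) {a b : E → ℝ} (ha : LocallyIntegrableOn a Ω μ)
    (hb : LocallyIntegrableOn b Ω μ) :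
    LocallyIntegrableOn (fun q => if q ∈ S then a (σ q) else b q) Ω μ := by
  rw [locallyIntegrableOn_iff hΩ.isLocallyClosed]
  intro K hKΩ hK
  have hK' : σ '' K ⊆ Ω := by rintro _ ⟨q, hq, rfl⟩; exact hσΩ q (hKΩ hq)
  have h1 : IntegrableOn (fun q => a (σ q)) K μ := by
    have := (hm.integrableOn_comp_preimage
      (hσ.measurableEquiv hm.measurable).measurableEmbedding).2
      (ha.integrableOn_compact_subset hK' (hK.image hσc))
    exact this.mono_set fun q hq => ⟨q, hq, rfl⟩
  have h2 : IntegrableOn b K μ := hb.integrableOn_compact_subset hKΩ hK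
  exact Integrable.piecewise hS h1.integrableOn h2.integrableOn

end LocalPolarization

/-! ### Polarization of Sobolev functions on the product -/

section ProductPolarization

/-- The reflection `(x, z) ↦ (x, σ z)` in the boundary of a half-space of `ℝⁿ`. -/
def prodReflect {α : Type*} {n : ℕ} (H : HalfSpace n) (p : α × Eucl n) : α × Eucl n :=
  (p.1, reflect (H.1 : Eucl n) H.2 p.2)

/-- The signed distance of `z` to the boundary of a half-space of `ℝⁿ`, as a function of
`(x, z)`. -/
def prodHeight {α : Type*} {n : ℕ} (H : HalfSpace n) (p : α × Eucl n) : ℝ :=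
  height (H.1 : Eucl n) H.2 p.2

/-- Polarization of a function on a product in the second variable. -/
def prodPol {α : Type*} {n : ℕ} (H : HalfSpace n) (u : α × Eucl n → ℝ) : α × Eucl n → ℝ :=
  polarize (prodReflect H) (prodHeight H) u

lemma prodPol_apply {α : Type*} {n : ℕ} (H : HalfSpace n) (u : α × Eucl n → ℝ)
    (p : α × Eucl n) : prodPol H u p = pol H (fun z => u (p.1, z)) p.2 := rfl

lemma isReflection_prodReflect {α : Type*} {n : ℕ} (H : HalfSpace n) :
    IsReflection (prodReflect (α := α) H) (prodHeight H) where
  invol p := Prod.ext rfl (H.isReflection.invol p.2)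
  anti p := H.isReflection.anti p.2
  fix p hp := Prod.ext rfl (H.isReflection.fix p.2 hp)

lemma measurable_prodHeight {α : Type*} [MeasurableSpace α] {n : ℕ} (H : HalfSpace n) :
    Measurable (prodHeight (α := α) H) := H.measurable_height.comp measurable_snd

lemma measurable_prodReflect {α : Type*} [MeasurableSpace α] {n : ℕ} (H : HalfSpace n) :
    Measurable (prodReflect (α := α) H) :=
  measurable_fst.prodMk (H.measurePreserving.measurable.comp measurable_snd)

lemma measurePreserving_prodReflect {α : Type*} [MeasurableSpace α] {n : ℕ} (H : HalfSpace n)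
    (ν : Measure α) :
    MeasurePreserving (prodReflect (α := α) H) (ν.prod volume) (ν.prod volume) := by
  refine ⟨measurable_prodReflect H, Measure.ext fun B hB => ?_⟩
  rw [Measure.map_apply (measurable_prodReflect H) hB, Measure.prod_apply hB,
    Measure.prod_apply (measurable_prodReflect H hB)]
  refine lintegral_congr fun x => ?_
  exact H.measurePreserving.measure_preimage (measurable_prodMk_left hB).nullMeasurableSet

variable {m n : ℕ} {M : Type*} [TopologicalSpace M] [ChartedSpace (Eucl m) M]

open Classical in
/-- The gradient of the polarization of `u` when `X` is the gradient of `u`: where polarization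
selects the reflected value of `u`, it is the reflection of `X`. -/
def polField (H : HalfSpace n) (u : M × Eucl n → ℝ)
    (X : ∀ p : M × Eucl n, ProdTangent (m := m) p) (p : M × Eucl n) : ProdTangent (m := m) p :=
  if p ∈ swapSet (prodReflect H) (prodHeight H) u then
    ((X (prodReflect H p)).1, linReflect (H.1 : Eucl n) (X (prodReflect H p)).2) else X p

variable [IsManifold (𝓡 m) ∞ M]

open Classical in
lemma fieldLength_polField (g : SmoothMetric m M) (H : HalfSpace n) (u : M × Eucl n → ℝ)
    (X : ∀ p : M × Eucl n, ProdTangent (m := m) p) (p : M × Eucl n) :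
    fieldLength g (polField H u X) p =
      if p ∈ swapSet (prodReflect H) (prodHeight H) u then fieldLength g X (prodReflect H p)
      else fieldLength g X p := by
  by_cases hp : p ∈ swapSet (prodReflect H) (prodHeight H) u
  · rw [if_pos hp, fieldLength, polField, if_pos hp, fieldLength]
    congr 1
    simp only [prodInner, LinearIsometryEquiv.inner_map_map]
    rfl
  · rw [if_neg hp, fieldLength, polField, if_neg hp, fieldLength]

open Classical in
lemma chartCoeff_polField (g : SmoothMetric m M) (H : HalfSpace n) (u : M × Eucl n → ℝ)
    (X : ∀ p : M × Eucl n, ProdTangent (m := m) p) (x : M) (w q : Eucl m × Eucl n) :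
    chartCoeff g (polField H u X) x w q =
      if q ∈ swapSet (prodReflect H) (prodHeight H) (fun q => u (prodChartInv x q)) then
        chartCoeff g X x (w.1, linReflect (H.1 : Eucl n) w.2) (prodReflect H q)
      else chartCoeff g X x w q := by
  have e : q ∈ swapSet (prodReflect H) (prodHeight H) (fun q => u (prodChartInv x q)) ↔
      prodChartInv x q ∈ swapSet (prodReflect H) (prodHeight H) u := Iff.rfl
  by_cases hp : prodChartInv x q ∈ swapSet (prodReflect H) (prodHeight H) u
  · rw [if_pos (e.2 hp), chartCoeff, polField, if_pos hp, chartCoeff]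
    simp only [prodInner]
    congr 1
    have : linReflect (H.1 : Eucl n) (linReflect (H.1 : Eucl n) w.2) = w.2 :=
      Submodule.reflection_reflection _ _
    conv_lhs => rw [← this, LinearIsometryEquiv.inner_map_map]
    rfl
  · rw [if_neg (mt e.1 hp), chartCoeff, polField, if_neg hp, chartCoeff]

variable [MeasurableSpace M]

/-- The lengths of the gradient at mirror points are exchanged or kept, which does not change the
integral of their powers. -/
lemma fieldNorm_polField (g : SmoothMetric m M) (H : HalfSpace n) {s : ℝ≥0∞} (hs : s ≠ 0)
    (hs' : s ≠ ⊤) {u : M × Eucl n → ℝ} (hu : Measurable u)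
    (X : ∀ p : M × Eucl n, ProdTangent (m := m) p) :
    fieldNorm g s (polField H u X) = fieldNorm g s X := by
  classical
  rw [fieldNorm, fieldNorm, eLpNorm_eq_lintegral_rpow_enorm_toReal hs hs',
    eLpNorm_eq_lintegral_rpow_enorm_toReal hs hs']
  congr 1
  rw [productVolume, ← (isReflection_prodReflect (α := M) H).lintegral_ite
    (measurePreserving_prodReflect H (riemannianVolume g))
    (measurableSet_swapSet (measurable_prodReflect H) (measurable_prodHeight H) hu)
    (fun p => (isReflection_prodReflect H).mem_swapSet)
    (fun p => ‖fieldLength g X p‖ₑ ^ s.toReal)]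
  refine lintegral_congr fun p => ?_
  rw [fieldLength_polField]
  split_ifs <;> rfl

variable [BorelSpace M]

/-- Polarization maps weak gradients to weak gradients. The coordinate directions tangent to the
mirror, and the one orthogonal to it, are mapped to multiples of themselves by the reflection; the
other directions are sums of these. -/
lemma IsWeakGradient.polField {g : SmoothMetric m M} {u : M × Eucl n → ℝ}
    {X : ∀ p : M × Eucl n, ProdTangent (m := m) p} (hX : IsWeakGradient g u X)
    (hu : Measurable u) (H : HalfSpace n) :
    IsWeakGradient g (prodPol H u) (SteinerProduct.polField H u X) := by
  classical
  have he : ‖(H.1 : Eucl n)‖ = 1 := H.norm_eq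
  set e := (H.1 : Eucl n) with he_def
  have hcont : Continuous (prodReflect (α := Eucl m) H) :=
    continuous_fst.prodMk ((continuous_reflect _ _).comp continuous_snd)
  have hσ := isReflection_prodReflect (α := Eucl m) H
  have hm := measurePreserving_prodReflect H (volume : Measure (Eucl m))
  have hΩ : ∀ x : M, ∀ q ∈ prodTarget (m := m) n x, prodReflect H q ∈ prodTarget (m := m) n x :=
    fun x q hq => ⟨hq.1, trivial⟩
  -- On the domain of a chart the set of exchanged points agrees with a measurable set.
  have hS : ∀ x : M, MeasurableSet (swapSet (prodReflect H) (prodHeight H)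
      (fun q => u (prodInvM (m := m) n x q))) := fun x =>
    measurableSet_swapSet (measurable_prodReflect H) (measurable_prodHeight H)
      (hu.comp (measurable_prodInvM x))
  have hmem : ∀ x : M, ∀ q ∈ prodTarget (m := m) n x,
      (q ∈ swapSet (prodReflect H) (prodHeight H) (fun q => u (prodInvM (m := m) n x q)) ↔
      q ∈ swapSet (prodReflect H) (prodHeight H) (fun q => u (prodChartInv x q))) :=
    fun x q hq => mem_swapSet_congr (by rw [prodInvM_of_mem hq])
      (by rw [prodInvM_of_mem (hΩ x q hq)])
  have hli : ∀ (x : M) (a b : Eucl m × Eucl n → ℝ),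
      LocallyIntegrableOn a (prodTarget (m := m) n x) →
      LocallyIntegrableOn b (prodTarget (m := m) n x) →
      LocallyIntegrableOn (fun q =>
        if q ∈ swapSet (prodReflect H) (prodHeight H) (fun q => u (prodChartInv x q)) then
          a (prodReflect H q) else b q) (prodTarget (m := m) n x) := fun x a b ha hb => by
    have h1 := locallyIntegrableOn_ite hσ hm hcont (isOpen_prodTarget (m := m) x) (hΩ x) (hS x)
      ha hb
    have hlc := (isOpen_prodTarget (m := m) (n := n) x).isLocallyClosed
    rw [locallyIntegrableOn_iff hlc] at h1 ⊢
    exact fun K hKs hK => (h1 K hKs hK).congr_fun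
      (fun q hq => by simp only [hmem x q (hKs hq)]) hK.measurableSet
  have hcoef : ∀ (x : M) (w : Eucl m × Eucl n),
      LocallyIntegrableOn (chartCoeff g (SteinerProduct.polField H u X) x w)
        (prodTarget (m := m) n x) := fun x w => by
    rw [funext (chartCoeff_polField g H u X x w)]
    exact hli x _ _ (hX.locallyIntegrable_coeff x _) (hX.locallyIntegrable_coeff x w)
  have hpol : ∀ x : M, LocallyIntegrableOn (fun q => prodPol H u (prodChartInv x q))
      (prodTarget (m := m) n x) := fun x =>
    hli x _ _ (hX.locallyIntegrable x) (hX.locallyIntegrable x)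
  -- The identity along a direction mapped to a multiple of itself.
  have heig : ∀ (x : M) (w : Eucl m × Eucl n) (κ : ℝ), κ ≠ 0 → linReflect e w.2 = κ • w.2 →
      w.1 = κ • w.1 → ∀ ψ : Eucl m × Eucl n → ℝ, ContDiff ℝ ∞ ψ → HasCompactSupport ψ →
      tsupport ψ ⊆ prodTarget (m := m) n x →
      ∫ q, prodPol H u (prodChartInv x q) * fderiv ℝ ψ q w =
        - ∫ q, chartCoeff g (SteinerProduct.polField H u X) x w q * ψ q := by
    intro x w κ hκ h2 h1 ψ hψ hψc hψs
    rcases eq_or_ne w 0 with rfl | hw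
    · have : ∀ q, chartCoeff g (SteinerProduct.polField H u X) x 0 q = 0 := fun q => by
        rw [chartCoeff_eq_inner, map_zero, inner_zero_right]
      simp [this]
    have hwκ : ((w.1, linReflect e w.2) : Eucl m × Eucl n) = κ • w := Prod.ext h1 h2
    have := integral_polarize_mul_fderiv (μ := volume) (κ := κ) (β := -inner ℝ w.2 e) hσ hm hcont
      (measurable_prodHeight H) (isOpen_prodTarget (m := m) x) (hΩ x) hw hκ ?_ ?_
      (hX.locallyIntegrable x) (hX.locallyIntegrable_coeff x w) (hX.integral_eq x w) hψ hψc hψs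
    · have e2 : chartCoeff g (SteinerProduct.polField H u X) x w = polarizeDeriv (prodReflect H)
          (prodHeight H) (fun q => u (prodChartInv x q)) κ (chartCoeff g X x w) := by
        funext q
        rw [chartCoeff_polField, ← he_def, hwκ, chartCoeff_smul_right, polarizeDeriv]
      rw [e2]
      exact this
    · intro p ρ
      refine Prod.ext ?_ ?_
      · change p.1 + ρ • w.1 = p.1 + (κ * ρ) • w.1
        rw [mul_comm κ, mul_smul, ← h1]
      · change reflect e H.2 (p.2 + ρ • w.2) = reflect e H.2 p.2 + (κ * ρ) • w.2
        rw [mul_comm κ, mul_smul, ← h2, linReflect_apply he]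
        simp only [reflect, height, inner_add_left, real_inner_smul_left]
        module
    · intro p ρ
      change height e H.2 (p.2 + ρ • w.2) = height e H.2 p.2 + ρ * _
      simp only [height, inner_add_left, real_inner_smul_left]
      ring
  refine ⟨hpol, hcoef, fun x w ψ hψ hψc hψs => ?_⟩
  have hee : inner ℝ e e = (1 : ℝ) := by rw [real_inner_self_eq_norm_sq, he]; norm_num
  let a : Eucl m × Eucl n := (w.1, w.2 - (inner ℝ w.2 e : ℝ) • e)
  let b : Eucl m × Eucl n := (0, (inner ℝ w.2 e : ℝ) • e)
  have hab : w = a + b := Prod.ext (add_zero _).symm (sub_add_cancel _ _).symm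
  have ha := heig x a 1 one_ne_zero (by
    rw [linReflect_apply he]
    simp only [a, inner_sub_left, real_inner_smul_left, hee]
    module) (by simp) ψ hψ hψc hψs
  have hb := heig x b (-1) (by norm_num) (by
    rw [linReflect_apply he]
    simp only [b, real_inner_smul_left, hee]
    module) (by simp [b]) ψ hψ hψc hψs
  have hint : ∀ w', Integrable fun q => prodPol H u (prodChartInv x q) * fderiv ℝ ψ q w' :=
    fun w' => integrable_mul_compactSupport (hpol x)
      ((hψ.continuous_fderiv (by simp)).clm_apply continuous_const)
      (hψc.fderiv_apply (𝕜 := ℝ) w') ((tsupport_fderiv_apply_subset ℝ w').trans hψs)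
  have hint' := fun w' => integrable_mul_compactSupport (hcoef x w') hψ.continuous hψc hψs
  rw [hab]
  simp only [map_add, chartCoeff_add_right, mul_add, add_mul]
  rw [integral_add (hint a) (hint b), integral_add (hint' a) (hint' b), ha, hb]
  ring

end ProductPolarization

/-! ### Uniform convexity of the `L^s`-norm of vector fields -/

section UniformConvexity

/-- The power `s > 1` of the length of the midpoint is smaller than the mean of the powers, by a
fixed proportion, unless the end points are close. The numbers stand for the lengths of two
vectors, of their midpoint and of their difference. -/
lemma exists_midpoint_defect {s : ℝ} (hs : 1 < s) {ε : ℝ} (hε : 0 < ε) :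
    ∃ K : ℝ, 0 ≤ K ∧ ∀ α β γ d : ℝ, 0 ≤ α → 0 ≤ β → 0 ≤ γ → 0 ≤ d →
      γ ^ 2 + d ^ 2 / 4 = (α ^ 2 + β ^ 2) / 2 → γ ≤ (α + β) / 2 → d ≤ α + β →
      d ^ s ≤ ε * (α ^ s + β ^ s) + K * ((α ^ s + β ^ s) / 2 - γ ^ s) := by
  have hs0 : 0 < s := one_pos.trans hs
  have hcont : Continuous fun a : ℝ => a ^ s := Real.continuous_rpow_const hs0.le
  have hconv : ∀ α β γ : ℝ, 0 ≤ α → 0 ≤ β → 0 ≤ γ → γ ≤ (α + β) / 2 →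
      γ ^ s ≤ (α ^ s + β ^ s) / 2 := by
    intro α β γ hα hβ hγ h
    have := (convexOn_rpow hs.le).2 (Set.mem_Ici.2 hα) (Set.mem_Ici.2 hβ)
      (by norm_num : (0 : ℝ) ≤ 1 / 2) (by norm_num : (0 : ℝ) ≤ 1 / 2) (by norm_num)
    simp only [smul_eq_mul] at this
    have h2 := Real.rpow_le_rpow hγ (h.trans_eq (by ring : (α + β) / 2 = 1 / 2 * α + 1 / 2 * β))
      hs0.le
    linarith
  let T : Set (ℝ × ℝ × ℝ × ℝ) := (Set.Icc 0 1 ×ˢ Set.Icc 0 1 ×ˢ Set.Icc 0 1 ×ˢ Set.Icc 0 2) ∩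
    ({q | q.2.2.1 ^ 2 + q.2.2.2 ^ 2 / 4 = (q.1 ^ 2 + q.2.1 ^ 2) / 2} ∩
      ({q | q.2.2.1 ≤ (q.1 + q.2.1) / 2} ∩ {q | ε ≤ q.2.2.2 ^ s}))
  have hT : IsCompact T := by
    refine (isCompact_Icc.prod (isCompact_Icc.prod (isCompact_Icc.prod isCompact_Icc))).inter_right
      ((isClosed_eq (by fun_prop) (by fun_prop)).inter ((isClosed_le (by fun_prop)
        (by fun_prop)).inter (isClosed_le continuous_const (hcont.comp (by fun_prop)))))
  let F : ℝ × ℝ × ℝ × ℝ → ℝ := fun q => (q.1 ^ s + q.2.1 ^ s) / 2 - q.2.2.1 ^ s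
  have hF : Continuous F :=
    (((hcont.comp continuous_fst).add (hcont.comp (continuous_fst.comp continuous_snd))).div_const
      2).sub (hcont.comp (continuous_fst.comp (continuous_snd.comp continuous_snd)))
  have hFpos : ∀ q ∈ T, 0 < F q := by
    rintro ⟨α, β, γ, d⟩ ⟨⟨hα, hβ, hγ, hd⟩, h1, h2, h3⟩
    simp only [Set.mem_Icc, Set.mem_ofPred_eq] at hα hβ hγ hd h1 h2 h3
    simp only [F, sub_pos]
    by_cases hab : α = β
    · subst hab
      have hdpos : 0 < d := by
        rcases hd.1.eq_or_lt with h | h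
        · rw [← h, Real.zero_rpow hs0.ne'] at h3
          exact absurd h3 (not_le.2 hε)
        · exact h
      have : γ < α := by
        refine lt_of_pow_lt_pow_left₀ 2 hα.1 ?_
        nlinarith [sq_pos_of_pos hdpos]
      have := Real.rpow_lt_rpow hγ.1 this hs0
      linarith
    · have := (strictConvexOn_rpow hs).2 (Set.mem_Ici.2 hα.1) (Set.mem_Ici.2 hβ.1) hab
        (by norm_num : (0 : ℝ) < 1 / 2) (by norm_num : (0 : ℝ) < 1 / 2) (by norm_num)
      simp only [smul_eq_mul] at this
      have h4 := Real.rpow_le_rpow hγ.1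
        (h2.trans_eq (by ring : (α + β) / 2 = 1 / 2 * α + 1 / 2 * β)) hs0.le
      linarith
  obtain ⟨δ, hδ, hle⟩ : ∃ δ : ℝ, 0 < δ ∧ ∀ q ∈ T, δ ≤ F q := by
    rcases T.eq_empty_or_nonempty with h | hne
    · exact ⟨1, one_pos, by simp [h]⟩
    · obtain ⟨q, hq, hmin⟩ := hT.exists_isMinOn hne hF.continuousOn
      exact ⟨_, hFpos q hq, hmin⟩
  refine ⟨2 ^ s / δ, by positivity, fun α β γ d hα hβ hγ hd h1 h2 h3 => ?_⟩
  have hdef := hconv α β γ hα hβ hγ h2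
  have hK : 0 ≤ 2 ^ s / δ := by positivity
  have hα' := Real.rpow_nonneg hα s
  have hβ' := Real.rpow_nonneg hβ s
  rcases (add_nonneg hα' hβ').eq_or_lt with h0 | hpos
  · have ha : α = 0 := by
      rw [← Real.rpow_eq_zero hα hs0.ne']; linarith
    have hb : β = 0 := by
      rw [← Real.rpow_eq_zero hβ hs0.ne']; linarith
    have hd0 : d = 0 := le_antisymm (by linarith) hd
    rw [← h0, hd0, Real.zero_rpow hs0.ne']
    have : 0 ≤ 2 ^ s / δ * ((α ^ s + β ^ s) / 2 - γ ^ s) := mul_nonneg hK (by linarith)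
    rw [← h0] at this
    linarith
  -- Both sides are homogeneous, so that one may assume `α ^ s + β ^ s = 1`.
  set N := α ^ s + β ^ s with hN
  let l : ℝ := N ^ (-(1 / s))
  have hl : 0 < l := Real.rpow_pos_of_pos hpos _
  have hls : l ^ s = N⁻¹ := by
    rw [← Real.rpow_mul hpos.le, neg_mul, one_div, inv_mul_cancel₀ hs0.ne', Real.rpow_neg_one]
  have hscale : ∀ a, 0 ≤ a → (l * a) ^ s = N⁻¹ * a ^ s := fun a ha => by
    rw [Real.mul_rpow hl.le ha, hls]
  have hone : (l * α) ^ s + (l * β) ^ s = 1 := by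
    rw [hscale α hα, hscale β hβ, ← mul_add, ← hN, inv_mul_cancel₀ hpos.ne']
  have hle1 : ∀ a, 0 ≤ a → (l * a) ^ s ≤ 1 → l * a ≤ 1 := fun a ha h => by
    by_contra hlt
    exact absurd h (not_le.2 (Real.one_lt_rpow (not_le.1 hlt) hs0))
  have hα1 : l * α ≤ 1 := hle1 α hα (by
    have := Real.rpow_nonneg (mul_nonneg hl.le hβ) s; linarith)
  have hβ1 : l * β ≤ 1 := hle1 β hβ (by
    have := Real.rpow_nonneg (mul_nonneg hl.le hα) s; linarith)
  have hγ1 : l * γ ≤ (l * α + l * β) / 2 := by nlinarith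
  have hd1 : l * d ≤ l * α + l * β := by nlinarith
  have key : (l * d) ^ s ≤ ε + 2 ^ s / δ * ((1 : ℝ) / 2 - (l * γ) ^ s) := by
    have hdef' := hconv (l * α) (l * β) (l * γ) (by positivity) (by positivity) (by positivity) hγ1
    rw [hone] at hdef'
    rcases le_or_gt ε ((l * d) ^ s) with h | h
    · have hmem : ((l * α, l * β, l * γ, l * d) : ℝ × ℝ × ℝ × ℝ) ∈ T := by
        refine ⟨⟨⟨by positivity, hα1⟩, ⟨by positivity, hβ1⟩, ⟨by positivity, ?_⟩,
          ⟨by positivity, ?_⟩⟩, ?_, hγ1, h⟩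
        · simp only; linarith
        · simp only; linarith
        · simp only [Set.mem_ofPred_eq]
          linear_combination l ^ 2 * h1
      have h5 := hle _ hmem
      simp only [F] at h5
      rw [hone] at h5
      have h6 : (l * d) ^ s ≤ 2 ^ s :=
        Real.rpow_le_rpow (by positivity) (by linarith) hs0.le
      have h7 : 2 ^ s ≤ 2 ^ s / δ * ((1 : ℝ) / 2 - (l * γ) ^ s) := by
        rw [div_mul_eq_mul_div, le_div_iff₀ hδ]
        exact mul_le_mul_of_nonneg_left h5 (by positivity)
      linarith
    · have : 0 ≤ 2 ^ s / δ * ((1 : ℝ) / 2 - (l * γ) ^ s) := mul_nonneg hK (by linarith)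
      linarith
  rw [hscale d hd, hscale γ hγ] at key
  have := mul_le_mul_of_nonneg_left key hpos.le
  rw [← mul_assoc, mul_inv_cancel₀ hpos.ne', one_mul] at this
  refine this.trans_eq ?_
  field_simp

lemma exists_norm_sub_rpow_le {s : ℝ} (hs : 1 < s) {ε : ℝ} (hε : 0 < ε) :
    ∃ K : ℝ, 0 ≤ K ∧ ∀ {V : Type*} [NormedAddCommGroup V] [InnerProductSpace ℝ V] (a b : V),
      ‖a - b‖ ^ s ≤ ε * (‖a‖ ^ s + ‖b‖ ^ s) +
        K * ((‖a‖ ^ s + ‖b‖ ^ s) / 2 - ‖(1 / 2 : ℝ) • a + (1 / 2 : ℝ) • b‖ ^ s) := by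
  obtain ⟨K, hK, h⟩ := exists_midpoint_defect hs hε
  refine ⟨K, hK, fun {V} _ _ a b => h _ _ _ _ (norm_nonneg _) (norm_nonneg _) (norm_nonneg _)
    (norm_nonneg _) ?_ ?_ (norm_sub_le a b)⟩
  · have := parallelogram_law_with_norm ℝ a b
    rw [← smul_add, norm_smul, Real.norm_of_nonneg (by norm_num : (0 : ℝ) ≤ 1 / 2)]
    linarith
  · rw [← smul_add, norm_smul, Real.norm_of_nonneg (by norm_num : (0 : ℝ) ≤ 1 / 2)]
    have := norm_add_le a b
    linarith

end UniformConvexity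

section StrongLimit

variable {α : Type*} [MeasurableSpace α] {μ : Measure α} {V : α → Type*}
  [∀ p, NormedAddCommGroup (V p)] [∀ p, InnerProductSpace ℝ (V p)]

/-- Near-minimizers of the `L^s`-norm on a decreasing sequence of midpoint convex sets of vector
fields form a Cauchy sequence. -/
lemma exists_cauchy_minimizers {r : ℝ} (hr : 1 < r) {S : ℕ → Set (∀ p, V p)} (hS : Antitone S)
    (hne : ∀ j, (S j).Nonempty)
    (hmid : ∀ j, ∀ X ∈ S j, ∀ Y ∈ S j, (fun p => (1 / 2 : ℝ) • X p + (1 / 2 : ℝ) • Y p) ∈ S j)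
    (hint : ∀ X ∈ S 0, Integrable (fun p => ‖X p‖ ^ r) μ) {C : ℝ}
    (hC : ∀ X ∈ S 0, ∫ p, ‖X p‖ ^ r ∂μ ≤ C)
    (hsub : ∀ X ∈ S 0, ∀ Y ∈ S 0, AEStronglyMeasurable (fun p => ‖X p - Y p‖) μ) :
    ∃ Z : ℕ → ∀ p, V p, (∀ j, Z j ∈ S j) ∧
      (∀ i j, Integrable (fun p => ‖Z i p - Z j p‖ ^ r) μ) ∧
      ∀ η > 0, ∃ N, ∀ i j, N ≤ j → j ≤ i → ∫ p, ‖Z i p - Z j p‖ ^ r ∂μ ≤ η := by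
  have hr0 : 0 < r := one_pos.trans hr
  let E : (∀ p, V p) → ℝ := fun X => ∫ p, ‖X p‖ ^ r ∂μ
  have hE0 : ∀ X, 0 ≤ E X := fun X => integral_nonneg fun p => Real.rpow_nonneg (norm_nonneg _) _
  have hS0 : ∀ j, S j ⊆ S 0 := fun j => hS (Nat.zero_le j)
  let I : ℕ → ℝ := fun j => sInf (E '' S j)
  have hbdd : ∀ j, BddBelow (E '' S j) := fun j => ⟨0, by rintro _ ⟨X, -, rfl⟩; exact hE0 X⟩
  have hImono : Monotone I := fun i j hij =>
    csInf_le_csInf (hbdd i) ((hne j).image E) (Set.image_mono (hS hij))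
  have hIle : ∀ j, ∀ X ∈ S j, I j ≤ E X := fun j X hX => csInf_le (hbdd j) ⟨X, hX, rfl⟩
  have hIbdd : BddAbove (Set.range I) := by
    refine ⟨C, ?_⟩
    rintro _ ⟨j, rfl⟩
    obtain ⟨X, hX⟩ := hne j
    exact (hIle j X hX).trans (hC X (hS0 j hX))
  have hlim := tendsto_atTop_ciSup hImono hIbdd
  have hIsup : ∀ j, I j ≤ ⨆ i, I i := le_ciSup hIbdd
  have hex : ∀ j : ℕ, ∃ X ∈ S j, E X < I j + 1 / ((j : ℝ) + 1) := fun j => by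
    obtain ⟨_, ⟨X, hX, rfl⟩, h⟩ := exists_lt_of_csInf_lt ((hne j).image E)
      (lt_add_of_pos_right (I j) (by positivity : (0 : ℝ) < 1 / ((j : ℝ) + 1)))
    exact ⟨X, hX, h⟩
  choose Z hZ hZI using hex
  have hconv : ∀ ε > 0, ∃ K : ℝ, 0 ≤ K ∧ ∀ i j,
      Integrable (fun p => ‖Z i p - Z j p‖ ^ r) μ ∧
      (j ≤ i → ∫ p, ‖Z i p - Z j p‖ ^ r ∂μ ≤
        ε * (2 * C) + K * ((E (Z i) + E (Z j)) / 2 - I j)) := by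
    intro ε hε
    obtain ⟨K, hK, h⟩ := exists_norm_sub_rpow_le hr hε
    refine ⟨K, hK, fun i j => ?_⟩
    have hi := hint _ (hS0 i (hZ i))
    have hj := hint _ (hS0 j (hZ j))
    have hm := hint _ (hmid 0 _ (hS0 i (hZ i)) _ (hS0 j (hZ j)))
    have hij : Integrable (fun p => ‖Z i p‖ ^ r + ‖Z j p‖ ^ r) μ := hi.add hj
    have hdef : Integrable (fun p => (‖Z i p‖ ^ r + ‖Z j p‖ ^ r) / 2 -
        ‖(1 / 2 : ℝ) • Z i p + (1 / 2 : ℝ) • Z j p‖ ^ r) μ := (hij.div_const 2).sub hm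
    have hrhs := (hij.const_mul ε).add (hdef.const_mul K)
    have hD : Integrable (fun p => ‖Z i p - Z j p‖ ^ r) μ := by
      refine hrhs.mono' ?_ (Filter.Eventually.of_forall fun p => ?_)
      · exact ((hsub _ (hS0 i (hZ i)) _ (hS0 j (hZ j))).aemeasurable.pow_const
          r).aestronglyMeasurable
      · rw [Real.norm_of_nonneg (Real.rpow_nonneg (norm_nonneg _) _)]
        exact h (Z i p) (Z j p)
    refine ⟨hD, fun hji => ?_⟩
    have h1 := integral_mono hD hrhs fun p => h (Z i p) (Z j p)
    have h2 := hIle j _ (hmid j _ (hS hji (hZ i)) _ (hZ j))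
    have h3 := hC _ (hS0 i (hZ i))
    have h4 := hC _ (hS0 j (hZ j))
    have e : ∫ p, (ε * (‖Z i p‖ ^ r + ‖Z j p‖ ^ r) + K * ((‖Z i p‖ ^ r + ‖Z j p‖ ^ r) / 2 -
        ‖(1 / 2 : ℝ) • Z i p + (1 / 2 : ℝ) • Z j p‖ ^ r)) ∂μ = ε * (E (Z i) + E (Z j)) +
        K * ((E (Z i) + E (Z j)) / 2 -
          E (fun p => (1 / 2 : ℝ) • Z i p + (1 / 2 : ℝ) • Z j p)) := by
      rw [integral_add (hij.const_mul ε) (hdef.const_mul K), integral_const_mul,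
        integral_const_mul, integral_sub (hij.div_const 2) hm, integral_div, integral_add hi hj]
    refine (h1.trans_eq e).trans (add_le_add ?_ ?_)
    · exact mul_le_mul_of_nonneg_left (by simp only [E]; linarith) hε.le
    · exact mul_le_mul_of_nonneg_left (by linarith) hK
  refine ⟨Z, hZ, fun i j => ((hconv 1 one_pos).choose_spec.2 i j).1, fun η hη => ?_⟩
  have hC0 : 0 ≤ C := by
    obtain ⟨X, hX⟩ := hne 0
    exact (hE0 X).trans (hC X hX)
  obtain ⟨K, hK, h⟩ := hconv (η / (2 * (2 * C + 1))) (by positivity)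
  have htend : Filter.Tendsto (fun j : ℕ => K * (((⨆ i, I i) - I j) / 2 + 1 / ((j : ℝ) + 1)))
      Filter.atTop (nhds 0) := by
    have h1 := ((hlim.const_sub (⨆ i, I i)).div_const 2).add
      (tendsto_one_div_add_atTop_nhds_zero_nat (𝕜 := ℝ))
    simpa using h1.const_mul K
  obtain ⟨N, hN⟩ := Filter.eventually_atTop.1 (htend.eventually_lt_const (half_pos hη))
  refine ⟨N, fun i j hj hji => ((h i j).2 hji).trans ?_⟩
  have h1 : η / (2 * (2 * C + 1)) * (2 * C) ≤ η / 2 := by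
    rw [div_mul_eq_mul_div, div_le_div_iff₀ (by positivity) two_pos]
    nlinarith
  have h2 : (E (Z i) + E (Z j)) / 2 - I j ≤ ((⨆ i, I i) - I j) / 2 + 1 / ((j : ℝ) + 1) := by
    have a1 := hZI i
    have a2 := hZI j
    have a3 := hIsup i
    have a4 : 1 / ((i : ℝ) + 1) ≤ 1 / ((j : ℝ) + 1) :=
      one_div_le_one_div_of_le (by positivity) (by have : (j : ℝ) ≤ i := by exact_mod_cast hji
                                                   linarith)
    linarith
  have h3 := hN j hj
  have h4 := mul_le_mul_of_nonneg_left h2 hK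
  linarith

omit [∀ p, InnerProductSpace ℝ (V p)] in
/-- A Cauchy sequence of vector fields for the `L^s`-norm has a subsequence which converges both
almost everywhere and in `L^s`. -/
lemma exists_limit_of_cauchy [∀ p, CompleteSpace (V p)] {r : ℝ} (hr : 0 < r)
    {Z : ℕ → ∀ p, V p} (hint : ∀ i j, Integrable (fun p => ‖Z i p - Z j p‖ ^ r) μ)
    (hZ : ∀ η > 0, ∃ N, ∀ i j, N ≤ j → j ≤ i → ∫ p, ‖Z i p - Z j p‖ ^ r ∂μ ≤ η) :
    ∃ φ : ℕ → ℕ, StrictMono φ ∧ ∃ W : ∀ p, V p,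
      (∀ᵐ p ∂μ, Filter.Tendsto (fun k => Z (φ k) p) Filter.atTop (nhds (W p))) ∧
      Filter.Tendsto (fun k => ∫⁻ p, ENNReal.ofReal (‖W p - Z (φ k) p‖ ^ r) ∂μ)
        Filter.atTop (nhds 0) := by
  classical
  let η : ℕ → ℝ := fun k => (1 / 2 : ℝ) ^ k * ((1 / 2 : ℝ) ^ k) ^ r
  have hη : ∀ k, 0 < η k := fun k => by positivity
  obtain ⟨φ, hφ, hφη⟩ := Filter.extraction_forall_of_eventually' (P := fun k N => ∀ i, N ≤ i →
    ∫ p, ‖Z i p - Z N p‖ ^ r ∂μ ≤ η k) fun k => by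
      obtain ⟨N, hN⟩ := hZ (η k) (hη k)
      exact ⟨N, fun j hj i hji => hN i j hj hji⟩
  have hnn : ∀ i j p, 0 ≤ ‖Z i p - Z j p‖ ^ r := fun i j p => Real.rpow_nonneg (norm_nonneg _) _
  have hl : ∀ k i, φ k ≤ i →
      ∫⁻ p, ENNReal.ofReal (‖Z i p - Z (φ k) p‖ ^ r) ∂μ ≤ ENNReal.ofReal (η k) := fun k i hi => by
    rw [← ofReal_integral_eq_lintegral_ofReal (hint _ _)
      (Filter.Eventually.of_forall (hnn _ _))]
    exact ENNReal.ofReal_le_ofReal (hφη k i hi)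
  -- The increments are a.e. bounded by a geometric sequence.
  have hsum : ∫⁻ p, ∑' k, ENNReal.ofReal (((1 / 2 : ℝ) ^ k) ^ r)⁻¹ *
      ENNReal.ofReal (‖Z (φ (k + 1)) p - Z (φ k) p‖ ^ r) ∂μ ≠ ⊤ := by
    rw [lintegral_tsum fun k =>
      ((hint _ _).aestronglyMeasurable.aemeasurable.ennreal_ofReal).const_mul _]
    refine ne_top_of_le_ne_top (b := ∑' k : ℕ, ENNReal.ofReal ((1 / 2 : ℝ) ^ k)) ?_
      (ENNReal.tsum_le_tsum fun k => ?_)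
    · rw [← ENNReal.ofReal_tsum_of_nonneg (fun k => by positivity)
        summable_geometric_two]
      exact ENNReal.ofReal_ne_top
    · rw [lintegral_const_mul'' _ (hint _ _).aestronglyMeasurable.aemeasurable.ennreal_ofReal]
      refine (mul_le_mul' le_rfl (hl k _ (hφ.monotone (Nat.le_succ k)))).trans_eq ?_
      rw [← ENNReal.ofReal_mul (by positivity)]
      congr 1
      simp only [η]
      have : (((1 / 2 : ℝ) ^ k) ^ r) ≠ 0 := by positivity
      field_simp
  have hcauchy : ∀ᵐ p ∂μ, ∃ w, Filter.Tendsto (fun k => Z (φ k) p) Filter.atTop (nhds w) := by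
    have hae := ae_lt_top' (AEMeasurable.tsum fun k =>
      ((hint _ _).aestronglyMeasurable.aemeasurable.ennreal_ofReal).const_mul _) hsum
    filter_upwards [hae] with p hp
    set B := ∑' k, ENNReal.ofReal (((1 / 2 : ℝ) ^ k) ^ r)⁻¹ *
      ENNReal.ofReal (‖Z (φ (k + 1)) p - Z (φ k) p‖ ^ r)
    refine cauchySeq_tendsto_of_complete
      (cauchySeq_of_le_geometric (1 / 2) (B.toReal ^ (1 / r)) (by norm_num) fun k => ?_)
    have h1 : ENNReal.ofReal (((1 / 2 : ℝ) ^ k) ^ r)⁻¹ *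
        ENNReal.ofReal (‖Z (φ (k + 1)) p - Z (φ k) p‖ ^ r) ≤ B := ENNReal.le_tsum k
    rw [← ENNReal.ofReal_mul (by positivity), ENNReal.ofReal_le_iff_le_toReal hp.ne] at h1
    have hpos : 0 < ((1 / 2 : ℝ) ^ k) ^ r := by positivity
    rw [inv_mul_le_iff₀ hpos] at h1
    have h2 := Real.rpow_le_rpow (hnn _ _ p) h1 (by positivity : 0 ≤ 1 / r)
    rw [← Real.rpow_mul (norm_nonneg _), mul_one_div_cancel hr.ne', Real.rpow_one,
      Real.mul_rpow hpos.le ENNReal.toReal_nonneg, ← Real.rpow_mul (by positivity),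
      mul_one_div_cancel hr.ne', Real.rpow_one, mul_comm] at h2
    rwa [dist_comm, dist_eq_norm]
  let W : ∀ p, V p := fun p =>
    if h : ∃ w, Filter.Tendsto (fun k => Z (φ k) p) Filter.atTop (nhds w) then h.choose else 0
  have hW : ∀ᵐ p ∂μ, Filter.Tendsto (fun k => Z (φ k) p) Filter.atTop (nhds (W p)) := by
    filter_upwards [hcauchy] with p hp
    simp only [W, dif_pos hp]
    exact hp.choose_spec
  refine ⟨φ, hφ, W, hW, ?_⟩
  have hηlim : Filter.Tendsto (fun k => ENNReal.ofReal (η k)) Filter.atTop (nhds 0) := by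
    rw [← ENNReal.ofReal_zero]
    refine ENNReal.tendsto_ofReal (squeeze_zero (fun k => (hη k).le) (fun k => ?_)
      (tendsto_pow_atTop_nhds_zero_of_lt_one (by norm_num : (0 : ℝ) ≤ 1 / 2) (by norm_num)))
    exact mul_le_of_le_one_right (by positivity) (Real.rpow_le_one (by positivity)
      (pow_le_one₀ (by norm_num) (by norm_num)) hr.le)
  refine tendsto_of_tendsto_of_tendsto_of_le_of_le tendsto_const_nhds hηlim
    (fun _ => zero_le) fun k => ?_
  calc ∫⁻ p, ENNReal.ofReal (‖W p - Z (φ k) p‖ ^ r) ∂μ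
      ≤ ∫⁻ p, Filter.liminf (fun i => ENNReal.ofReal (‖Z (φ i) p - Z (φ k) p‖ ^ r))
          Filter.atTop ∂μ := by
        refine lintegral_mono_ae ?_
        filter_upwards [hW] with p hp
        refine le_of_eq (Filter.Tendsto.liminf_eq ?_).symm
        exact ENNReal.tendsto_ofReal (((hp.sub_const _).norm).rpow_const (Or.inr hr.le))
    _ ≤ Filter.liminf (fun i => ∫⁻ p, ENNReal.ofReal (‖Z (φ i) p - Z (φ k) p‖ ^ r) ∂μ)
          Filter.atTop := lintegral_liminf_le'
        fun i => (hint _ _).aestronglyMeasurable.aemeasurable.ennreal_ofReal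
    _ ≤ ENNReal.ofReal (η k) := by
        refine Filter.liminf_le_of_frequently_le' (Filter.Eventually.frequently ?_)
        filter_upwards [Filter.eventually_ge_atTop k] with i hi
        exact hl k _ (hφ.monotone hi)

end StrongLimit

/-! ### Lower semicontinuity of the energy -/

lemma tendsto_integral_mul_of_compactSupport {E : Type*} [NormedAddCommGroup E]
    [MeasurableSpace E] [BorelSpace E] {μ : Measure E} {Ω : Set E} {a : ℕ → E → ℝ} {b φ : E → ℝ}
    (ha : ∀ k, LocallyIntegrableOn (a k) Ω μ) (hb : LocallyIntegrableOn b Ω μ)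
    (hφ : Continuous φ) (hc : HasCompactSupport φ) (hs : tsupport φ ⊆ Ω)
    (hlim : Filter.Tendsto (fun k => ∫⁻ q in tsupport φ, ‖a k q - b q‖ₑ ∂μ)
      Filter.atTop (nhds 0)) :
    Filter.Tendsto (fun k => ∫ q, a k q * φ q ∂μ) Filter.atTop (nhds (∫ q, b q * φ q ∂μ)) := by
  obtain ⟨B, hB⟩ := hφ.bounded_above_of_compact_support hc
  have hB0 : (0 : ℝ) ≤ B := by
    by_contra h
    exact absurd ((norm_nonneg _).trans (hB 0)) h
  refine tendsto_integral_of_L1 _ (integrable_mul_compactSupport hb hφ hc hs).aestronglyMeasurable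
    (Filter.Eventually.of_forall fun k => integrable_mul_compactSupport (ha k) hφ hc hs) ?_
  have h2 : Filter.Tendsto (fun k => ENNReal.ofReal B * ∫⁻ q in tsupport φ, ‖a k q - b q‖ₑ ∂μ)
      Filter.atTop (nhds 0) := by
    simpa using ENNReal.Tendsto.const_mul hlim (Or.inr ENNReal.ofReal_ne_top)
  refine tendsto_of_tendsto_of_tendsto_of_le_of_le tendsto_const_nhds h2 (fun _ => zero_le)
    fun k => ?_
  simp only
  rw [← lintegral_const_mul' _ _ ENNReal.ofReal_ne_top, ← lintegral_indicator
    (isClosed_tsupport φ).measurableSet]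
  refine lintegral_mono fun q => ?_
  by_cases hq : q ∈ tsupport φ
  · rw [Set.indicator_of_mem hq, ← sub_mul, enorm_mul, mul_comm]
    refine mul_le_mul' ?_ le_rfl
    rw [← ofReal_norm]
    exact ENNReal.ofReal_le_ofReal (hB q)
  · simp [image_eq_zero_of_notMem_tsupport hq]

variable {m n : ℕ} {M : Type*} [TopologicalSpace M] [ChartedSpace (Eucl m) M]
  [IsManifold (𝓡 m) ∞ M] [MeasurableSpace M]

lemma fieldNorm_eq_lintegral (g : SmoothMetric m M) {s : ℝ≥0∞} (hs : s ≠ 0) (hs' : s ≠ ⊤)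
    (X : ∀ p : M × Eucl n, ProdTangent (m := m) p) :
    fieldNorm g s X = (∫⁻ p, ENNReal.ofReal (‖vec g X p‖ ^ s.toReal) ∂productVolume g n) ^
      (1 / s.toReal) := by
  rw [fieldNorm, eLpNorm_eq_lintegral_rpow_enorm_toReal hs hs']
  congr 1
  refine lintegral_congr fun p => ?_
  rw [fieldLength_eq_norm, enorm_norm, ← ofReal_norm,
    ENNReal.ofReal_rpow_of_nonneg (norm_nonneg _) ENNReal.toReal_nonneg]

variable [BorelSpace M] [CompactSpace M]

/-- The set of gradients of norm at most `C` of functions which are close to `v` in `L^s`. -/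
def gradientsNear (g : SmoothMetric m M) (s : ℝ≥0∞) (v : M × Eucl n → ℝ) (C δ : ℝ≥0∞) :
    Set (∀ p : M × Eucl n, TVec g p) :=
  {Z | ∃ w : M × Eucl n → ℝ, IsWeakGradient g w (toField Z) ∧
    AEStronglyMeasurable w (productVolume g n) ∧
    eLpNorm (fun p => w p - v p) s (productVolume g n) ≤ δ ∧ fieldNorm g s (toField Z) ≤ C}

lemma midpoint_mem_gradientsNear {g : SmoothMetric m M} {s : ℝ≥0∞} (hs : 1 ≤ s)
    {v : M × Eucl n → ℝ} (hv : AEStronglyMeasurable v (productVolume g n)) {C δ : ℝ≥0∞}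
    {X Y : ∀ p : M × Eucl n, TVec g p} (hX : X ∈ gradientsNear g s v C δ)
    (hY : Y ∈ gradientsNear g s v C δ) :
    (fun p => (1 / 2 : ℝ) • X p + (1 / 2 : ℝ) • Y p) ∈ gradientsNear g s v C δ := by
  obtain ⟨w, hw, hwm, hwv, hXC⟩ := hX
  obtain ⟨w', hw', hwm', hwv', hYC⟩ := hY
  have hhalf : ‖(1 / 2 : ℝ)‖ₑ = 2⁻¹ := by
    rw [← ofReal_norm, Real.norm_of_nonneg (by norm_num), one_div,
      ENNReal.ofReal_inv_of_pos two_pos]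
    simp
  have hsum : ∀ c : ℝ≥0∞, 2⁻¹ * c + 2⁻¹ * c = c := fun c => by
    rw [← add_mul, ENNReal.inv_two_add_inv_two, one_mul]
  refine ⟨fun p => (1 / 2 : ℝ) * w p + (1 / 2 : ℝ) * w' p, hw.linComb hw' _ _,
    (hwm.const_mul _).add (hwm'.const_mul _), ?_, ?_⟩
  · have e : (fun p => (1 / 2 : ℝ) * w p + (1 / 2 : ℝ) * w' p - v p) =
        ((1 / 2 : ℝ) • fun p => w p - v p) + ((1 / 2 : ℝ) • fun p => w' p - v p) := by
      funext p
      simp only [Pi.add_apply, Pi.smul_apply, smul_eq_mul]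
      ring
    rw [e]
    refine (eLpNorm_add_le ((hwm.sub hv).const_smul _) ((hwm'.sub hv).const_smul _) hs).trans ?_
    rw [eLpNorm_const_smul, eLpNorm_const_smul, hhalf, ← hsum δ]
    exact add_le_add (mul_le_mul' le_rfl hwv) (mul_le_mul' le_rfl hwv')
  · have hXm := hw.aemeasurable_fieldLength.aestronglyMeasurable
    have hYm := hw'.aemeasurable_fieldLength.aestronglyMeasurable
    rw [← hsum C]
    refine le_trans ?_ (add_le_add (mul_le_mul' (le_refl (2⁻¹ : ℝ≥0∞)) hXC)
      (mul_le_mul' (le_refl (2⁻¹ : ℝ≥0∞)) hYC))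
    rw [fieldNorm, fieldNorm, fieldNorm, ← hhalf, ← eLpNorm_const_smul, ← eLpNorm_const_smul]
    refine le_trans (eLpNorm_mono_real fun p => ?_)
      (eLpNorm_add_le (hXm.const_smul _) (hYm.const_smul _) hs)
    have e : fieldLength g (toField fun p => (1 / 2 : ℝ) • X p + (1 / 2 : ℝ) • Y p) p =
        ‖(1 / 2 : ℝ) • X p + (1 / 2 : ℝ) • Y p‖ := rfl
    rw [Real.norm_of_nonneg (show 0 ≤ fieldLength g _ p from Real.sqrt_nonneg _), e]
    refine (norm_add_le ((1 / 2 : ℝ) • X p) ((1 / 2 : ℝ) • Y p)).trans_eq ?_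
    rw [norm_smul, norm_smul, Real.norm_of_nonneg (by norm_num : (0 : ℝ) ≤ 1 / 2)]
    rfl

/-- The `L^s`-bound on gradients passes to limits of functions in `L^s`. The Hilbert space norms of
the tangent spaces make the norm of `L^s` vector fields uniformly convex, so that suitable convex
combinations of the gradients converge strongly. -/
theorem exists_isWeakGradient_of_tendsto {g : SmoothMetric m M} {s : ℝ≥0∞} (hs : 1 < s)
    (hs' : s < ⊤) {u : ℕ → M × Eucl n → ℝ} {X : ℕ → ∀ p : M × Eucl n, ProdTangent (m := m) p}
    (hu : ∀ k, IsWeakGradient g (u k) (X k))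
    (hm : ∀ k, AEStronglyMeasurable (u k) (productVolume g n)) {v : M × Eucl n → ℝ}
    (hv : MemLp v s (productVolume g n))
    (hlim : Filter.Tendsto (fun k => eLpNorm (fun p => u k p - v p) s (productVolume g n))
      Filter.atTop (nhds 0)) {C : ℝ≥0∞} (hC : C ≠ ⊤) (hXC : ∀ k, fieldNorm g s (X k) ≤ C) :
    ∃ Z : ∀ p : M × Eucl n, ProdTangent (m := m) p, IsWeakGradient g v Z ∧
      MemLp (fieldLength g Z) s (productVolume g n) ∧ fieldNorm g s Z ≤ C := by
  have hs0 : s ≠ 0 := (zero_lt_one.trans hs).ne'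
  set r := s.toReal with hrdef
  have hr : 1 < r := by
    rw [hrdef, ← ENNReal.toReal_one]; exact (ENNReal.toReal_lt_toReal (by simp) hs'.ne).2 hs
  have hr0 : 0 < r := one_pos.trans hr
  let S : ℕ → Set (∀ p : M × Eucl n, TVec g p) := fun j =>
    gradientsNear g s v C (ENNReal.ofReal ((1 / 2 : ℝ) ^ j))
  have hδ : Filter.Tendsto (fun j : ℕ => ENNReal.ofReal ((1 / 2 : ℝ) ^ j)) Filter.atTop
      (nhds 0) := by
    rw [← ENNReal.ofReal_zero]
    exact ENNReal.tendsto_ofReal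
      (tendsto_pow_atTop_nhds_zero_of_lt_one (by norm_num : (0 : ℝ) ≤ 1 / 2) (by norm_num))
  have hS : Antitone S := by
    rintro i j hij Z ⟨w, h1, h2, h3, h4⟩
    exact ⟨w, h1, h2, h3.trans (ENNReal.ofReal_le_ofReal
      (pow_le_pow_of_le_one (by norm_num) (by norm_num) hij)), h4⟩
  have hne : ∀ j, (S j).Nonempty := fun j => by
    obtain ⟨k, hk⟩ := (hlim.eventually_lt_const
      (ENNReal.ofReal_pos.2 (by positivity : (0 : ℝ) < (1 / 2 : ℝ) ^ j))).exists
    exact ⟨X k, u k, hu k, hm k, hk.le, hXC k⟩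
  have hmeas : ∀ Z ∈ S 0, AEMeasurable (fun p => ‖Z p‖) (productVolume g n) := by
    rintro Z ⟨w, h1, -⟩
    exact h1.aemeasurable_fieldLength
  have hlint : ∀ Z ∈ S 0, ∫⁻ p, ENNReal.ofReal (‖Z p‖ ^ r) ∂productVolume g n ≤ C ^ r := by
    rintro Z ⟨w, -, -, -, h4⟩
    rw [fieldNorm_eq_lintegral g hs0 hs'.ne] at h4
    change (∫⁻ p, ENNReal.ofReal (‖Z p‖ ^ r) ∂productVolume g n) ^ (1 / r) ≤ C at h4
    have := ENNReal.rpow_le_rpow h4 hr0.le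
    rwa [← ENNReal.rpow_mul, one_div_mul_cancel hr0.ne', ENNReal.rpow_one] at this
  have hCr : C ^ r ≠ ⊤ := ENNReal.rpow_ne_top_of_nonneg hr0.le hC
  have hint : ∀ Z ∈ S 0, Integrable (fun p => ‖Z p‖ ^ r) (productVolume g n) := fun Z hZ => by
    refine ⟨((hmeas Z hZ).pow_const r).aestronglyMeasurable, ?_⟩
    rw [hasFiniteIntegral_iff_ofReal
      (Filter.Eventually.of_forall fun p => Real.rpow_nonneg (norm_nonneg _) _)]
    exact (hlint Z hZ).trans_lt hCr.lt_top
  have hCint : ∀ Z ∈ S 0, ∫ p, ‖Z p‖ ^ r ∂productVolume g n ≤ (C ^ r).toReal := fun Z hZ => by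
    rw [integral_eq_lintegral_of_nonneg_ae
      (Filter.Eventually.of_forall fun p => Real.rpow_nonneg (norm_nonneg _) _)
      (hint Z hZ).aestronglyMeasurable]
    exact ENNReal.toReal_mono hCr (hlint Z hZ)
  have hsub : ∀ Y ∈ S 0, ∀ Z ∈ S 0,
      AEStronglyMeasurable (fun p => ‖Y p - Z p‖) (productVolume g n) := by
    rintro Y ⟨w, h1, -⟩ Z ⟨w', h1', -⟩
    have := (h1.linComb h1' 1 (-1)).aemeasurable_fieldLength.aestronglyMeasurable
    refine this.congr (Filter.Eventually.of_forall fun p => ?_)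
    change ‖(1 : ℝ) • Y p + (-1 : ℝ) • Z p‖ = ‖Y p - Z p‖
    rw [one_smul, neg_one_smul, sub_eq_add_neg]
  obtain ⟨Z, hZS, hZint, hZc⟩ := exists_cauchy_minimizers hr hS hne
    (fun j X hX Y hY => midpoint_mem_gradientsNear hs.le hv.1 hX hY) hint hCint hsub
  obtain ⟨φ, hφ, W, hW, hWlim⟩ := exists_limit_of_cauchy hr0 hZint hZc
  have hZφ : ∀ k, Z (φ k) ∈ S k := fun k => hS (hφ.id_le k) (hZS (φ k))
  choose w hw hwm hwv hwC using hZφ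
  have hS0 : ∀ k, Z (φ k) ∈ S 0 := fun k => hS (Nat.zero_le _) (hZS (φ k))
  have hWm : AEStronglyMeasurable (fun p => ‖W p‖) (productVolume g n) :=
    aestronglyMeasurable_of_tendsto_ae Filter.atTop
      (fun k => (hmeas _ (hS0 k)).aestronglyMeasurable) (by
        filter_upwards [hW] with p hp using hp.norm)
  have hWZm : ∀ k, AEStronglyMeasurable (fun p => ‖W p - Z (φ k) p‖) (productVolume g n) :=
    fun k => aestronglyMeasurable_of_tendsto_ae Filter.atTop
      (f := fun i p => ‖Z (φ i) p - Z (φ k) p‖)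
      (fun i => hsub _ (hS0 i) _ (hS0 k)) (by
        filter_upwards [hW] with p hp using (hp.sub_const _).norm)
  have hWC : fieldNorm g s (toField W) ≤ C := by
    have h := Lp.eLpNorm_lim_le_liminf_eLpNorm (p := s) (f := fun k p => ‖Z (φ k) p‖)
      (fun k => (hmeas _ (hS0 k)).aestronglyMeasurable) (fun p => ‖W p‖) (by
        filter_upwards [hW] with p hp using hp.norm)
    refine h.trans (Filter.liminf_le_of_frequently_le' (Filter.Eventually.frequently
      (Filter.Eventually.of_forall fun k => hwC k)))
  have hWL : MemLp (fieldLength g (toField W)) s (productVolume g n) :=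
    ⟨hWm, hWC.trans_lt hC.lt_top⟩
  have hWZ : Filter.Tendsto (fun k => eLpNorm (fun p => ‖W p - Z (φ k) p‖) s (productVolume g n))
      Filter.atTop (nhds 0) := by
    have h1 := (ENNReal.continuous_rpow_const (y := 1 / r)).tendsto 0 |>.comp hWlim
    rw [ENNReal.zero_rpow_of_pos (by positivity)] at h1
    refine h1.congr fun k => ?_
    rw [eLpNorm_eq_lintegral_rpow_enorm_toReal hs0 hs'.ne]
    simp only [Function.comp]
    congr 1
    refine lintegral_congr fun p => ?_
    rw [enorm_norm, ← ofReal_norm, ENNReal.ofReal_rpow_of_nonneg (norm_nonneg _) hr0.le]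
  -- Convergence of the coefficients in `L¹` on compact subsets of charts.
  have hcoefint : ∀ (x : M) (y : Eucl m × Eucl n) (K : Set (Eucl m × Eucl n)), IsCompact K →
      K ⊆ prodTarget (m := m) n x → Filter.Tendsto
      (fun k => ∫⁻ q in K,
        ‖chartCoeff g (toField (Z (φ k))) x y q - chartCoeff g (toField W) x y q‖ₑ)
      Filter.atTop (nhds 0) := by
    intro x y K hK hKt
    obtain ⟨D, hD, hDle⟩ := exists_setLIntegral_chart_le (n := n) g x hs.le hK hKt
    obtain ⟨B, hB⟩ := hK.exists_bound_of_continuousOn ((continuousOn_norm_frame g x y).mono hKt)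
    have h1 : Filter.Tendsto (fun k => ENNReal.ofReal B *
        (D * eLpNorm (fun p => ‖W p - Z (φ k) p‖) s (productVolume g n)))
        Filter.atTop (nhds 0) := by
      have := ENNReal.Tendsto.const_mul (ENNReal.Tendsto.const_mul hWZ (Or.inr hD))
        (Or.inr (ENNReal.ofReal_ne_top (r := B)))
      simpa using this
    refine tendsto_of_tendsto_of_tendsto_of_le_of_le tendsto_const_nhds h1 (fun _ => zero_le)
      fun k => ?_
    refine le_trans ?_ (mul_le_mul' le_rfl (hDle _ (hWZm k)))
    rw [← lintegral_const_mul' _ _ ENNReal.ofReal_ne_top]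
    refine setLIntegral_mono' hK.measurableSet fun q hq => ?_
    rw [chartCoeff_eq_inner, chartCoeff_eq_inner, ← inner_sub_left, enorm_norm,
      ← ofReal_norm, ← ofReal_norm, ← ENNReal.ofReal_mul ((norm_nonneg _).trans (hB q hq))]
    refine ENNReal.ofReal_le_ofReal ((abs_real_inner_le_norm _ _).trans ?_)
    rw [mul_comm, norm_sub_rev]
    have hBq := hB q hq
    rw [norm_norm] at hBq
    exact mul_le_mul_of_nonneg_right hBq (norm_nonneg _)
  have hcoef : ∀ (x : M) (y : Eucl m × Eucl n),
      LocallyIntegrableOn (chartCoeff g (toField W) x y) (prodTarget (m := m) n x) := by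
    intro x y
    have hlc := (isOpen_prodTarget (m := m) (n := n) x).isLocallyClosed
    have hae := ae_chart_of_ae g x hW
    have hmes : AEStronglyMeasurable (chartCoeff g (toField W) x y)
        (volume.restrict (prodTarget (m := m) n x)) := by
      refine aestronglyMeasurable_of_tendsto_ae Filter.atTop
        (fun k => ((hw k).locallyIntegrable_coeff x y).aestronglyMeasurable) ?_
      filter_upwards [hae] with q hq
      exact hq.inner tendsto_const_nhds
    rw [locallyIntegrableOn_iff hlc]
    intro K hKt hK
    have h1 : IntegrableOn
        (fun q => fieldLength g (toField W) (prodChartInv x q) * ‖frame g x q y‖) K :=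
      ((MemLp.locallyIntegrableOn_chart g x hs.le hWL).integrableOn_compact_subset hKt
        hK).mul_continuousOn ((continuousOn_norm_frame g x y).mono hKt) hK
    exact h1.mono' (hmes.mono_measure (Measure.restrict_mono hKt le_rfl))
      (Filter.Eventually.of_forall fun q => abs_chartCoeff_le g (toField W) x y q)
  refine ⟨toField W, ⟨fun x => MemLp.locallyIntegrableOn_chart g x hs.le hv, hcoef,
    fun x y ψ hψ hc hψs => ?_⟩, hWL, hWC⟩
  have hcf : Continuous fun q => fderiv ℝ ψ q y :=
    (hψ.continuous_fderiv (by simp)).clm_apply continuous_const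
  have hcc : HasCompactSupport fun q => fderiv ℝ ψ q y := hc.fderiv_apply (𝕜 := ℝ) y
  have hcs : tsupport (fun q => fderiv ℝ ψ q y) ⊆ prodTarget (m := m) n x :=
    (tsupport_fderiv_apply_subset ℝ y).trans hψs
  have hwlim : Filter.Tendsto (fun k => eLpNorm (fun p => w k p - v p) s (productVolume g n))
      Filter.atTop (nhds 0) :=
    tendsto_of_tendsto_of_tendsto_of_le_of_le tendsto_const_nhds hδ (fun _ => zero_le) hwv
  have lim1 := tendsto_integral_mul_of_compactSupport (a := fun k q => w k (prodChartInv x q))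
    (b := fun q => v (prodChartInv x q)) (fun k => (hw k).locallyIntegrable x)
    (MemLp.locallyIntegrableOn_chart g x hs.le hv) hcf hcc hcs (by
      obtain ⟨D, hD, hDle⟩ := exists_setLIntegral_chart_le (n := n) g x hs.le hcc hcs
      have h1 := ENNReal.Tendsto.const_mul hwlim (Or.inr hD)
      rw [mul_zero] at h1
      exact tendsto_of_tendsto_of_tendsto_of_le_of_le tendsto_const_nhds h1 (fun _ => zero_le)
        fun k => hDle _ ((hwm k).sub hv.1))
  have lim2 := tendsto_integral_mul_of_compactSupport
    (fun k => (hw k).locallyIntegrable_coeff x y) (hcoef x y) hψ.continuous hc hψs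
    (hcoefint x y _ hc hψs)
  refine tendsto_nhds_unique lim1 (lim2.neg.congr fun k => ?_)
  exact ((hw k).integral_eq x y ψ hψ hc hψs).symm

/-! ### Convergence of polarizations in `L^s` -/

lemma abs_sub_rpow_le {r : ℝ} (hr : 1 ≤ r) {a b : ℝ} (ha : 0 ≤ a) (hb : 0 ≤ b) :
    |a - b| ^ r ≤ |a ^ r - b ^ r| := by
  wlog h : b ≤ a generalizing a b
  · rw [abs_sub_comm, abs_sub_comm (a ^ r)]
    exact this hb ha (le_of_not_ge h)
  rw [abs_of_nonneg (sub_nonneg.2 h)]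
  have := Real.add_rpow_le_rpow_add (sub_nonneg.2 h) hb hr
  rw [sub_add_cancel] at this
  exact le_trans (by linarith) (le_abs_self _)

section Fibre

variable {n : ℕ}

lemma sweep_rpow (H : ℕ → HalfSpace n) (k : ℕ) {f : Eucl n → ℝ} (hf : ∀ z, 0 ≤ f z) {r : ℝ}
    (hr : 0 < r) (z : Eucl n) :
    sweep H k (fun y => f y ^ r) z = sweep H k f z ^ r := by
  have h := sweep_induction₂ (P := fun F f => (∀ z, 0 ≤ f z) ∧ F = fun y => f y ^ r)
    (fun H' F f h => ⟨polarize_nonneg h.1, by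
      rw [h.2]
      funext y
      exact polarize_comp (φ := fun a => a ^ r)
        (fun a ha b _ hab => Real.rpow_lt_rpow ha hab hr) h.1 y⟩) H k ⟨hf, rfl⟩
  rw [h.2]

lemma sweep_nonneg (H : ℕ → HalfSpace n) (k : ℕ) {f : Eucl n → ℝ} (hf : ∀ z, 0 ≤ f z)
    (z : Eucl n) : 0 ≤ sweep H k f z :=
  sweep_induction (P := fun f => ∀ z, 0 ≤ f z) (fun _ _ h => polarize_nonneg h) H k hf z

lemma sweep_integrable (H : ℕ → HalfSpace n) (k : ℕ) {f : Eucl n → ℝ} (hf : Measurable f)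
    (hi : Integrable f) : Integrable (sweep H k f) ∧ ∫ z, sweep H k f z = ∫ z, f z := by
  have := sweep_induction
    (P := fun F => Measurable F ∧ Integrable F ∧ ∫ z, F z = ∫ z, f z)
    (fun H' F h => ⟨measurable_pol H' h.1, integrable_pol H' h.1 h.2.1,
      (H'.isReflection.integral_polarize H'.measurePreserving H'.measurable_height h.1
        h.2.1).trans h.2.2⟩) H k ⟨hf, hi, rfl⟩
  exact this.2

variable [NeZero n]

omit [NeZero n] in
lemma Vanishing.of_integrable_rpow {f : Eucl n → ℝ} (hf : Measurable f) (hf0 : ∀ z, 0 ≤ f z)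
    {r : ℝ} (hr : 0 < r) (hi : Integrable fun z => f z ^ r) : Vanishing f :=
  ⟨hf, hf0, fun c hc => (measure_mono fun _ hy => Real.rpow_lt_rpow hc.le hy hr).trans_lt
    ((Vanishing.of_integrable (hf.pow_const r) (fun z => Real.rpow_nonneg (hf0 z) r) hi).finite
      (c ^ r) (Real.rpow_pos_of_pos hc r))⟩

variable {f : Eucl n → ℝ} {r : ℝ}

/-- The `L^r`-distance of a sweep to the rearrangement is controlled by the `L¹`-distance for the
function `f ^ r`, since both operations commute with powers. -/
lemma lintegral_sweep_sub_rearr_le (hf : Measurable f) (hf0 : ∀ z, 0 ≤ f z) (hr : 1 ≤ r)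
    (hi : Integrable fun z => f z ^ r) (H : ℕ → HalfSpace n) (k : ℕ) :
    ∫⁻ z, ENNReal.ofReal (|sweep H k f z - rearr f z| ^ r) ≤
      ENNReal.ofReal (∫ z, |sweep H k (fun y => f y ^ r) z - rearr (fun y => f y ^ r) z|) := by
  have hr0 : 0 < r := one_pos.trans_le hr
  have hF0 : ∀ z, 0 ≤ f z ^ r := fun z => Real.rpow_nonneg (hf0 z) r
  have vf := Vanishing.of_integrable_rpow hf hf0 hr0 hi
  have vF := Vanishing.of_integrable (hf.pow_const r) hF0 hi
  have hF : Integrable fun z => |sweep H k (fun y => f y ^ r) z - rearr (fun y => f y ^ r) z| :=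
    ((sweep_integrable H k (hf.pow_const r) hi).1.sub (vF.integrable_rearr hi)).abs
  rw [ofReal_integral_eq_lintegral_ofReal hF (Filter.Eventually.of_forall fun _ => abs_nonneg _)]
  refine lintegral_mono_ae ?_
  filter_upwards [ae_ne_zero (n := n)] with z hz
  refine ENNReal.ofReal_le_ofReal ?_
  rw [sweep_rpow H k hf0 hr0, vf.rearr_rpow hr0 vF hz]
  exact abs_sub_rpow_le hr (sweep_nonneg H k hf0 z) (vf.rearr_nonneg hz)

lemma tendsto_lintegral_sweep (hf : Measurable f) (hf0 : ∀ z, 0 ≤ f z) (hr : 1 ≤ r)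
    (hi : Integrable fun z => f z ^ r) {H : ℕ → HalfSpace n} (hH : DenseRange H) :
    Filter.Tendsto (fun k => ∫⁻ z, ENNReal.ofReal (|sweep H k f z - rearr f z| ^ r))
      Filter.atTop (nhds 0) := by
  have h := ENNReal.tendsto_ofReal (tendsto_integral_sweep hH (hf.pow_const r)
    (fun z => Real.rpow_nonneg (hf0 z) r) hi)
  rw [ENNReal.ofReal_zero] at h
  exact tendsto_of_tendsto_of_tendsto_of_le_of_le tendsto_const_nhds h (fun _ => zero_le)
    fun k => lintegral_sweep_sub_rearr_le hf hf0 hr hi H k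

lemma lintegral_sweep_sub_rearr_le_two_mul (hf : Measurable f) (hf0 : ∀ z, 0 ≤ f z) (hr : 1 ≤ r)
    (hi : Integrable fun z => f z ^ r) (H : ℕ → HalfSpace n) (k : ℕ) :
    ∫⁻ z, ENNReal.ofReal (|sweep H k f z - rearr f z| ^ r) ≤
      2 * ∫⁻ z, ENNReal.ofReal (f z ^ r) := by
  have hr0 : 0 < r := one_pos.trans_le hr
  have hF0 : ∀ z, 0 ≤ f z ^ r := fun z => Real.rpow_nonneg (hf0 z) r
  have vF := Vanishing.of_integrable (hf.pow_const r) hF0 hi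
  refine (lintegral_sweep_sub_rearr_le hf hf0 hr hi H k).trans ?_
  rw [← ofReal_integral_eq_lintegral_ofReal hi (Filter.Eventually.of_forall hF0),
    show 2 * ENNReal.ofReal (∫ z, f z ^ r) = ENNReal.ofReal (2 * ∫ z, f z ^ r) by
      rw [ENNReal.ofReal_mul zero_le_two, ENNReal.ofReal_ofNat]]
  refine ENNReal.ofReal_le_ofReal ?_
  have hs := sweep_integrable H k (hf.pow_const r) hi
  have hrr := vF.integrable_rearr hi
  calc ∫ z, |sweep H k (fun y => f y ^ r) z - rearr (fun y => f y ^ r) z|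
      ≤ ∫ z, (sweep H k (fun y => f y ^ r) z + rearr (fun y => f y ^ r) z) := by
        refine integral_mono_ae (hs.1.sub hrr).abs (hs.1.add hrr) ?_
        filter_upwards [ae_ne_zero (n := n)] with z hz
        have h1 := sweep_nonneg H k hF0 z
        have h2 := vF.rearr_nonneg hz
        exact abs_le.2 ⟨by linarith, by linarith⟩
    _ = 2 * ∫ z, f z ^ r := by
        rw [integral_add hs.1 hrr, hs.2, vF.integral_rearr]; ring

lemma lintegral_rearr_rpow (hf : Measurable f) (hf0 : ∀ z, 0 ≤ f z) (hr : 0 < r)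
    (hi : Integrable fun z => f z ^ r) :
    ∫⁻ z, ENNReal.ofReal (|rearr f z| ^ r) = ∫⁻ z, ENNReal.ofReal (f z ^ r) := by
  have hF0 : ∀ z, 0 ≤ f z ^ r := fun z => Real.rpow_nonneg (hf0 z) r
  have vf := Vanishing.of_integrable_rpow hf hf0 hr hi
  have vF := Vanishing.of_integrable (hf.pow_const r) hF0 hi
  rw [← vF.lintegral_rearr]
  refine lintegral_congr_ae ?_
  filter_upwards [ae_ne_zero (n := n)] with z hz
  rw [vf.rearr_rpow hr vF hz, abs_of_nonneg (vf.rearr_nonneg hz)]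

end Fibre

section Product

variable {α : Type*} {n : ℕ}

/-- Fibrewise successive polarizations. -/
def prodIterPol (H : ℕ → HalfSpace n) : ℕ → (α × Eucl n → ℝ) → α × Eucl n → ℝ
  | 0, u => u
  | k + 1, u => prodPol (H k) (prodIterPol H k u)

/-- Fibrewise sweeps. -/
def prodSweep (H : ℕ → HalfSpace n) : ℕ → (α × Eucl n → ℝ) → α × Eucl n → ℝ
  | 0, u => u
  | k + 1, u => prodIterPol H (k + 1) (prodSweep H k u)

lemma prodIterPol_apply (H : ℕ → HalfSpace n) (k : ℕ) (u : α × Eucl n → ℝ) (p : α × Eucl n) :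
    prodIterPol H k u p = iterPol H k (fun z => u (p.1, z)) p.2 := by
  induction k generalizing p with
  | zero => rfl
  | succ k ih =>
    rw [prodIterPol, prodPol_apply, iterPol]
    simp only [ih]

lemma prodSweep_apply (H : ℕ → HalfSpace n) (k : ℕ) (u : α × Eucl n → ℝ) (p : α × Eucl n) :
    prodSweep H k u p = sweep H k (fun z => u (p.1, z)) p.2 := by
  induction k generalizing p with
  | zero => rfl
  | succ k ih =>
    rw [prodSweep, prodIterPol_apply, sweep]
    simp only [ih]

lemma prodSweep_induction {P : (α × Eucl n → ℝ) → Prop} (hP : ∀ H u, P u → P (prodPol H u))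
    (H : ℕ → HalfSpace n) (k : ℕ) {u : α × Eucl n → ℝ} (hu : P u) : P (prodSweep H k u) := by
  have iter : ∀ j v, P v → P (prodIterPol H j v) := fun j v hv => by
    induction j with
    | zero => exact hv
    | succ j ih => exact hP _ _ ih
  induction k with
  | zero => exact hu
  | succ k ih => exact iter _ _ ih

variable [MeasurableSpace α]

lemma measurable_prodSweep (H : ℕ → HalfSpace n) (k : ℕ) {u : α × Eucl n → ℝ}
    (hu : Measurable u) : Measurable (prodSweep H k u) :=
  prodSweep_induction (P := Measurable)
    (fun H _ h => measurable_polarize (measurable_prodReflect H) (measurable_prodHeight H) h)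
    H k hu

variable {ν : Measure α} {s : ℝ≥0∞} {u : α × Eucl n → ℝ}

lemma eLpNorm_prod_eq (hs : s ≠ 0) (hs' : s ≠ ⊤) {f : α × Eucl n → ℝ}
    (hf : AEMeasurable f (ν.prod volume)) :
    eLpNorm f s (ν.prod volume) =
      (∫⁻ x, (∫⁻ z, ENNReal.ofReal (|f (x, z)| ^ s.toReal)) ∂ν) ^ (1 / s.toReal) := by
  rw [eLpNorm_eq_lintegral_rpow_enorm_toReal hs hs', lintegral_prod _ (hf.enorm.pow_const _)]
  congr 1
  refine lintegral_congr fun x => lintegral_congr fun z => ?_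
  rw [← ofReal_norm, ENNReal.ofReal_rpow_of_nonneg (norm_nonneg _) ENNReal.toReal_nonneg,
    Real.norm_eq_abs]

lemma lintegral_lintegral_lt_top (hs : s ≠ 0) (hs' : s ≠ ⊤) (hu0 : ∀ p, 0 ≤ u p)
    (hL : MemLp u s (ν.prod volume)) :
    ∫⁻ x, (∫⁻ z, ENNReal.ofReal (u (x, z) ^ s.toReal)) ∂ν < ⊤ := by
  have h := hL.2
  rw [eLpNorm_prod_eq hs hs' hL.1.aemeasurable] at h
  simp only [abs_of_nonneg (hu0 _)] at h
  have hr0 : 0 < s.toReal := ENNReal.toReal_pos hs hs'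
  exact (ENNReal.rpow_lt_top_iff_of_pos (by positivity)).1 h

/-- A nonnegative function in `L^s` has a measurable nonnegative representative all of whose fibres
are in `L^s`. -/
lemma exists_good_representative (hs : s ≠ 0) (hs' : s ≠ ⊤) (hL : MemLp u s (ν.prod volume))
    (hu0 : 0 ≤ᵐ[ν.prod volume] u) :
    ∃ v : α × Eucl n → ℝ, Measurable v ∧ (∀ p, 0 ≤ v p) ∧
      (∀ x, Integrable fun z => v (x, z) ^ s.toReal) ∧ u =ᵐ[ν.prod volume] v := by
  classical
  obtain ⟨w, hw, hwu⟩ := hL.1.aemeasurable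
  let w' : α × Eucl n → ℝ := fun p => max (w p) 0
  have hw' : Measurable w' := hw.max measurable_const
  have hw0 : ∀ p, 0 ≤ w' p := fun p => le_max_right _ _
  have huw : u =ᵐ[ν.prod volume] w' := by
    filter_upwards [hwu, hu0] with p hp h0
    simp only [w', ← hp]
    exact (max_eq_left h0).symm
  have hfin := lintegral_lintegral_lt_top hs hs' hw0 (hL.ae_eq huw)
  have hmeas : Measurable fun x => ∫⁻ z, ENNReal.ofReal (w' (x, z) ^ s.toReal) :=
    (hw'.pow_const _).ennreal_ofReal.lintegral_prod_right'
  let G : Set α := {x | ∫⁻ z, ENNReal.ofReal (w' (x, z) ^ s.toReal) < ⊤}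
  have hG : MeasurableSet G := measurableSet_lt hmeas measurable_const
  have hae : ∀ᵐ x ∂ν, x ∈ G := ae_lt_top hmeas hfin.ne
  have hr0 : 0 < s.toReal := ENNReal.toReal_pos hs hs'
  refine ⟨fun p => if p.1 ∈ G then w' p else 0, Measurable.ite (measurable_fst hG) hw'
    measurable_const, fun p => ?_, fun x => ?_, ?_⟩
  · by_cases hp : p.1 ∈ G
    · simpa only [if_pos hp] using hw0 p
    · simp only [if_neg hp, le_refl]
  · by_cases hx : x ∈ G
    · simp only [hx, if_true]
      refine ⟨((hw'.comp measurable_prodMk_left).pow_const _).aestronglyMeasurable, ?_⟩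
      rw [hasFiniteIntegral_iff_ofReal
        (Filter.Eventually.of_forall fun z => Real.rpow_nonneg (hw0 _) _)]
      exact hx
    · simp only [hx, if_false, Real.zero_rpow hr0.ne']
      exact integrable_zero _ _ _
  · have h1 :=
      (Measure.quasiMeasurePreserving_fst (μ := ν) (ν := (volume : Measure (Eucl n)))).ae hae
    filter_upwards [huw, h1] with p hp hpG
    rw [hp, if_pos hpG]

variable [NeZero n]

lemma ae_snd_ne_zero : ∀ᵐ p ∂ν.prod (volume : Measure (Eucl n)), p.2 ≠ 0 :=
  Measure.quasiMeasurePreserving_snd.ae (ae_ne_zero (n := n))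

/-- Off the null set `α × {0}`, the superlevel sets of the symmetrization are given by comparing the
volume of a ball with that of a fibre, both of which are measurable. -/
lemma aemeasurable_steiner {u : α × Eucl n → ℝ} (hu : Measurable u)
    (hv : ∀ x, Vanishing fun z => u (x, z)) : AEMeasurable (steiner u) (ν.prod volume) := by
  refine ⟨fun p => if p.2 = 0 then 0 else steiner u p, measurable_of_Ioi fun c => ?_, ?_⟩
  · have h0 : MeasurableSet {p : α × Eucl n | p.2 = 0} :=
      measurable_snd (measurableSet_singleton 0)
    rcases lt_or_ge c 0 with hc | hc
    · convert MeasurableSet.univ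
      ext p
      simp only [Set.mem_preimage, Set.mem_Ioi, Set.mem_univ, iff_true]
      split_ifs with hz
      · exact hc
      · exact hc.trans_le ((hv p.1).rearr_nonneg hz)
    · have hball : Measurable fun p : α × Eucl n => volume (Metric.ball (0 : Eucl n) ‖p.2‖) := by
        have : Monotone fun ρ : ℝ => volume (Metric.ball (0 : Eucl n) ρ) :=
          fun a b hab => measure_mono (Metric.ball_subset_ball hab)
        exact this.measurable.comp measurable_snd.norm
      have hfib : Measurable fun p : α × Eucl n => volume {y | c < u (p.1, y)} :=
        (measurable_measure_prodMk_left (measurableSet_lt measurable_const hu)).comp measurable_fst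
      convert h0.compl.inter (measurableSet_lt hball hfib)
      ext p
      simp only [Set.mem_preimage, Set.mem_Ioi, Set.mem_inter_iff, Set.mem_compl_iff,
        Set.mem_ofPred_eq]
      split_ifs with hz
      · simp [hz, hc]
      · simp only [hz, not_false_eq_true, true_and]
        exact (hv p.1).lt_rearr_iff hz c
  · filter_upwards [ae_snd_ne_zero (n := n) (ν := ν)] with p hp
    rw [if_neg hp]

lemma steiner_congr_ae {u v : α × Eucl n → ℝ} (h : u =ᵐ[ν.prod volume] v) :
    steiner u =ᵐ[ν.prod volume] steiner v := by
  have h1 := (Measure.quasiMeasurePreserving_fst (μ := ν) (ν := (volume : Measure (Eucl n)))).ae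
    (Measure.ae_ae_of_ae_prod h)
  filter_upwards [h1, ae_snd_ne_zero (n := n) (ν := ν)] with p hp hz
  rw [steiner_eq_rearr, steiner_eq_rearr]
  refine rearr_congr (fun c => measure_congr ?_) hz
  filter_upwards [hp] with z hz'
  exact congrArg (fun a => c < a) hz'

lemma memLp_steiner (hs : 1 ≤ s) (hs' : s ≠ ⊤) (hu : Measurable u) (hu0 : ∀ p, 0 ≤ u p)
    (hi : ∀ x, Integrable fun z => u (x, z) ^ s.toReal) (hL : MemLp u s (ν.prod volume)) :
    MemLp (steiner u) s (ν.prod volume) := by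
  have hs0 : s ≠ 0 := (zero_lt_one.trans_le hs).ne'
  have hr0 : 0 < s.toReal := ENNReal.toReal_pos hs0 hs'
  have hm : AEMeasurable (steiner u) (ν.prod volume) := aemeasurable_steiner hu fun x =>
    Vanishing.of_integrable_rpow (hu.comp measurable_prodMk_left) (fun z => hu0 _) hr0 (hi x)
  refine ⟨hm.aestronglyMeasurable, ?_⟩
  have h := lintegral_lintegral_lt_top hs0 hs' hu0 hL
  rw [eLpNorm_prod_eq hs0 hs' hm]
  refine ENNReal.rpow_lt_top_of_nonneg (by positivity) ?_
  simp only [steiner_eq_rearr]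
  rw [lintegral_congr fun x => lintegral_rearr_rpow (f := fun z => u (x, z))
    (hu.comp measurable_prodMk_left) (fun z => hu0 _) hr0 (hi x)]
  exact h.ne

/-- The sweeps of `u` converge to its Steiner symmetrization in `L^s`. -/
lemma tendsto_eLpNorm_prodSweep (hs : 1 ≤ s) (hs' : s ≠ ⊤) (hu : Measurable u)
    (hu0 : ∀ p, 0 ≤ u p) (hi : ∀ x, Integrable fun z => u (x, z) ^ s.toReal)
    (hL : MemLp u s (ν.prod volume)) {H : ℕ → HalfSpace n} (hH : DenseRange H) :
    Filter.Tendsto (fun k => eLpNorm (fun p => prodSweep H k u p - steiner u p) s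
      (ν.prod volume)) Filter.atTop (nhds 0) := by
  have hs0 : s ≠ 0 := (zero_lt_one.trans_le hs).ne'
  have hr0 : 0 < s.toReal := ENNReal.toReal_pos hs0 hs'
  have hr1 : 1 ≤ s.toReal := by
    rw [← ENNReal.toReal_one]; exact ENNReal.toReal_mono hs' hs
  have hm : AEMeasurable (steiner u) (ν.prod volume) := aemeasurable_steiner hu fun x =>
    Vanishing.of_integrable_rpow (hu.comp measurable_prodMk_left) (fun z => hu0 _) hr0 (hi x)
  have hmk : ∀ k, AEMeasurable (fun p => prodSweep H k u p - steiner u p) (ν.prod volume) :=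
    fun k => (measurable_prodSweep H k hu).aemeasurable.sub hm
  have hint : Filter.Tendsto (fun k => ∫⁻ x, (∫⁻ z,
      ENNReal.ofReal (|prodSweep H k u (x, z) - steiner u (x, z)| ^ s.toReal)) ∂ν)
      Filter.atTop (nhds (∫⁻ _, 0 ∂ν)) := by
    refine tendsto_lintegral_of_dominated_convergence'
      (fun x => 2 * ∫⁻ z, ENNReal.ofReal (u (x, z) ^ s.toReal)) (fun k => ?_) (fun k => ?_) ?_ ?_
    · exact (((hmk k).abs).pow_const _).ennreal_ofReal.lintegral_prod_right'
    · refine Filter.Eventually.of_forall fun x => ?_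
      simp only [prodSweep_apply, steiner_eq_rearr]
      exact lintegral_sweep_sub_rearr_le_two_mul (f := fun z => u (x, z))
        (hu.comp measurable_prodMk_left) (fun z => hu0 _) hr1 (hi x) H k
    · rw [lintegral_const_mul' _ _ (by simp)]
      exact ENNReal.mul_ne_top (by simp) (lintegral_lintegral_lt_top hs0 hs' hu0 hL).ne
    · refine Filter.Eventually.of_forall fun x => ?_
      simp only [prodSweep_apply, steiner_eq_rearr]
      exact tendsto_lintegral_sweep (f := fun z => u (x, z))
        (hu.comp measurable_prodMk_left) (fun z => hu0 _) hr1 (hi x) hH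
  rw [lintegral_zero] at hint
  have h := (ENNReal.continuous_rpow_const (y := 1 / s.toReal)).tendsto 0 |>.comp hint
  rw [ENNReal.zero_rpow_of_pos (by positivity)] at h
  exact h.congr fun k => (eLpNorm_prod_eq hs0 hs' (hmk k)).symm

end Product

/-! ### The symmetrization inequality -/

/-- On `M × ℝ⁰` symmetrization does nothing. -/
lemma steiner_of_dim_zero {M : Type*} (u : M × Eucl 0 → ℝ) : steiner u = u := by
  funext p
  have h : {c : ℝ | p ∈ steinerSet {q | c < u q}} = Set.Iio (u p) := by
    ext c
    have hz : ∀ z : Eucl 0, z = p.2 := fun z => Subsingleton.elim _ _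
    simp only [steinerSet, fiber, Set.mem_ofPred_eq, Set.mem_Iio]
    constructor
    · rintro (h | ⟨-, z, h⟩)
      · obtain ⟨z, h⟩ := nonempty_of_measure_ne_zero (bot_le.trans_lt h).ne'
        rw [hz z] at h
        exact h
      · rw [hz z] at h
        exact h
    · exact fun h => Or.inr ⟨Subsingleton.elim _ _, p.2, h⟩
  rw [steiner, h, csSup_Iio]

variable {m n : ℕ} {M : Type*} [TopologicalSpace M] [ChartedSpace (Eucl m) M]
  [IsManifold (𝓡 m) ∞ M] [MeasurableSpace M] [BorelSpace M] [CompactSpace M]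

/-- The symmetrization is the `L^s`-limit of sweeps whose gradients all have the norm of the
gradient of `u`. -/
lemma exists_isWeakGradient_steiner [NeZero n] {g : SmoothMetric m M} {s : ℝ≥0∞} (hs : 1 < s)
    (hs' : s < ⊤) {u : M × Eucl n → ℝ} (hL : MemLp u s (productVolume g n))
    (hu0 : 0 ≤ᵐ[productVolume g n] u) {X : ∀ p : M × Eucl n, ProdTangent (m := m) p}
    (hX : IsWeakGradient g u X) (hXL : MemLp (fieldLength g X) s (productVolume g n)) :
    MemLp (steiner u) s (productVolume g n) ∧ 0 ≤ᵐ[productVolume g n] steiner u ∧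
    ∃ Z : ∀ p : M × Eucl n, ProdTangent (m := m) p, IsWeakGradient g (steiner u) Z ∧
      MemLp (fieldLength g Z) s (productVolume g n) ∧ fieldNorm g s Z ≤ fieldNorm g s X := by
  have hs0 : s ≠ 0 := (zero_lt_one.trans hs).ne'
  obtain ⟨v, hv, hv0, hvi, huv⟩ := exists_good_representative hs0 hs'.ne hL hu0
  have hvL : MemLp v s (productVolume g n) := hL.ae_eq huv
  have hsteiner : steiner u =ᵐ[productVolume g n] steiner v := steiner_congr_ae huv
  have hvsL : MemLp (steiner v) s (productVolume g n) :=
    memLp_steiner hs.le hs'.ne hv hv0 hvi hvL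
  obtain ⟨H, hH⟩ := exists_denseRange_halfSpace (n := n)
  have hsweep : ∀ k, Measurable (prodSweep H k v) ∧
      ∃ Y : ∀ p : M × Eucl n, ProdTangent (m := m) p,
        IsWeakGradient g (prodSweep H k v) Y ∧ fieldNorm g s Y = fieldNorm g s X := fun k =>
    prodSweep_induction (P := fun w => Measurable w ∧
      ∃ Y : ∀ p : M × Eucl n, ProdTangent (m := m) p,
        IsWeakGradient g w Y ∧ fieldNorm g s Y = fieldNorm g s X)
      (fun H' w ⟨hw, Y, hY, hYn⟩ =>
        ⟨measurable_polarize (measurable_prodReflect H') (measurable_prodHeight H') hw,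
          polField H' w Y, hY.polField hw H', (fieldNorm_polField g H' hs0 hs'.ne hw Y).trans hYn⟩)
      H k ⟨hv, X, hX.congr_ae huv, rfl⟩
  choose hwm Y hY hYn using hsweep
  obtain ⟨Z, hZ, hZL, hZn⟩ := exists_isWeakGradient_of_tendsto hs hs' hY
    (fun k => (hwm k).aestronglyMeasurable) hvsL
    (tendsto_eLpNorm_prodSweep hs.le hs'.ne hv hv0 hvi hvL hH) hXL.2.ne
    (fun k => (hYn k).le)
  refine ⟨hvsL.ae_eq hsteiner.symm, ?_, Z, hZ.congr_ae hsteiner.symm, hZL, hZn⟩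
  have hr0 : 0 < s.toReal := ENNReal.toReal_pos hs0 hs'.ne
  filter_upwards [hsteiner, ae_snd_ne_zero (n := n) (ν := riemannianVolume g)] with p hp hz
  rw [hp, steiner_eq_rearr]
  exact (Vanishing.of_integrable_rpow (hv.comp measurable_prodMk_left) (fun z => hv0 _) hr0
    (hvi p.1)).rearr_nonneg hz

lemma IsWeakGradient.fieldNorm_eq {g : SmoothMetric m M} {u : M × Eucl n → ℝ}
    {X Y : ∀ p : M × Eucl n, ProdTangent (m := m) p} (hX : IsWeakGradient g u X)
    (hY : IsWeakGradient g u Y) (s : ℝ≥0∞) : fieldNorm g s X = fieldNorm g s Y :=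
  eLpNorm_congr_ae (hX.fieldLength_ae_eq hY)

end SteinerProduct

end

theorem theorem1 {m n : ℕ} {M : Type*} [TopologicalSpace M] [T2Space M] [CompactSpace M]
    [ChartedSpace (EuclideanSpace ℝ (Fin m)) M] [IsManifold (𝓡 m) ∞ M]
    [MeasurableSpace M] [BorelSpace M]
    (g : SteinerProduct.SmoothMetric m M) (s : ℝ≥0∞) (hs : 1 < s) (hs' : s < ⊤)
    (u : M × EuclideanSpace ℝ (Fin n) → ℝ) (hu : SteinerProduct.MemSobolevOnePos g s u) :
    SteinerProduct.MemSobolevOnePos g s (SteinerProduct.steiner u) ∧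
      ∀ X Y : ∀ p : M × EuclideanSpace ℝ (Fin n), SteinerProduct.ProdTangent (m := m) p,
        SteinerProduct.IsWeakGradient g u X →
        SteinerProduct.IsWeakGradient g (SteinerProduct.steiner u) Y →
        SteinerProduct.fieldNorm g s Y ≤ SteinerProduct.fieldNorm g s X := by
  rcases Nat.eq_zero_or_pos n with rfl | hn
  · rw [SteinerProduct.steiner_of_dim_zero]
    exact ⟨hu, fun X Y hX hY => (hY.fieldNorm_eq hX s).le⟩
  · have : NeZero n := ⟨hn.ne'⟩
    obtain ⟨⟨hL, X₀, hX₀, hXL⟩, hu0⟩ := hu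
    obtain ⟨hsL, hs0, Z, hZ, hZL, hZn⟩ :=
      SteinerProduct.exists_isWeakGradient_steiner hs hs' hL hu0 hX₀ hXL
    refine ⟨⟨⟨hsL, Z, hZ, hZL⟩, hs0⟩, fun X Y hX hY => ?_⟩
    rw [hY.fieldNorm_eq hZ s, hX.fieldNorm_eq hX₀ s]
    exact hZn
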